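/- Let $n\ge 1$ and let $(Y,\xi)$ be a contact manifold of dimension $2n+1$ (smooth, Hausdorff, second countable, without boundary). A \emph{Weinstein hypersurface} in $(Y,\xi)$ is a compact smoothly embedded hypersurface with boundary $\Sigma\subset Y$ together with a contact form $\lambda$ for $\xi$ (so $\xi=\ker\lambda$) such that $d\lambda|_\Sigma$ is symplectic and the Liouville field $Z$ on $\Sigma$, defined by $\iota_Z d\lambda|_\Sigma=\lambda|_\Sigma$, points strictly outward along $\partial\Sigma$ and admits a smooth Lyapunov function $\phi:\Sigma\to\mathbb R$, i.e. $d\phi(Z)\ge c\|Z\|^2$ for a constant $c>0$ and some Riemannian metric on $\Sigma$. Its core is $\mathrm{Core}(\Sigma)=\bigcap_{t>0}Z^{-t}(\Sigma)$, where $Z^{-t}$ is the time $-t$ flow map of $Z$. A \emph{contact surrounding} $U(\Sigma)$ of $\Sigma$ is a subset of $Y$ obtained as follows. Choose $\varepsilon>0$ and a larger Weinstein hypersurface $\widetilde\Sigma\supset\Sigma$, with the same contact form $\lambda$, such that the closure of $\widetilde\Sigma\setminus\Sigma$ is a collar $\partial\Sigma\times[1,1+\varepsilon]$ (with $\partial\Sigma\times\{1\}=\partial\Sigma$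 and $\partial\Sigma\times\{1+\varepsilon\}=\partial\widetilde\Sigma$) on which $\lambda|_{\widetilde\Sigma}=t\,\lambda|_{\partial\Sigma}$, $t\in[1,1+\varepsilon]$. Choose a smooth embedding $\widetilde\Sigma\times(-\varepsilon,\varepsilon)\to Y$ which is the inclusion on $\widetilde\Sigma\times\{0\}$ and pulls $\lambda$ back to $\pi^*(\lambda|_{\widetilde\Sigma})+du$, where $u$ is the second coordinate and $\pi$ the projection to $\widetilde\Sigma$. Choose a smooth function $h:\widetilde\Sigma\to[0,\infty)$ with $h=0$ on $\Sigma$, with $dh(\widetilde Z)>0$ on $\widetilde\Sigma\setminus\Sigma$ ($\widetilde Z$ being the Liouville field of $\widetilde\Sigma$), and with $h=t-1$ near $\partial\widetilde\Sigma$. Choose $0<\delta<\varepsilon$. Then $U(\Sigma)$ is the image in $Y$ of $\{(x,u)\in\widetilde\Sigma\times(-\varepsilon,\varepsilon): h(x)^2+u^2\le\delta^2\}$. \textbf{Proposition.} Let $\Sigma$ be a Weinstein hypersurface in a contact manifold $(Y,\xi)$ and let $U(\Sigma)$ be a contact surrounding of $\Sigma$. Then $Y\setminus\overline{U(\Sigma)}$,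 $Y\setminus\Sigma$ and $Y\setminus\mathrm{Core}(\Sigma)$ are open in $Y$, and, with the contact structures induced by $\xi$, they are pairwise contactomorphic, i.e. related by diffeomorphisms that carry $\xi$ to $\xi$. -/

import Mathlib

open Set Topology
open scoped Manifold ContDiff

namespace ContactGeometry

section Forms

variable {E : Type*} [NormedAddCommGroup E] [NormedSpace ℝ E]
  {H : Type*} [TopologicalSpace H] (I : ModelWithCorners ℝ E H)
  {E' : Type*} [NormedAddCommGroup E'] [NormedSpace ℝ E']
  {H' : Type*} [TopologicalSpace H'] (I' : ModelWithCorners ℝ E' H')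
  {M : Type*} [TopologicalSpace M] [ChartedSpace H M]
  {N : Type*} [TopologicalSpace N] [ChartedSpace H' N]

variable (M) in
/-- A (not necessarily smooth) differential 1-form on `M`. -/
abbrev OneForm : Type _ := (x : M) → TangentSpace I x →L[ℝ] ℝ

/-- Smoothness of a 1-form, as a section of the cotangent bundle. -/
def IsSmoothForm [IsManifold I ∞ M] (α : OneForm I M) : Prop :=
  ContMDiff I (I.prod 𝓘(ℝ, E →L[ℝ] ℝ)) ∞
    (fun x ↦ Bundle.TotalSpace.mk' (E →L[ℝ] ℝ)
      (E := fun x : M ↦ TangentSpace I x →L[ℝ] ℝ) x (α x))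

/-- The pull-back `f^* α` of a 1-form. -/
noncomputable def pullback (f : M → N) (α : OneForm I' N) : OneForm I M :=
  fun x ↦ (α (f x)).comp (mfderiv I I' f x)

/-- The differential `df` of a real function. -/
noncomputable def differential (f : M → ℝ) : OneForm I M :=
  fun x ↦ (mfderiv I 𝓘(ℝ, ℝ) f x : TangentSpace I x →L[ℝ] ℝ)

/-- The 1-form `α` read in the preferred chart at `x`, as a map `E → E^*`. -/
noncomputable def localForm (α : OneForm I M) (x : M) : E → E →L[ℝ] ℝ :=
  fun z ↦ (α ((extChartAt I x).symm z)).comp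
    (mfderivWithin 𝓘(ℝ, E) I (extChartAt I x).symm (range I) z)

/-- The exterior derivative `dα` at the point `x`, computed in the preferred chart at `x`
(which is the chart through which `TangentSpace I x` is identified with `E`). -/
noncomputable def extDer (α : OneForm I M) (x : M) (v w : TangentSpace I x) : ℝ :=
  fderivWithin ℝ (localForm I α x) (range I) (extChartAt I x x) v w
    - fderivWithin ℝ (localForm I α x) (range I) (extChartAt I x x) w v

/-- The contact condition at `x`: `α` does not vanish at `x` and `dα` is nondegenerate on the
hyperplane `ker α` (in dimension `2 n + 1`: `α ∧ (dα)^n ≠ 0` at `x`). -/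
def IsContactAt (α : OneForm I M) (x : M) : Prop :=
  α x ≠ 0 ∧ ∀ v : TangentSpace I x, α x v = 0 →
    (∀ w : TangentSpace I x, α x w = 0 → extDer I α x v w = 0) → v = 0

variable (M) in
/-- A field of linear subspaces of the tangent spaces. -/
abbrev PlaneField : Type _ := (x : M) → Submodule ℝ (TangentSpace I x)

/-- `α` is a (global) contact form for `ξ`. -/
structure IsContactFormFor [IsManifold I ∞ M] (α : OneForm I M) (ξ : PlaneField I M) : Prop where
  smooth : IsSmoothForm I α
  contact : ∀ x, IsContactAt I α x
  ker_eq : ∀ x (v : TangentSpace I x), v ∈ ξ x ↔ α x v = 0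

/-- `ξ` is a contact structure: near every point it is the kernel of a contact form. (A form
defined near a point may be cut off, so it may be taken to be smooth on the whole of `M`.) -/
def IsContactStructure [IsManifold I ∞ M] (ξ : PlaneField I M) : Prop :=
  ∀ x₀ : M, ∃ α : OneForm I M, IsSmoothForm I α ∧
    ∀ᶠ x in 𝓝 x₀, IsContactAt I α x ∧ ∀ v : TangentSpace I x, v ∈ ξ x ↔ α x v = 0

/-- The subsets `A` and `B` of `M` are open and `(A, ξ)`, `(B, ξ)` are contactomorphic: there is a
smooth diffeomorphism from `A` onto `B` whose differential maps `ξ` onto `ξ`. -/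
def AreContactomorphic (ξ : PlaneField I M) (A B : Set M) : Prop :=
  ∃ f : PartialDiffeomorph I I M M ∞, f.source = A ∧ f.target = B ∧
    ∀ x ∈ A, (ξ x).map (mfderiv I I f x : TangentSpace I x →ₗ[ℝ] TangentSpace I (f x)) = ξ (f x)

end Forms

section Weinstein

variable {n : ℕ} [NeZero n]
  {Y : Type*} [TopologicalSpace Y] [ChartedSpace (EuclideanSpace ℝ (Fin (2 * n + 1))) Y]
  [IsManifold (𝓡 (2 * n + 1)) ∞ Y]
  {S : Type*} [TopologicalSpace S] [CompactSpace S] [ChartedSpace (EuclideanHalfSpace (2 * n)) S]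
  [IsManifold (𝓡∂ (2 * n)) ∞ S]

/-- `φ` is a Lyapunov function for the vector field `Z` on `S`: `dφ(Z) ≥ c ‖Z‖²` for some positive
constant `c` and some Riemannian metric on `S`. -/
def IsLyapunov (Z : (x : S) → TangentSpace (𝓡∂ (2 * n)) x) (φ : S → ℝ) : Prop :=
  ContMDiff (𝓡∂ (2 * n)) 𝓘(ℝ, ℝ) ∞ φ ∧
  ∃ g : Bundle.ContMDiffRiemannianMetric (𝓡∂ (2 * n)) ∞ (EuclideanSpace ℝ (Fin (2 * n)))
      (fun x : S ↦ TangentSpace (𝓡∂ (2 * n)) x),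
    ∃ c : ℝ, 0 < c ∧ ∀ x, c * g.inner x (Z x) (Z x) ≤ differential (𝓡∂ (2 * n)) φ x (Z x)

/-- A tangent vector at a boundary point points strictly out of the manifold: in the preferred
chart at `x`, where the manifold is `{z | 0 ≤ z 0}`, its coordinate number `0` is negative. -/
def IsOutward (x : S) (v : TangentSpace (𝓡∂ (2 * n)) x) : Prop :=
  (show EuclideanSpace ℝ (Fin (2 * n)) from v) 0 < 0

variable (S) in
/-- A Weinstein hypersurface in `(Y, ξ)`, given as the image of a smooth embedding of a compact
manifold with boundary `S` of dimension `2 n`, together with a contact form `form` for `ξ` whose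
restriction to the hypersurface is the Liouville form of a Weinstein structure. -/
structure WeinsteinHypersurface (ξ : PlaneField (𝓡 (2 * n + 1)) Y) where
  /-- the contact form `λ` -/
  form : OneForm (𝓡 (2 * n + 1)) Y
  isContactFormFor : IsContactFormFor (𝓡 (2 * n + 1)) form ξ
  /-- the embedding of the hypersurface -/
  emb : S → Y
  isSmoothEmbedding : Manifold.IsSmoothEmbedding (𝓡∂ (2 * n)) (𝓡 (2 * n + 1)) ∞ emb
  /-- the restriction of `dλ` to the hypersurface is symplectic -/
  symplectic : ∀ (x : S) (v : TangentSpace (𝓡∂ (2 * n)) x),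
    (∀ w : TangentSpace (𝓡∂ (2 * n)) x, extDer (𝓡 (2 * n + 1)) form (emb x)
      (mfderiv (𝓡∂ (2 * n)) (𝓡 (2 * n + 1)) emb x v)
      (mfderiv (𝓡∂ (2 * n)) (𝓡 (2 * n + 1)) emb x w) = 0) → v = 0
  /-- the Liouville vector field `Z`, which is dual to the restriction of `λ` -/
  liouville : (x : S) → TangentSpace (𝓡∂ (2 * n)) x
  liouville_smooth : ContMDiff (𝓡∂ (2 * n)) (𝓡∂ (2 * n)).tangent ∞
    (fun x ↦ (⟨x, liouville x⟩ : TangentBundle (𝓡∂ (2 * n)) S))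
  liouville_dual : ∀ (x : S) (w : TangentSpace (𝓡∂ (2 * n)) x),
    extDer (𝓡 (2 * n + 1)) form (emb x)
      (mfderiv (𝓡∂ (2 * n)) (𝓡 (2 * n + 1)) emb x (liouville x))
      (mfderiv (𝓡∂ (2 * n)) (𝓡 (2 * n + 1)) emb x w)
      = pullback (𝓡∂ (2 * n)) (𝓡 (2 * n + 1)) emb form x w
  outward : ∀ x ∈ (𝓡∂ (2 * n)).boundary S, IsOutward x (liouville x)
  exists_lyapunov : ∃ φ : S → ℝ, IsLyapunov liouville φ

namespace WeinsteinHypersurface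

variable {ξ : PlaneField (𝓡 (2 * n + 1)) Y}

/-- The hypersurface as a subset of `Y`. -/
def carrier (W : WeinsteinHypersurface S ξ) : Set Y := range W.emb

/-- The Liouville form of the hypersurface: the restriction of `λ` to it. -/
noncomputable def liouvilleForm (W : WeinsteinHypersurface S ξ) : OneForm (𝓡∂ (2 * n)) S :=
  pullback (𝓡∂ (2 * n)) (𝓡 (2 * n + 1)) W.emb W.form

/-- `Z^{-t}(S)`: the set of the points at which the flow of the Liouville field, started from a
point of `S`, arrives at time `-t`. -/
def flowImage (W : WeinsteinHypersurface S ξ) (t : ℝ) : Set S :=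
  {x | ∃ γ : ℝ → S, IsMIntegralCurveOn γ W.liouville (Icc (-t) 0) ∧ γ (-t) = x}

/-- The core (skeleton) `⋂_{t > 0} Z^{-t}(S)`, as a subset of `Y`. -/
def core (W : WeinsteinHypersurface S ξ) : Set Y :=
  W.emb '' ⋂ t : Ioi (0 : ℝ), W.flowImage t

end WeinsteinHypersurface

/-- A contact surrounding of the Weinstein hypersurface `W`, together with the choices made in its
construction. Here `S'` is the manifold underlying the larger Weinstein hypersurface, and `B` is the
manifold underlying the boundary of `W`. -/
structure ContactSurrounding {ξ : PlaneField (𝓡 (2 * n + 1)) Y} (W : WeinsteinHypersurface S ξ)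
    (S' : Type*) [TopologicalSpace S'] [CompactSpace S']
    [ChartedSpace (EuclideanHalfSpace (2 * n)) S'] [IsManifold (𝓡∂ (2 * n)) ∞ S']
    (B : Type*) [TopologicalSpace B] [ChartedSpace (EuclideanSpace ℝ (Fin (2 * n - 1))) B]
    [IsManifold (𝓡 (2 * n - 1)) ∞ B] where
  /-- the size of the collar and of the thickening -/
  ε : ℝ
  ε_pos : 0 < ε
  /-- the larger Weinstein hypersurface, with the same contact form -/
  ext : WeinsteinHypersurface S' ξ
  ext_form : ext.form = W.form
  subset_ext : W.carrier ⊆ ext.carrier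
  /-- the parametrization of the collar by `B × [1, 1 + ε]`; the second coordinate is `t` -/
  collar : B × ℝ → S'
  collar_smooth : ContMDiffOn ((𝓡 (2 * n - 1)).prod 𝓘(ℝ, ℝ)) (𝓡∂ (2 * n)) ∞ collar
    (univ ×ˢ Icc 1 (1 + ε))
  collar_embedding : IsEmbedding ((univ ×ˢ Icc 1 (1 + ε) : Set (B × ℝ)).domRestrict collar)
  collar_immersion : ∀ p ∈ (univ ×ˢ Icc 1 (1 + ε) : Set (B × ℝ)), Function.Injective
    (mfderivWithin ((𝓡 (2 * n - 1)).prod 𝓘(ℝ, ℝ)) (𝓡∂ (2 * n)) collar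
      (univ ×ˢ Icc 1 (1 + ε)) p)
  /-- the collar is attached along the boundary of `W` ... -/
  collar_start : range (fun b : B ↦ ext.emb (collar (b, 1))) = W.emb '' (𝓡∂ (2 * n)).boundary S
  /-- ... covers the complement of `W` ... -/
  collar_range : collar '' (univ ×ˢ Ioc 1 (1 + ε)) = {x | ext.emb x ∉ W.carrier}
  /-- ... and ends at the boundary of the larger hypersurface. -/
  collar_end : collar '' (univ ×ˢ {1 + ε}) = (𝓡∂ (2 * n)).boundary S'
  /-- on the collar the Liouville form is `t` times its restriction to the boundary of `W` -/
  collar_form : ∀ p ∈ (univ ×ˢ Icc 1 (1 + ε) : Set (B × ℝ)),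
    (ext.liouvilleForm (collar p)).comp
      (mfderivWithin ((𝓡 (2 * n - 1)).prod 𝓘(ℝ, ℝ)) (𝓡∂ (2 * n)) collar
        (univ ×ˢ Icc 1 (1 + ε)) p)
      = p.2 • pullback ((𝓡 (2 * n - 1)).prod 𝓘(ℝ, ℝ)) (𝓡∂ (2 * n))
          (fun q : B × ℝ ↦ collar (q.1, 1)) ext.liouvilleForm p
  /-- the parametrization of the thickening of the larger hypersurface -/
  thick : S' × (⟨Ioo (-ε) ε, isOpen_Ioo⟩ : TopologicalSpace.Opens ℝ) → Y
  thick_isSmoothEmbedding :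
    Manifold.IsSmoothEmbedding ((𝓡∂ (2 * n)).prod 𝓘(ℝ, ℝ)) (𝓡 (2 * n + 1)) ∞ thick
  thick_zero : ∀ p, (p.2 : ℝ) = 0 → thick p = ext.emb p.1
  /-- `λ = π^* (λ|_{S'}) + du` on the thickening -/
  thick_form :
    pullback ((𝓡∂ (2 * n)).prod 𝓘(ℝ, ℝ)) (𝓡 (2 * n + 1)) thick ext.form
      = pullback ((𝓡∂ (2 * n)).prod 𝓘(ℝ, ℝ)) (𝓡∂ (2 * n)) Prod.fst ext.liouvilleForm
        + differential ((𝓡∂ (2 * n)).prod 𝓘(ℝ, ℝ)) (fun q ↦ (q.2 : ℝ))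
  /-- the profile function -/
  h : S' → ℝ
  h_smooth : ContMDiff (𝓡∂ (2 * n)) 𝓘(ℝ, ℝ) ∞ h
  h_nonneg : ∀ x, 0 ≤ h x
  h_zero : ∀ x, ext.emb x ∈ W.carrier → h x = 0
  /-- off `W` the function `h` increases along the Liouville field -/
  h_increasing : ∀ x, ext.emb x ∉ W.carrier →
    0 < differential (𝓡∂ (2 * n)) h x (ext.liouville x)
  /-- `h = t - 1` near the boundary of the larger hypersurface -/
  h_end : ∃ t₀ ∈ Ico 1 (1 + ε), ∀ (b : B), ∀ t ∈ Icc t₀ (1 + ε), h (collar (b, t)) = t - 1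
  /-- the radius of the surrounding -/
  δ : ℝ
  δ_pos : 0 < δ
  δ_lt : δ < ε

/-- The subset `U = {h ^ 2 + u ^ 2 ≤ δ ^ 2}` of `Y`. -/
def ContactSurrounding.carrier {ξ : PlaneField (𝓡 (2 * n + 1)) Y} {W : WeinsteinHypersurface S ξ}
    {S' : Type*} [TopologicalSpace S'] [CompactSpace S']
    [ChartedSpace (EuclideanHalfSpace (2 * n)) S'] [IsManifold (𝓡∂ (2 * n)) ∞ S']
    {B : Type*} [TopologicalSpace B] [ChartedSpace (EuclideanSpace ℝ (Fin (2 * n - 1))) B]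
    [IsManifold (𝓡 (2 * n - 1)) ∞ B] (U : ContactSurrounding W S' B) : Set Y :=
  U.thick '' {p | U.h p.1 ^ 2 + (p.2 : ℝ) ^ 2 ≤ U.δ ^ 2}

end Weinstein

end ContactGeometry

/-! On the thickening λ = λ_Σ + du, so the field Q = Z + u ∂_u satisfies λ(Q) = u and ι_Q dλ = λ_Σ =
λ - du: it is the contact field of the Hamiltonian u, and it expands λ. The function ρ = h² + u²
grows along it, because dρ(Q) = 2h dh(Z) + 2u² is positive wherever ρ > 0. For 0 ≤ r < ε² the
sublevel set {ρ ≤ r} is compact in Y. It is Σ for r = 0 and U(Σ) for r = δ². So it suffices that the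
complement of every such sublevel set is contactomorphic to the complement of the core.

Compression. The contact field X of g(ρ)u, with g a cut-off equal to 1 on ρ ≤ a, has compact support
and hence a complete flow by contactomorphisms. In general X ≠ g(ρ)Q, but still dρ(X) = g(ρ) dρ(Q)
(`IsContactWell.differential_contactField`), so ρ never decreases along X. An orbit that stays in {ρ
≤ a} for all positive times must have ρ = 0: otherwise compactness bounds the growth rate of ρ below
by a positive constant. On Σ one has X = Z, so the orbit starts in the core. Therefore the images of
{ρ ≤ a} under the backward flow shrink to the core, and every neighbourhood of the core contains one
of them (`IsContactWell.exists_compression`).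

Infinite composition. Take levels b_k decreasing to m and neighbourhoods V_k of the core with
intersection the core. Composing compressions θ_k supported in {ρ ≤ b_k} gives contactomorphisms
that stabilise off {ρ ≤ m} and push {ρ ≤ b_(k+1)} into V_k. Their limit maps the complement of {ρ ≤
m} onto the complement of the core (`areContactomorphic_of_compressible`).

The analytic input is the smooth flow of a contact field. Local flows come from the inverse function
theorem on a space of paths, and the kernel of λ is invariant because λ of a transported vector
solves a homogeneous linear equation. -/

namespace ContactGeometry

/-! ### Smoothness of postcomposition on spaces of continuous maps. -/

section Superposition

universe u

variable {K : Type*} [TopologicalSpace K] [CompactSpace K]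
  {E F : Type u} [NormedAddCommGroup E] [NormedSpace ℝ E] [NormedAddCommGroup F] [NormedSpace ℝ F]

variable (K E F) in
/-- Pointwise application of a continuous family of operators, as a continuous bilinear map. -/
noncomputable def pointwiseApply : C(K, E →L[ℝ] F) →L[ℝ] C(K, E) →L[ℝ] C(K, F) :=
  LinearMap.mkContinuous₂
    (LinearMap.mk₂ ℝ (fun (A : C(K, E →L[ℝ] F)) (η : C(K, E)) ↦
        (⟨fun t ↦ A t (η t), by fun_prop⟩ : C(K, F)))
      (fun _ _ _ ↦ by ext; simp) (fun _ _ _ ↦ by ext; simp) (fun _ _ _ ↦ by ext; simp)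
      (fun _ _ _ ↦ by ext; simp)) 1
    (fun A η ↦ by
      rw [one_mul, ContinuousMap.norm_le _ (by positivity)]
      exact fun t ↦ (A t).le_of_opNorm_le_of_le (A.norm_coe_le_norm t) (η.norm_coe_le_norm t))

/-- The mean value inequality bounds the error at each t by the oscillation of DX near γ t. This is
uniformly small because the range of γ is compact. -/
theorem hasFDerivAt_postcomp {X : E → F} (hX : ContDiff ℝ 1 X) (γ : C(K, E)) :
    HasFDerivAt (fun γ : C(K, E) ↦ (⟨X, hX.continuous⟩ : C(E, F)).comp γ)
      (pointwiseApply K E F ((⟨fderiv ℝ X, hX.continuous_fderiv one_ne_zero⟩ :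
        C(E, E →L[ℝ] F)).comp γ)) γ := by
  rw [hasFDerivAt_iff_isLittleO_nhds_zero, Asymptotics.isLittleO_iff]
  intro c hc
  have hunif := (isCompact_range γ.continuous).uniformContinuousAt_of_continuousAt (fderiv ℝ X)
    (fun x _ ↦ (hX.continuous_fderiv one_ne_zero).continuousAt) (Metric.dist_mem_uniformity hc)
  obtain ⟨δ, hδ, hδ'⟩ := Metric.mem_uniformity_dist.1 hunif
  filter_upwards [Metric.ball_mem_nhds (0 : C(K, E)) hδ] with η hη
  rw [ContinuousMap.norm_le _ (by positivity)]
  intro t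
  have hηt : ‖η t‖ < δ := (η.norm_coe_le_norm t).trans_lt (by simpa using hη)
  have key := (convex_ball (γ t) δ).norm_image_sub_le_of_norm_hasFDerivWithin_le'
    (f := X) (f' := fderiv ℝ X) (φ := fderiv ℝ X (γ t)) (C := c) (x := γ t) (y := γ t + η t)
    (fun x _ ↦ ((hX.differentiable one_ne_zero) x).hasFDerivAt.hasFDerivWithinAt)
    (fun x hx ↦ by
      have := hδ' (a := γ t) (b := x) (by rw [dist_comm]; exact hx) (mem_range_self t)
      rw [← dist_eq_norm, dist_comm]
      exact (le_of_lt this))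
    (Metric.mem_ball_self hδ) (by simpa using hηt)
  simp only [add_sub_cancel_left] at key
  exact key.trans (by gcongr; exact η.norm_coe_le_norm t)

/-- The derivative is postcomposition with DX followed by a bounded bilinear map, so induction
applies. The target F varies in the induction, since DX takes values in E →L[ℝ] F; this is why E and
F share a universe. -/
theorem contDiff_postcomp_nat (n : ℕ) : ∀ {F : Type u} [NormedAddCommGroup F] [NormedSpace ℝ F]
    {X : E → F} (hX : ContDiff ℝ n X),
    ContDiff ℝ n (fun γ : C(K, E) ↦ (⟨X, hX.continuous⟩ : C(E, F)).comp γ) := by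
  induction n with
  | zero =>
    intro F _ _ X hX
    exact contDiff_zero.2 (ContinuousMap.continuous_postcomp _)
  | succ n ih =>
    intro F _ _ X hX
    have h1 : ContDiff ℝ 1 X := hX.of_le (by norm_cast; omega)
    have h2 : ContDiff ℝ n (fderiv ℝ X) :=
      (contDiff_succ_iff_fderiv.1 (by exact_mod_cast hX : ContDiff ℝ (n + 1) X)).2.2
    suffices ContDiff ℝ (n + 1) (fun γ : C(K, E) ↦ (⟨X, h1.continuous⟩ : C(E, F)).comp γ) by
      exact_mod_cast this
    rw [contDiff_succ_iff_fderiv]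
    refine ⟨fun γ ↦ (hasFDerivAt_postcomp h1 γ).differentiableAt, by simp, ?_⟩
    have : fderiv ℝ (fun γ : C(K, E) ↦ (⟨X, h1.continuous⟩ : C(E, F)).comp γ) =
        fun γ ↦ pointwiseApply K E F ((⟨fderiv ℝ X, h2.continuous⟩ :
          C(E, E →L[ℝ] F)).comp γ) := funext fun γ ↦ (hasFDerivAt_postcomp h1 γ).fderiv
    rw [this]
    exact (pointwiseApply K E F).contDiff.comp (ih h2)

theorem contDiff_postcomp {X : E → F} (hX : ContDiff ℝ ∞ X) :
    ContDiff ℝ ∞ (fun γ : C(K, E) ↦ (⟨X, hX.continuous⟩ : C(E, F)).comp γ) :=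
  contDiff_infty.2 fun n ↦ contDiff_postcomp_nat n (hX.of_le (by exact_mod_cast le_top))

end Superposition

/-! ### Smooth local flows from the inverse function theorem on a path space. -/

section LocalFlow

universe u

variable {E : Type u} [NormedAddCommGroup E] [NormedSpace ℝ E]

variable (E) in
/-- The indefinite integral from `0`, as an operator on the continuous paths. -/
noncomputable def pathIntegral : C(unitInterval, E) →L[ℝ] C(unitInterval, E) :=
  LinearMap.mkContinuous
    { toFun := fun η ↦ ⟨fun s ↦ ∫ r in (0 : ℝ)..s, η (projIcc 0 1 zero_le_one r), by
        have h : Continuous fun r ↦ η (projIcc 0 1 zero_le_one r) := by fun_prop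
        exact (intervalIntegral.continuous_primitive (fun a b ↦ h.intervalIntegrable a b) 0).comp
          continuous_subtype_val⟩
      map_add' := fun η η' ↦ by
        ext s
        have h (η : C(unitInterval, E)) : Continuous fun r ↦ η (projIcc 0 1 zero_le_one r) := by
          fun_prop
        exact intervalIntegral.integral_add ((h η).intervalIntegrable _ _)
          ((h η').intervalIntegrable _ _)
      map_smul' := fun c η ↦ by
        ext s
        exact intervalIntegral.integral_smul c _ } 1
    (fun η ↦ by
      rw [one_mul, ContinuousMap.norm_le _ (norm_nonneg _)]
      intro s
      have := intervalIntegral.norm_integral_le_of_norm_le_const (a := 0) (b := (s : ℝ))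
        (f := fun r ↦ η (projIcc 0 1 zero_le_one r)) (C := ‖η‖) (fun r _ ↦ η.norm_coe_le_norm _)
      refine this.trans ?_
      rw [sub_zero, abs_of_nonneg s.2.1]
      exact mul_le_of_le_one_right (norm_nonneg _) s.2.2)

theorem pathIntegral_apply (η : C(unitInterval, E)) (s : unitInterval) :
    pathIntegral E η s = ∫ r in (0 : ℝ)..s, η (projIcc 0 1 zero_le_one r) := rfl

end LocalFlow

section LocalFlow

universe u

variable {E : Type u} [NormedAddCommGroup E] [NormedSpace ℝ E] 

/-- The operator whose zeros over `(x, t)` are the solutions of `γ' = t X(γ)` with `γ 0 = x`. -/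
noncomputable def pathOperator {X : E → E} (hX : ContDiff ℝ ∞ X)
    (v : (E × ℝ) × C(unitInterval, E)) : (E × ℝ) × C(unitInterval, E) :=
  (v.1, v.2 - ContinuousMap.const _ v.1.1
    - v.1.2 • pathIntegral E ((⟨X, hX.continuous⟩ : C(E, E)).comp v.2))

theorem contDiff_pathOperator {X : E → E} (hX : ContDiff ℝ ∞ X) :
    ContDiff ℝ ∞ (pathOperator hX) := by
  refine contDiff_fst.prodMk ((contDiff_snd.sub ?_).sub ?_)
  · exact (ContinuousLinearMap.const ℝ unitInterval : E →L[ℝ] C(unitInterval, E)).contDiff.comp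
      (contDiff_fst.comp contDiff_fst)
  · exact (contDiff_snd.comp contDiff_fst).smul
      ((pathIntegral E).contDiff.comp ((contDiff_postcomp hX).comp contDiff_snd))

/-- The shear `(p, η) ↦ (p, η - B p)`. -/
noncomputable def shear {V W : Type*} [NormedAddCommGroup V] [NormedSpace ℝ V]
    [NormedAddCommGroup W] [NormedSpace ℝ W] (B : V →L[ℝ] W) : (V × W) ≃L[ℝ] (V × W) :=
  ContinuousLinearEquiv.equivOfInverse
    ((ContinuousLinearMap.fst ℝ V W).prod
      (ContinuousLinearMap.snd ℝ V W - B.comp (ContinuousLinearMap.fst ℝ V W)))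
    ((ContinuousLinearMap.fst ℝ V W).prod
      (ContinuousLinearMap.snd ℝ V W + B.comp (ContinuousLinearMap.fst ℝ V W)))
    (fun v ↦ by simp) (fun v ↦ by simp)

/-- At t = 0 the factor t annihilates the γ-derivative of the integral term. What remains is a
shear, which is invertible without any smallness assumption. -/
theorem hasFDerivAt_pathOperator {X : E → E} (hX : ContDiff ℝ ∞ X) (x₀ : E) :
    ∃ L : ((E × ℝ) × C(unitInterval, E)) ≃L[ℝ] ((E × ℝ) × C(unitInterval, E)),
      HasFDerivAt (pathOperator hX) (L : _ →L[ℝ] _) ((x₀, 0), ContinuousMap.const _ x₀) := by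
  set c : E →L[ℝ] C(unitInterval, E) := ContinuousLinearMap.const ℝ unitInterval
  set N : C(unitInterval, E) → C(unitInterval, E) :=
    fun γ ↦ pathIntegral E ((⟨X, hX.continuous⟩ : C(E, E)).comp γ)
  have hN : Differentiable ℝ N :=
    ((pathIntegral E).contDiff.comp (contDiff_postcomp hX)).differentiable (by simp)
  refine ⟨shear (c.comp (ContinuousLinearMap.fst ℝ E ℝ) +
    (ContinuousLinearMap.snd ℝ E ℝ).smulRight (N (c x₀))), ?_⟩
  have hf : HasFDerivAt (fun v : (E × ℝ) × C(unitInterval, E) ↦ v.1) _ ((x₀, (0 : ℝ)), c x₀) :=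
    hasFDerivAt_fst (𝕜 := ℝ)
  have hs : HasFDerivAt (fun v : (E × ℝ) × C(unitInterval, E) ↦ v.2) _ ((x₀, (0 : ℝ)), c x₀) :=
    hasFDerivAt_snd (𝕜 := ℝ)
  have hN' := (hN (c x₀)).hasFDerivAt.comp ((x₀, (0 : ℝ)), c x₀) hs
  have h1 := hf.prodMk ((hs.sub (c.hasFDerivAt.comp _ hf.fst)).sub (hf.snd.smul hN'))
  refine h1.congr_fderiv ?_
  ext v <;> simp [shear, c]

/-- The local inverse of the path operator assigns to (x, t) the path s ↦ ψ(s t, x) on [0, 1]. Its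
value at s = 1 is the flow, smooth jointly in (x, t) because the inverse is. -/
theorem exists_local_flow [CompleteSpace E] {X : E → E} (hX : ContDiff ℝ ∞ X) (x₀ : E) :
    ∃ ψ : ℝ → E → E, ∃ τ > 0, 
      (∀ x ∈ Metric.ball x₀ τ, ψ 0 x = x) ∧
      (∀ x ∈ Metric.ball x₀ τ, ∀ t ∈ Metric.ball (0 : ℝ) τ,
        HasDerivAt (fun t ↦ ψ t x) (X (ψ t x)) t) ∧
      ∀ x ∈ Metric.ball x₀ τ, ∀ t ∈ Metric.ball (0 : ℝ) τ,
        ContDiffAt ℝ ∞ (fun p : E × ℝ ↦ ψ p.2 p.1) (x, t) := by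
  obtain ⟨L, hL⟩ := hasFDerivAt_pathOperator hX x₀
  have hG := contDiff_pathOperator hX
  set c : E →L[ℝ] C(unitInterval, E) := ContinuousLinearMap.const ℝ unitInterval with hc
  set G := pathOperator hX with hGdef
  set u₀ : (E × ℝ) × C(unitInterval, E) := ((x₀, 0), c x₀)
  set e := hG.contDiffAt.toOpenPartialHomeomorph G hL (by simp)
  have he : ∀ v, e v = G v := fun v ↦ rfl
  have hu₀ : u₀ ∈ e.source := hG.contDiffAt.mem_toOpenPartialHomeomorph_source hL (by simp)
  have hGu₀ : G u₀ = ((x₀, 0), 0) := by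
    simp only [G, pathOperator, u₀, zero_smul, sub_zero]
    exact Prod.ext rfl (sub_self _)
  -- Invertibility of the derivative is an open condition. It is needed at all nearby points, to
  -- make the local inverse smooth there and not only at the centre.
  have hinv : ∀ᶠ v in 𝓝 u₀, v ∈ e.source ∧
      fderiv ℝ G v ∈ range (fun M : ((E × ℝ) × C(unitInterval, E)) ≃L[ℝ]
        ((E × ℝ) × C(unitInterval, E)) ↦ (M : _ →L[ℝ] _)) := by
    refine (e.open_source.eventually_mem hu₀).and ?_
    refine (hG.continuous_fderiv (by simp)).continuousAt.eventually_mem ?_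
    have := ContinuousLinearEquiv.nhds L
    rwa [← hL.fderiv] at this
  obtain ⟨r, hr, hball⟩ := Metric.eventually_nhds_iff_ball.1 hinv
  set Γ : E × ℝ → C(unitInterval, E) := fun p ↦ (e.symm (p, 0)).2
  have htar : ((x₀, (0 : ℝ)), (0 : C(unitInterval, E))) ∈ e.target := by
    rw [← hGu₀]; exact e.map_source hu₀
  have hsymm₀ : e.symm ((x₀, (0 : ℝ)), 0) = u₀ := by
    rw [← hGu₀]; exact e.left_inv hu₀
  have hev : ∀ᶠ p : E × ℝ in 𝓝 (x₀, (0 : ℝ)), ((p, 0) : (E × ℝ) × C(unitInterval, E)) ∈ e.target ∧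
      e.symm (p, 0) ∈ Metric.ball u₀ r := by
    have hcont : Filter.Tendsto (fun p : E × ℝ ↦ ((p, 0) : (E × ℝ) × C(unitInterval, E)))
      (𝓝 (x₀, 0)) (𝓝 ((x₀, 0), 0)) := (by fun_prop : Continuous fun p : E × ℝ ↦ 
        ((p, 0) : (E × ℝ) × C(unitInterval, E))).continuousAt
    refine (hcont.eventually (e.open_target.eventually_mem htar)).and ?_
    refine (Filter.Tendsto.comp (e.symm.continuousAt htar) hcont).eventually ?_
    rw [hsymm₀]
    exact Metric.ball_mem_nhds _ hr
  obtain ⟨τ, hτ, hgood⟩ := Metric.eventually_nhds_iff_ball.1 hev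
  rw [show Metric.ball (x₀, (0 : ℝ)) τ = Metric.ball x₀ τ ×ˢ Metric.ball (0 : ℝ) τ from
    (ball_prod_same _ _ _).symm] at hgood
  have hfst : ∀ p ∈ Metric.ball x₀ τ ×ˢ Metric.ball (0 : ℝ) τ, e.symm (p, 0) = (p, Γ p) := by
    intro p hp
    have := e.right_inv (hgood p hp).1
    rw [he] at this
    exact Prod.ext (congrArg Prod.fst this : (G (e.symm (p, 0))).1 = p) rfl
  have hint : ∀ p ∈ Metric.ball x₀ τ ×ˢ Metric.ball (0 : ℝ) τ, ∀ s : unitInterval,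
      Γ p s = p.1 + p.2 • ∫ r in (0 : ℝ)..s, X (Γ p (projIcc 0 1 zero_le_one r)) := by
    intro p hp s
    have h1 := e.right_inv (hgood p hp).1
    rw [hfst p hp, he] at h1
    have h2 := congrArg (fun v : (E × ℝ) × C(unitInterval, E) ↦ v.2 s) h1
    simp only [G, pathOperator, ContinuousMap.sub_apply, ContinuousMap.smul_apply,
      pathIntegral_apply, ContinuousMap.const_apply, ContinuousMap.zero_apply] at h2
    rw [sub_sub, sub_eq_zero] at h2
    exact h2
  -- The path r ↦ Γ p (s r) solves the equation for the time s t. Its distance to the constant path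
  -- x₀ is at most that of Γ p, so it stays in the ball where the operator is injective, and hence
  -- equals Γ (x, s t).
  have hscale : ∀ p ∈ Metric.ball x₀ τ ×ˢ Metric.ball (0 : ℝ) τ, ∀ s : unitInterval,
      Γ (p.1, s * p.2) 1 = Γ p s := by
    intro p hp s
    have hp' : (p.1, s * p.2) ∈ Metric.ball x₀ τ ×ˢ Metric.ball (0 : ℝ) τ := by
      refine ⟨hp.1, ?_⟩
      have := hp.2
      simp only [mem_ball_zero_iff, norm_mul] at this ⊢
      refine lt_of_le_of_lt (mul_le_of_le_one_left (norm_nonneg _) ?_) this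
      rw [Real.norm_of_nonneg s.2.1]; exact s.2.2
    set γ : C(unitInterval, E) := (Γ p).comp ⟨fun r ↦ s * r, by fun_prop⟩
    have hmem : ((p.1, s * p.2), γ) ∈ Metric.ball u₀ r := by
      have h1 := (hgood p hp).2
      rw [hfst p hp] at h1
      have h2 := (hgood _ hp').2
      rw [hfst _ hp'] at h2
      rw [Metric.mem_ball, Prod.dist_eq, max_lt_iff] at h1 h2 ⊢
      refine ⟨h2.1, lt_of_le_of_lt ?_ h1.2⟩
      rw [ContinuousMap.dist_le dist_nonneg]
      intro q
      exact ContinuousMap.dist_apply_le_dist (f := Γ p) (g := c x₀) (s * q)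
    have hGγ : G ((p.1, s * p.2), γ) = ((p.1, s * p.2), 0) := by
      refine Prod.ext rfl ?_
      ext q
      simp only [G, pathOperator, ContinuousMap.sub_apply, ContinuousMap.smul_apply,
        pathIntegral_apply, ContinuousMap.const_apply, ContinuousMap.zero_apply]
      rw [sub_sub, sub_eq_zero]
      change Γ p (s * q) = _
      rw [hint p hp (s * q), mul_comm (s : ℝ), mul_smul]
      congr 2
      have h3 := intervalIntegral.smul_integral_comp_mul_left (a := 0) (b := (q : ℝ))
        (f := fun r ↦ X (Γ p (projIcc 0 1 zero_le_one r))) (s : ℝ)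
      rw [mul_zero] at h3
      rw [show ((s * q : unitInterval) : ℝ) = s * q from rfl, ← h3]
      congr 1
      refine intervalIntegral.integral_congr fun r hr ↦ ?_
      rw [uIcc_of_le q.2.1] at hr
      have hr' : r ∈ Icc (0 : ℝ) 1 := ⟨hr.1, hr.2.trans q.2.2⟩
      have hsr : (s : ℝ) * r ∈ Icc (0 : ℝ) 1 := ⟨mul_nonneg s.2.1 hr'.1, mul_le_one₀ s.2.2 hr'.1 hr'.2⟩
      simp only [ContinuousMap.comp_apply, ContinuousMap.coe_mk, γ]
      rw [projIcc_of_mem _ hr', projIcc_of_mem _ hsr]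
      rfl
    have := e.left_inv (hball _ hmem).1
    rw [he, hGγ] at this
    have h4 : Γ (p.1, s * p.2) = γ := congrArg Prod.snd this
    rw [h4]
    simp [γ]
  have hsmooth : ∀ p ∈ Metric.ball x₀ τ ×ˢ Metric.ball (0 : ℝ) τ,
      ContDiffAt ℝ ∞ (fun p ↦ Γ p 1) p := by
    intro p hp
    obtain ⟨hs, L', hL'⟩ := hball _ (hgood p hp).2
    have h1 : ContDiffAt ℝ ∞ e.symm (p, 0) := by
      refine e.contDiffAt_symm (hgood p hp).1 (f₀' := L') ?_ hG.contDiffAt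
      have := (hG.differentiable (by simp) (e.symm (p, 0))).hasFDerivAt
      rw [← hL'] at this
      exact this
    have h2 : ContDiffAt ℝ ∞ (fun p : E × ℝ ↦ e.symm (p, 0)) p :=
      h1.comp p (contDiffAt_id.prodMk contDiffAt_const)
    exact (ContinuousMap.evalCLM ℝ (1 : unitInterval)).contDiff.contDiffAt.comp p h2.snd
  -- By the scaling identity the endpoints t ↦ Γ (x, t) 1 satisfy the integral equation of X in the
  -- true time variable.
  have hint' : ∀ p ∈ Metric.ball x₀ τ ×ˢ Metric.ball (0 : ℝ) τ,
      Γ p 1 = p.1 + ∫ r in (0 : ℝ)..p.2, X (Γ (p.1, r) 1) := by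
    intro p hp
    rw [hint p hp 1]
    congr 1
    have h3 := intervalIntegral.smul_integral_comp_mul_left (a := 0) (b := 1)
        (f := fun r ↦ X (Γ (p.1, r) 1)) p.2
    rw [mul_zero, mul_one] at h3
    rw [← h3]
    congr 1
    refine intervalIntegral.integral_congr fun r hr ↦ ?_
    rw [show ((1 : unitInterval) : ℝ) = 1 from rfl, uIcc_of_le zero_le_one] at hr
    rw [projIcc_of_mem _ hr, mul_comm, hscale p hp ⟨r, hr⟩]
  refine ⟨fun t x ↦ Γ (x, t) 1, τ, hτ, fun x hx ↦ ?_, fun x hx t ht ↦ ?_, fun x hx t ht ↦ 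
    hsmooth (x, t) ⟨hx, ht⟩⟩
  · simpa using hint' (x, 0) ⟨hx, Metric.mem_ball_self hτ⟩
  · have hcont : ContinuousOn (fun r ↦ X (Γ (x, r) 1)) (Metric.ball 0 τ) := fun r hr ↦
      (hX.continuous.continuousAt.comp ((hsmooth (x, r) ⟨hx, hr⟩).continuousAt.comp (f := fun r ↦ (x, r))
        (by fun_prop))).continuousWithinAt
    have hsub : uIcc 0 t ⊆ Metric.ball 0 τ := by
      rw [Real.ball_eq_Ioo] at ht ⊢
      exact (ordConnected_Ioo.uIcc_subset (by simp [hτ]) ht)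
    have h5 := intervalIntegral.integral_hasDerivAt_right
      (hcont.mono hsub).intervalIntegrable
      (hcont.stronglyMeasurableAtFilter Metric.isOpen_ball t ht)
      (hcont.continuousAt (Metric.isOpen_ball.mem_nhds ht))
    refine (h5.const_add x).congr_of_eventuallyEq ?_
    filter_upwards [Metric.isOpen_ball.mem_nhds ht] with r hr
    exact hint' (x, r) ⟨hx, hr⟩

end LocalFlow

/-! ### The variational equation and the invariance of the kernel. -/

section LocalFlow

universe u

variable {E : Type u} [NormedAddCommGroup E] [NormedSpace ℝ E] 

/-- The differential of a local flow satisfies the variational equation. -/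
theorem hasDerivAt_fderiv_flow {X : E → E} {ψ : ℝ → E → E} {x : E} {t : ℝ}
    (hψ : ContDiffAt ℝ ∞ (fun p : E × ℝ ↦ ψ p.2 p.1) (x, t))
    (hX : DifferentiableAt ℝ X (ψ t x))
    (hd : ∀ᶠ p : E × ℝ in 𝓝 (x, t), HasDerivAt (fun t ↦ ψ t p.1) (X (ψ p.2 p.1)) p.2) (v : E) :
    HasDerivAt (fun t ↦ fderiv ℝ (fun p : E × ℝ ↦ ψ p.2 p.1) (x, t) (v, 0))
      (fderiv ℝ X (ψ t x) (fderiv ℝ (fun p : E × ℝ ↦ ψ p.2 p.1) (x, t) (v, 0))) t := by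
  set f : E × ℝ → E := fun p ↦ ψ p.2 p.1
  have hDf : DifferentiableAt ℝ (fderiv ℝ f) (x, t) :=
    (hψ.fderiv_right (m := ∞) (by simp)).differentiableAt (by simp)
  have hf : DifferentiableAt ℝ f (x, t) := hψ.differentiableAt (by simp)
  have hsymm : IsSymmSndFDerivAt ℝ f (x, t) := hψ.isSymmSndFDerivAt
    (by rw [minSmoothness_of_isRCLikeNormedField]; exact WithTop.coe_le_coe.2 le_top)
  have hc : HasDerivAt (fun t : ℝ ↦ (x, t)) ((0 : E), (1 : ℝ)) t :=
    (hasDerivAt_const t x).prodMk (hasDerivAt_id t)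
  have h1 := (hDf.hasFDerivAt.comp_hasDerivAt t hc).clm_apply (hasDerivAt_const t (v, (0 : ℝ)))
  refine h1.congr_deriv ?_
  -- Symmetry of the second derivative exchanges the time derivative with the derivative along v;
  -- the time derivative of the flow is X ∘ ψ, which is then differentiated in space.
  rw [map_zero, add_zero, hsymm.eq]
  have h2 : (fun p ↦ fderiv ℝ f p ((0 : E), (1 : ℝ))) =ᶠ[𝓝 (x, t)] fun p ↦ X (f p) := by
    have hev : ∀ᶠ p in 𝓝 (x, t), DifferentiableAt ℝ f p :=
      ((hψ.of_le (m := 1) (by exact_mod_cast le_top)).eventually (by simp)).mono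
        fun p hp ↦ hp.differentiableAt (by simp)
    filter_upwards [hd, hev] with p hp hp'
    have hc' : HasDerivAt (fun t : ℝ ↦ (p.1, t)) ((0 : E), (1 : ℝ)) p.2 :=
      (hasDerivAt_const _ p.1).prodMk (hasDerivAt_id _)
    exact (hp'.hasFDerivAt.comp_hasDerivAt (f := fun t : ℝ ↦ (p.1, t)) p.2 hc').unique hp
  have h3 : HasFDerivAt (fun p ↦ fderiv ℝ f p ((0 : E), (1 : ℝ))) _ (x, t) :=
    hDf.hasFDerivAt.clm_apply (hasFDerivAt_const ((0 : E), (1 : ℝ)) (x, t))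
  have h4 := (h2.hasFDerivAt_iff.1 h3).unique (hX.hasFDerivAt.comp (x, t) hf.hasFDerivAt)
  have h5 := congrArg (fun L : E × ℝ →L[ℝ] E ↦ L (v, 0)) h4
  simpa using h5

/-- A local flow along which the Lie derivative of a 1-form is a multiple of the form preserves
its kernel. -/
theorem flow_preserves_ker {X : E → E} {lam : E → E →L[ℝ] ℝ} {c : E → ℝ} {Ω : Set E}
    (hΩ : IsOpen Ω) (hX : ContDiffOn ℝ ∞ X Ω) (hlam : ContDiffOn ℝ ∞ lam Ω)
    (hL : ∀ z ∈ Ω, ∀ v, fderiv ℝ lam z (X z) v + lam z (fderiv ℝ X z v) = c z * lam z v)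
    {e : E} (he : ∀ z ∈ Ω, lam z e ≠ 0) {ψ : ℝ → E → E} {x₀ : E} {τ : ℝ}
    (hψ : ∀ x ∈ Metric.ball x₀ τ, ∀ t ∈ Metric.ball (0 : ℝ) τ,
      ContDiffAt ℝ ∞ (fun p : E × ℝ ↦ ψ p.2 p.1) (x, t))
    (hd : ∀ x ∈ Metric.ball x₀ τ, ∀ t ∈ Metric.ball (0 : ℝ) τ,
      HasDerivAt (fun t ↦ ψ t x) (X (ψ t x)) t)
    (h0 : ∀ x ∈ Metric.ball x₀ τ, ψ 0 x = x)
    (hmem : ∀ x ∈ Metric.ball x₀ τ, ∀ t ∈ Metric.ball (0 : ℝ) τ, ψ t x ∈ Ω)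
    {x v : E} (hx : x ∈ Metric.ball x₀ τ) (hv : lam x v = 0) {t : ℝ}
    (ht : t ∈ Metric.ball (0 : ℝ) τ) :
    lam (ψ t x) (fderiv ℝ (ψ t) x v) = 0 := by
  set f : E × ℝ → E := fun p ↦ ψ p.2 p.1
  have hpart : ∀ s ∈ Metric.ball (0 : ℝ) τ, fderiv ℝ (ψ s) x v = fderiv ℝ f (x, s) (v, 0) := by
    intro s hs
    have h1 : HasFDerivAt (fun x : E ↦ (x, s)) ((ContinuousLinearMap.id ℝ E).prod 0) x :=
      (hasFDerivAt_id x).prodMk (hasFDerivAt_const s x)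
    have h2 := (((hψ x hx s hs).differentiableAt (by simp)).hasFDerivAt.comp x h1).fderiv
    have : fderiv ℝ (ψ s) x = _ := h2
    rw [this]
    simp
  -- By the Lie derivative hypothesis y' = c(ψ_s x) y, and y(0) = lam x v = 0, so y vanishes by
  -- uniqueness.
  set y : ℝ → ℝ := fun s ↦ lam (ψ s x) (fderiv ℝ f (x, s) (v, 0))
  have hτ : 0 < τ := Metric.pos_of_mem_ball hx
  have hXd : ∀ z ∈ Ω, DifferentiableAt ℝ X z := fun z hz ↦
    ((hX z hz).contDiffAt (hΩ.mem_nhds hz)).differentiableAt (by simp)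
  have hld : ∀ z ∈ Ω, DifferentiableAt ℝ lam z := fun z hz ↦
    ((hlam z hz).contDiffAt (hΩ.mem_nhds hz)).differentiableAt (by simp)
  have hy : ∀ s ∈ Metric.ball (0 : ℝ) τ, HasDerivAt y (c (ψ s x) * y s) s := by
    intro s hs
    have hz := hmem x hx s hs
    have h1 := hasDerivAt_fderiv_flow (hψ x hx s hs) (hXd _ hz) (by
      filter_upwards [(Metric.isOpen_ball.prod Metric.isOpen_ball).mem_nhds 
        (show (x, s) ∈ Metric.ball x₀ τ ×ˢ Metric.ball (0 : ℝ) τ from ⟨hx, hs⟩)] with p hp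
      exact hd p.1 hp.1 p.2 hp.2) v
    have h2 : HasDerivAt (fun s ↦ lam (ψ s x)) (fderiv ℝ lam (ψ s x) (X (ψ s x))) s :=
      (hld _ hz).hasFDerivAt.comp_hasDerivAt s (hd x hx s hs)
    have h3 := h2.clm_apply h1
    rw [hL _ hz] at h3
    exact h3
  -- The factor c is not assumed continuous. Evaluating the hypothesis on e, where `lam` does not
  -- vanish, expresses it as a continuous quotient; its bound along the orbit is the Lipschitz
  -- constant below.
  have hccont : ContinuousOn c Ω := by
    have h1 : ContinuousOn (fun z ↦ (fderiv ℝ lam z (X z) e + lam z (fderiv ℝ X z e)) / lam z e)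
        Ω := by
      have hX' := hX.continuousOn_fderiv_of_isOpen hΩ (by simp)
      have hl' := hlam.continuousOn_fderiv_of_isOpen hΩ (by simp)
      exact ((((hl'.clm_apply hX.continuousOn).clm_apply continuousOn_const).add
        (hlam.continuousOn.clm_apply (hX'.clm_apply continuousOn_const)))).div
        (hlam.continuousOn.clm_apply continuousOn_const) he
    refine h1.congr fun z hz ↦ ?_
    dsimp only
    rw [hL z hz, mul_div_assoc, div_self (he z hz), mul_one]
  obtain ⟨t₁, ht₁, ht₁τ⟩ := exists_between (show |t| < τ by simpa using ht)
  have hsub : Icc (-t₁) t₁ ⊆ Metric.ball (0 : ℝ) τ := by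
    rw [Real.ball_eq_Ioo]; exact fun s hs ↦ ⟨by linarith [hs.1], by linarith [hs.2]⟩
  have hψc : ContinuousOn (fun s ↦ ψ s x) (Icc (-t₁) t₁) := fun s hs ↦
    (hd x hx s (hsub hs)).continuousAt.continuousWithinAt
  obtain ⟨C, hC⟩ := isCompact_Icc.exists_bound_of_continuousOn
    (hccont.comp hψc fun s hs ↦ hmem x hx s (hsub hs))
  have huniq := ODE_solution_unique_of_mem_Ioo (v := fun s z ↦ c (ψ s x) * z)
    (s := fun _ ↦ univ) (K := C.toNNReal) (a := -t₁) (b := t₁) (t₀ := 0) (f := y) (g := fun _ ↦ 0)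
    (fun s hs ↦ LipschitzWith.lipschitzOnWith (by
      refine LipschitzWith.of_dist_le_mul fun z w ↦ ?_
      rw [Real.dist_eq, Real.dist_eq, ← mul_sub, abs_mul]
      gcongr
      exact (hC s (Ioo_subset_Icc_self hs)).trans (Real.le_coe_toNNReal C)))
    (by have := abs_nonneg t; constructor <;> linarith)
    (fun s hs ↦ ⟨hy s (hsub (Ioo_subset_Icc_self hs)), mem_univ _⟩)
    (fun s hs ↦ ⟨by simpa using hasDerivAt_const s (0 : ℝ), mem_univ _⟩)
    (by
      have h00 : (0 : ℝ) ∈ Metric.ball (0 : ℝ) τ := Metric.mem_ball_self hτ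
      have h6 : fderiv ℝ (ψ 0) x = ContinuousLinearMap.id ℝ E := by
        rw [Filter.EventuallyEq.fderiv_eq (f := id), fderiv_id]
        filter_upwards [Metric.isOpen_ball.mem_nhds hx] with z hz using h0 z hz
      simp only [y]
      rw [← hpart 0 h00, h6, h0 x hx]
      exact hv)
  have := huniq (abs_lt.1 ht₁)
  rw [hpart t ht]
  exact this

end LocalFlow

/-! ### Pull-back and exterior derivative of 1-forms in charts. -/

section Forms

set_option linter.unusedSectionVars false
variable {E : Type*} [NormedAddCommGroup E] [NormedSpace ℝ E]
  {H : Type*} [TopologicalSpace H] {I : ModelWithCorners ℝ E H}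
  {M : Type*} [TopologicalSpace M] [ChartedSpace H M] [IsManifold I ∞ M]

theorem contDiffOn_localForm {α : OneForm I M} (hα : IsSmoothForm I α) (x : M) :
    ContDiffOn ℝ ∞ (localForm I α x) (extChartAt I x).target := by
  have h1 : ContMDiffOn I 𝓘(ℝ, E →L[ℝ] ℝ) ∞ (fun y ↦
    ContinuousLinearMap.inCoordinates E (TangentSpace I) ℝ (Bundle.Trivial M ℝ) x y x y (α y)) (chartAt H x).source := by
    have h2 := ((trivializationAt (E →L[ℝ] ℝ) (fun y : M ↦ TangentSpace I y →L[ℝ] Bundle.Trivial M ℝ y) x).contMDiffOn_section_baseSet_iff (IB := I) (n := ∞) (s := α)).1 hα.contMDiffOn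
    rw [hom_trivializationAt_baseSet] at h2
    simp at h2
    exact h2
  rw [← contMDiffOn_iff_contDiffOn]
  refine (h1.comp (contMDiffOn_extChartAt_symm x) (fun z hz ↦ ?_)).congr ?_
  · have := (extChartAt I x).map_target hz
    rwa [extChartAt_source] at this
  · intro z hz
    have : (extChartAt I x).symm z ∈ (chartAt H x).source := by
      have := (extChartAt I x).map_target hz
      rwa [extChartAt_source] at this
    simp only [Function.comp, localForm, ContinuousLinearMap.inCoordinates]
    rw [TangentBundle.symmL_trivializationAt this, (extChartAt I x).right_inv hz]
    ext v
    simp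

variable {E' : Type*} [NormedAddCommGroup E'] [NormedSpace ℝ E']
  {H' : Type*} [TopologicalSpace H'] {I' : ModelWithCorners ℝ E' H'}
  {N : Type*} [TopologicalSpace N] [ChartedSpace H' N] [IsManifold I' ∞ N]

theorem fderivWithin_writtenInExtChartAt {f : M → N} {x : M} {z : E}
    (hz : z ∈ (extChartAt I x).target)
    (hfz : f ((extChartAt I x).symm z) ∈ (extChartAt I' (f x)).source)
    (hf : MDifferentiableAt I I' f ((extChartAt I x).symm z)) :
    fderivWithin ℝ (writtenInExtChartAt I I' x f) (range I) z =
      (mfderiv I' 𝓘(ℝ, E') (extChartAt I' (f x)) (f ((extChartAt I x).symm z))).comp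
        ((mfderiv I I' f ((extChartAt I x).symm z)).comp
          (mfderivWithin 𝓘(ℝ, E) I (extChartAt I x).symm (range I) z)) := by
  have U : UniqueMDiffWithinAt 𝓘(ℝ, E) (range I) z :=
    I.uniqueMDiffOn z (extChartAt_target_subset_range x hz)
  have h1 := mdifferentiableWithinAt_extChartAt_symm hz
  have h2 : MDifferentiableAt I' 𝓘(ℝ, E') (extChartAt I' (f x)) (f ((extChartAt I x).symm z)) :=
    mdifferentiableAt_extChartAt (by rwa [extChartAt_source] at hfz)
  have h3 := hf.comp_mdifferentiableWithinAt z h1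
  rw [← mfderiv_comp_mfderivWithin z hf h1 U]
  have h4 := mfderiv_comp_mfderivWithin z (f := f ∘ (extChartAt I x).symm) h2 h3 U
  rw [← mfderivWithin_eq_fderivWithin]
  exact h4

/-- Reading a form in a chart is itself a pull-back, so the charts of N cancel. The identity holds
only near x, where f stays in the chosen chart of N. -/
theorem localForm_pullback_eventuallyEq {f : M → N} {x : M}
    (hf : ∀ᶠ y in 𝓝 x, ContMDiffAt I I' ∞ f y) (α : OneForm I' N) :
    ∀ᶠ z in 𝓝[range I] (extChartAt I x x), localForm I (pullback I I' f α) x z =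
      (localForm I' α (f x) (writtenInExtChartAt I I' x f z)).comp
        (fderivWithin ℝ (writtenInExtChartAt I I' x f) (range I) z) := by
  have hcont : Filter.Tendsto (extChartAt I x).symm (𝓝[range I] (extChartAt I x x)) (𝓝 x) := by
    have := (continuousAt_extChartAt_symm (I := I) x).tendsto.mono_left
      (nhdsWithin_le_nhds (s := range I))
    rwa [extChartAt_to_inv] at this
  filter_upwards [extChartAt_target_mem_nhdsWithin x, hcont.eventually hf,
    (hf.self_of_nhds.continuousAt.tendsto.comp hcont).eventually
      (extChartAt_source_mem_nhds (I := I') (f x))] with z hz hfd hfz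
  rw [fderivWithin_writtenInExtChartAt hz hfz (hfd.mdifferentiableAt (by simp))]
  have key : ∀ p ∈ (extChartAt I' (f x)).source, ∀ v : TangentSpace I' p,
      localForm I' α (f x) (extChartAt I' (f x) p)
        (mfderiv I' 𝓘(ℝ, E') (extChartAt I' (f x)) p v) = α p v := by
    intro p hp v
    have h5 := congrArg (fun L ↦ L v) (mfderivWithin_extChartAt_symm_comp_mfderiv_extChartAt' hp)
    have h6 : ∀ q, q = p → ∀ w : E', (α q : E' →L[ℝ] ℝ) w = (α p : E' →L[ℝ] ℝ) w := by
      rintro q rfl w; rfl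
    refine (h6 _ ((extChartAt I' (f x)).left_inv hp) _).trans ?_
    exact congrArg (α p) h5
  ext v
  exact (key _ hfz _).symm

theorem writtenInExtChartAt_self (f : M → N) (x : M) :
    writtenInExtChartAt I I' x f (extChartAt I x x) = extChartAt I' (f x) (f x) := by
  simp [writtenInExtChartAt]

/-- Product rule for z ↦ L(F z) ∘ DF z. The term with D²F is symmetric, so it disappears from the
exterior derivative. M may have a boundary, hence the derivatives within `range I`. -/
theorem hasFDerivWithinAt_localForm_pullback [I'.Boundaryless] {f : M → N} {x : M}
    (hf : ∀ᶠ y in 𝓝 x, ContMDiffAt I I' ∞ f y) {α : OneForm I' N} (hα : IsSmoothForm I' α) :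
    ∃ D : E →L[ℝ] E →L[ℝ] ℝ, HasFDerivWithinAt (localForm I (pullback I I' f α) x) D (range I)
      (extChartAt I x x) ∧
      ∀ v w : E, D v w = localForm I' α (f x) (extChartAt I' (f x) (f x))
        (fderivWithin ℝ (fderivWithin ℝ (writtenInExtChartAt I I' x f) (range I)) (range I)
          (extChartAt I x x) v w) +
        fderivWithin ℝ (localForm I' α (f x)) (range I') (extChartAt I' (f x) (f x))
          (fderivWithin ℝ (writtenInExtChartAt I I' x f) (range I) (extChartAt I x x) v)
          (fderivWithin ℝ (writtenInExtChartAt I I' x f) (range I) (extChartAt I x x) w) := by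
  set F := writtenInExtChartAt I I' x f with hFdef
  set z₀ := extChartAt I x x
  have hz₀ : z₀ ∈ range I := extChartAt_target_subset_range x (mem_extChartAt_target x)
  have U := I.uniqueDiffOn
  have hF : ContDiffWithinAt ℝ ∞ F (range I) z₀ := (contMDiffAt_iff.1 hf.self_of_nhds).2
  have hFz : F z₀ = extChartAt I' (f x) (f x) := writtenInExtChartAt_self f x
  set L := localForm I' α (f x)
  rw [← hFz, I'.range_eq_univ, fderivWithin_univ]
  have hL : HasFDerivAt L (fderiv ℝ L (F z₀)) (F z₀) := by
    rw [hFz]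
    exact (((contDiffOn_localForm hα (f x)).contDiffAt (extChartAt_target_mem_nhds (f x))
      ).differentiableAt (by simp)).hasFDerivAt
  have hF1 := (hF.differentiableWithinAt (by simp)).hasFDerivWithinAt
  have hF2 : HasFDerivWithinAt (fderivWithin ℝ F (range I)) _ (range I) z₀ :=
    ((hF.fderivWithin_right (m := ∞) U (by simp) hz₀).differentiableWithinAt
      (by simp)).hasFDerivWithinAt
  have hcomp := (hL.comp_hasFDerivWithinAt z₀ hF1).clm_comp hF2
  exact ⟨_, hcomp.congr_of_eventuallyEq (localForm_pullback_eventuallyEq hf α)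
    ((localForm_pullback_eventuallyEq hf α).self_of_nhdsWithin hz₀), fun v w ↦ rfl⟩

/-- The exterior derivative commutes with the pull-back. -/
theorem extDer_pullback [I'.Boundaryless] {f : M → N} {x : M}
    (hf : ∀ᶠ y in 𝓝 x, ContMDiffAt I I' ∞ f y) {α : OneForm I' N}
    (hα : IsSmoothForm I' α) (v w : TangentSpace I x) :
    extDer I (pullback I I' f α) x v w =
      extDer I' α (f x) (mfderiv I I' f x v) (mfderiv I I' f x w) := by
  have hz₀ : extChartAt I x x ∈ range I :=
    extChartAt_target_subset_range x (mem_extChartAt_target x)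
  have hF : ContDiffWithinAt ℝ ∞ (writtenInExtChartAt I I' x f) (range I) (extChartAt I x x) :=
    (contMDiffAt_iff.1 hf.self_of_nhds).2
  have hDf : mfderiv I I' f x = _ := (hf.self_of_nhds.mdifferentiableAt (by simp)).mfderiv
  obtain ⟨D, hD, hDvw⟩ := hasFDerivWithinAt_localForm_pullback hf hα
  -- Symmetry extends to boundary points because `range I` lies in the closure of its interior.
  have hsymm := hF.isSymmSndFDerivWithinAt
    (by rw [minSmoothness_of_isRCLikeNormedField]; exact WithTop.coe_le_coe.2 le_top) I.uniqueDiffOn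
    (I.range_subset_closure_interior hz₀) hz₀
  have e1 := hDvw v w
  have e2 := hDvw w v
  rw [hsymm.eq v w] at e1
  unfold extDer
  rw [hD.fderivWithin (I.uniqueDiffOn _ hz₀), hDf]
  exact (congrArg₂ (· - ·) e1 e2).trans (add_sub_add_left_eq_sub _ _ _)

theorem extDer_add {α β : OneForm I M} {x : M}
    (hα : DifferentiableWithinAt ℝ (localForm I α x) (range I) (extChartAt I x x))
    (hβ : DifferentiableWithinAt ℝ (localForm I β x) (range I) (extChartAt I x x))
    (v w : TangentSpace I x) :
    extDer I (α + β) x v w = extDer I α x v w + extDer I β x v w := by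
  have hz₀ : extChartAt I x x ∈ range I :=
    extChartAt_target_subset_range x (mem_extChartAt_target x)
  have h : fderivWithin ℝ (localForm I (α + β) x) (range I) (extChartAt I x x) = _ :=
    fderivWithin_add (I.uniqueDiffOn _ hz₀) hα hβ
  unfold extDer
  rw [h]
  exact add_sub_add_comm _ _ _ _

/-- The differential of the coordinate function on `ℝ`. -/
noncomputable def stdForm : OneForm 𝓘(ℝ, ℝ) ℝ := fun _ ↦ ContinuousLinearMap.id ℝ ℝ

theorem isSmoothForm_stdForm : IsSmoothForm 𝓘(ℝ, ℝ) stdForm := by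
  intro x
  refine (contMDiffAt_hom_bundle (F₁ := ℝ) (F₂ := ℝ) (E₁ := TangentSpace 𝓘(ℝ, ℝ))
    (E₂ := Bundle.Trivial ℝ ℝ) _).2 ⟨contMDiffAt_id, ?_⟩
  refine (contMDiffAt_const (c := ContinuousLinearMap.id ℝ ℝ)).congr_of_eventuallyEq
    (Filter.Eventually.of_forall fun y ↦ ?_)
  ext
  simp [ContinuousLinearMap.inCoordinates, stdForm]
  rfl

/-- du is the pull-back of the constant form dt on the line, which is closed. -/
theorem extDer_differential {u : M → ℝ} (hu : ContMDiff I 𝓘(ℝ, ℝ) ∞ u) (x : M)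
    (v w : TangentSpace I x) : extDer I (differential I u) x v w = 0 := by
  have h1 : differential I u = pullback I 𝓘(ℝ, ℝ) u stdForm := rfl
  rw [h1, extDer_pullback (.of_forall hu) isSmoothForm_stdForm]
  have h2 : localForm 𝓘(ℝ, ℝ) stdForm (u x) = fun _ ↦ ContinuousLinearMap.id ℝ ℝ := by
    funext z
    unfold localForm
    simp only [stdForm, extChartAt_model_space_eq_id, PartialEquiv.refl_symm, PartialEquiv.refl_coe,
      mfderivWithin_eq_fderivWithin, modelWithCornersSelf_coe, range_id, fderivWithin_univ, fderiv_id]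
    ext
    rfl
  have h3 : ∀ a b : ℝ, fderivWithin ℝ (localForm 𝓘(ℝ, ℝ) stdForm (u x)) (range 𝓘(ℝ, ℝ))
      (extChartAt 𝓘(ℝ, ℝ) (u x) (u x)) a b = 0 := by
    intro a b
    rw [h2, fderivWithin_const_apply]
    rfl
  exact (congrArg₂ (· - ·) (h3 _ _) (h3 _ _)).trans (sub_self 0)
end Forms

/-! ### Vector fields in charts. -/

section Fields

set_option linter.unusedSectionVars false

variable {E : Type*} [NormedAddCommGroup E] [NormedSpace ℝ E]
  {H : Type*} [TopologicalSpace H] {I : ModelWithCorners ℝ E H}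
  {M : Type*} [TopologicalSpace M] [ChartedSpace H M] [IsManifold I ∞ M]

variable (I) in
/-- The vector field `X` read in the preferred chart at `x`. -/
noncomputable def localField (X : (y : M) → TangentSpace I y) (x : M) : E → E :=
  fun z ↦ mfderiv I 𝓘(ℝ, E) (extChartAt I x) ((extChartAt I x).symm z) (X ((extChartAt I x).symm z))

variable (I) in
/-- Smoothness of a vector field, in the preferred charts. -/
def IsSmoothField (X : (y : M) → TangentSpace I y) : Prop :=
  ∀ x, ContDiffOn ℝ ∞ (localField I X x) (extChartAt I x).target

theorem IsSmoothField.contMDiff {X : (y : M) → TangentSpace I y} (hX : IsSmoothField I X) :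
    ContMDiff I I.tangent ∞ (fun y ↦ (⟨y, X y⟩ : TangentBundle I M)) := by
  intro x
  have h1 : ContMDiffWithinAt I 𝓘(ℝ, E) ∞ (localField I X x ∘ extChartAt I x) 
      (extChartAt I x).source x := by
    have h2 := (contMDiffOn_iff_contDiffOn.2 (hX x)) (extChartAt I x x) (mem_extChartAt_target x)
    exact h2.comp x ((contMDiffAt_extChartAt (I := I) (x := x)).contMDiffWithinAt) (extChartAt I x).mapsTo
  have h3 := h1.contMDiffAt (extChartAt_source_mem_nhds x)
  refine (Bundle.contMDiffAt_section x).2 (h3.congr_of_eventuallyEq ?_)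
  filter_upwards [extChartAt_source_mem_nhds (I := I) x] with y hy
  have hy' : y ∈ (chartAt H x).source := by rwa [extChartAt_source] at hy
  have h4 := congrArg (fun L ↦ L (X y)) (TangentBundle.continuousLinearMapAt_trivializationAt (I := I) hy')
  have h5 : localField I X x (extChartAt I x y) = mfderiv I 𝓘(ℝ, E) (extChartAt I x) y (X y) := by
    unfold localField
    rw [(extChartAt I x).left_inv hy]
  rw [Function.comp, h5]
  refine Eq.trans ?_ h4
  exact (congrFun ((trivializationAt E (TangentSpace I) x).coe_linearMapAt_of_mem (R := ℝ)
    (by simpa using hy')) (X y)).symm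

variable (I) in
/-- The tangent vector at `φ⁻¹ z` with coordinates `a` in the preferred chart `φ` at `x`. -/
noncomputable def chartVec (x : M) (z : E) : E →L[ℝ] TangentSpace I ((extChartAt I x).symm z) :=
  mfderivWithin 𝓘(ℝ, E) I (extChartAt I x).symm (range I) z

theorem chartVec_localField (X : (y : M) → TangentSpace I y) {x : M} {z : E}
    (hz : z ∈ (extChartAt I x).target) :
    chartVec I x z (localField I X x z) = X ((extChartAt I x).symm z) :=
  congrArg (fun L ↦ L (X ((extChartAt I x).symm z)))
    (mfderivWithin_extChartAt_symm_comp_mfderiv_extChartAt hz)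

theorem mfderiv_chartVec {x : M} {z : E}
    (hz : z ∈ (extChartAt I x).target) (a : E) :
    mfderiv I 𝓘(ℝ, E) (extChartAt I x) ((extChartAt I x).symm z) (chartVec I x z a) = a :=
  congrArg (fun L ↦ L a)
    (mfderiv_extChartAt_comp_mfderivWithin_extChartAt_symm hz)

theorem chartVec_mfderiv {x : M} {z : E}
    (hz : z ∈ (extChartAt I x).target) (v : TangentSpace I ((extChartAt I x).symm z)) :
    chartVec I x z (mfderiv I 𝓘(ℝ, E) (extChartAt I x) ((extChartAt I x).symm z) v) = v :=
  congrArg (fun L ↦ L v)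
    (mfderivWithin_extChartAt_symm_comp_mfderiv_extChartAt hz)

variable [I.Boundaryless]

/-- `extDer` at a point is defined through the preferred chart at that point. Naturality under the
inverse chart at x allows its computation in one fixed chart for all nearby points. -/
theorem extDer_chartVec {α : OneForm I M} (hα : IsSmoothForm I α) {x : M} {z : E}
    (hz : z ∈ (extChartAt I x).target) (a b : E) :
    extDer I α ((extChartAt I x).symm z) (chartVec I x z a) (chartVec I x z b) =
      fderiv ℝ (localForm I α x) z a b - fderiv ℝ (localForm I α x) z b a := by
  have hf : ∀ᶠ y in 𝓝 z, ContMDiffAt 𝓘(ℝ, E) I ∞ (extChartAt I x).symm y := by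
    filter_upwards [extChartAt_target_mem_nhds' (I := I) hz] with y hy
    exact (contMDiffOn_extChartAt_symm (I := I) x y hy).contMDiffAt (extChartAt_target_mem_nhds' hy)
  have h1 := extDer_pullback hf hα a b
  have h2 : localForm 𝓘(ℝ, E) (pullback 𝓘(ℝ, E) I (extChartAt I x).symm α) z = localForm I α x := by
    funext w
    simp only [localForm, pullback, extChartAt_model_space_eq_id, PartialEquiv.refl_symm,
      PartialEquiv.refl_coe, mfderivWithin_eq_fderivWithin, modelWithCornersSelf_coe, range_id,
      fderivWithin_univ, fderiv_id, I.range_eq_univ, mfderivWithin_univ]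
    rfl
  have h3 : mfderiv 𝓘(ℝ, E) I (extChartAt I x).symm z = chartVec I x z := by
    rw [chartVec, I.range_eq_univ, mfderivWithin_univ]
  rw [h3] at h1
  refine h1.symm.trans ?_
  unfold extDer
  rw [h2]
  simp only [modelWithCornersSelf_coe, range_id, fderivWithin_univ]
  rfl

end Fields

/-! ### A contact form as an isomorphism between fields and forms. -/

section ContactFields

variable {E : Type*} [NormedAddCommGroup E] [NormedSpace ℝ E]
  {H : Type*} [TopologicalSpace H] {I : ModelWithCorners ℝ E H}
  {M : Type*} [TopologicalSpace M] [ChartedSpace H M] [IsManifold I ∞ M]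

variable (I) in
/-- The bilinear form `dα + α ⊗ α` in the preferred chart at `x`. -/
noncomputable def contactMatrix (α : OneForm I M) (x : M) (z : E) : E →L[ℝ] E →L[ℝ] ℝ :=
  fderiv ℝ (localForm I α x) z - (fderiv ℝ (localForm I α x) z).flip +
    (localForm I α x z).smulRight (localForm I α x z)

variable [I.Boundaryless]

theorem contactMatrix_apply {α : OneForm I M} (hα : IsSmoothForm I α) {x : M} {z : E}
    (hz : z ∈ (extChartAt I x).target) (a b : E) :
    contactMatrix I α x z a b =
      extDer I α ((extChartAt I x).symm z) (chartVec I x z a) (chartVec I x z b) +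
        α ((extChartAt I x).symm z) (chartVec I x z a) *
          α ((extChartAt I x).symm z) (chartVec I x z b) := by
  rw [extDer_chartVec hα hz]
  rfl

theorem contDiffOn_contactMatrix [FiniteDimensional ℝ E] {α : OneForm I M} (hα : IsSmoothForm I α) (x : M) :
    ContDiffOn ℝ ∞ (contactMatrix I α x) (extChartAt I x).target := by
  have h := contDiffOn_localForm hα x
  have h' := h.fderiv_of_isOpen (m := ∞) (isOpen_extChartAt_target x) (by simp)
  have h1 : ContDiffOn ℝ ∞ (fun z ↦ (fderiv ℝ (localForm I α x) z).flip)
      (extChartAt I x).target :=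
    contDiffOn_clm_apply.2 fun a ↦ contDiffOn_clm_apply.2 fun b ↦
      (h'.clm_apply contDiffOn_const).clm_apply contDiffOn_const
  have h2 : ContDiffOn ℝ ∞ (fun z ↦ (localForm I α x z).smulRight (localForm I α x z))
      (extChartAt I x).target := h.smulRight h
  exact (h'.sub h1).add h2

/-- If a is annihilated, inserting a itself leaves α(a)² = 0. Then dα(a, ·) = 0 with a in the kernel
of α, so a = 0 by the contact condition; injectivity suffices by dimension. -/
theorem isInvertible_contactMatrix [FiniteDimensional ℝ E] {α : OneForm I M}
    (hα : IsSmoothForm I α) (hc : ∀ y, IsContactAt I α y)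
    {x : M} {z : E} (hz : z ∈ (extChartAt I x).target) :
    (contactMatrix I α x z).IsInvertible := by
  have hinj : Function.Injective (contactMatrix I α x z) := by
    rw [injective_iff_map_eq_zero]
    intro a ha
    have h1 : ∀ b, extDer I α ((extChartAt I x).symm z) (chartVec I x z a) (chartVec I x z b) +
        α ((extChartAt I x).symm z) (chartVec I x z a) *
          α ((extChartAt I x).symm z) (chartVec I x z b) = 0 := by
      intro b
      rw [← contactMatrix_apply hα hz, ha]; rfl
    have h2 : α ((extChartAt I x).symm z) (chartVec I x z a) = 0 := by
      have := h1 a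
      rw [extDer_chartVec hα hz, sub_self, zero_add] at this
      exact mul_self_eq_zero.1 this
    have h3 := (hc ((extChartAt I x).symm z)).2 (chartVec I x z a) h2 (fun w _ ↦ by
      have := h1 (mfderiv I 𝓘(ℝ, E) (extChartAt I x) ((extChartAt I x).symm z) w)
      rw [chartVec_mfderiv hz, h2, zero_mul, add_zero] at this
      exact this)
    have h4 := mfderiv_chartVec (I := I) hz a
    rw [h3, map_zero] at h4
    exact h4.symm
  have hrank : Module.finrank ℝ E = Module.finrank ℝ (E →L[ℝ] ℝ) := by
    rw [← (LinearMap.toContinuousLinearMap : (E →ₗ[ℝ] ℝ) ≃ₗ[ℝ] (E →L[ℝ] ℝ)).finrank_eq]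
    exact (Subspace.dual_finrank_eq (K := ℝ) (V := E)).symm
  have : CompleteSpace E := FiniteDimensional.complete ℝ E
  have hsurj : Function.Surjective (contactMatrix I α x z) :=
    (LinearMap.injective_iff_surjective_of_finrank_eq_finrank
      (f := (contactMatrix I α x z : E →ₗ[ℝ] (E →L[ℝ] ℝ))) hrank).1 hinj
  exact ⟨ContinuousLinearEquiv.ofBijective (contactMatrix I α x z)
    (LinearMap.ker_eq_bot.2 hinj) (LinearMap.range_eq_top.2 hsurj), rfl⟩

/-- A contact form identifies the smooth vector fields with the smooth 1-forms. -/
theorem exists_smoothField [FiniteDimensional ℝ E] {α : OneForm I M}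
    (hα : IsSmoothForm I α) (hc : ∀ y, IsContactAt I α y) {β : OneForm I M}
    (hβ : ∀ x, ContDiffOn ℝ ∞ (localForm I β x) (extChartAt I x).target) :
    ∃ X : (y : M) → TangentSpace I y, IsSmoothField I X ∧
      ∀ y (w : TangentSpace I y), extDer I α y (X y) w + α y (X y) * α y w = β y w := by
  have : CompleteSpace E := FiniteDimensional.complete ℝ E
  have hloc : ∀ x z, z ∈ (extChartAt I x).target → ∀ w : TangentSpace I ((extChartAt I x).symm z),
      extDer I α ((extChartAt I x).symm z)
        (chartVec I x z ((contactMatrix I α x z).inverse (localForm I β x z))) w +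
      α ((extChartAt I x).symm z)
        (chartVec I x z ((contactMatrix I α x z).inverse (localForm I β x z))) *
        α ((extChartAt I x).symm z) w = β ((extChartAt I x).symm z) w := by
    intro x z hz w
    have h1 := contactMatrix_apply hα hz ((contactMatrix I α x z).inverse (localForm I β x z))
      (mfderiv I 𝓘(ℝ, E) (extChartAt I x) ((extChartAt I x).symm z) w)
    rw [chartVec_mfderiv hz, (isInvertible_contactMatrix hα hc hz).self_apply_inverse] at h1
    refine h1.symm.trans ?_
    exact congrArg (β _) (chartVec_mfderiv hz w)
  have hex : ∀ y, ∃ v : TangentSpace I y, ∀ w, extDer I α y v w + α y v * α y w = β y w := by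
    intro y
    have h1 := hloc y (extChartAt I y y) (mem_extChartAt_target y)
    rw [extChartAt_to_inv] at h1
    exact ⟨_, h1⟩
  choose X hX using hex
  refine ⟨X, fun x ↦ ?_, hX⟩
  -- Inversion of operators is smooth at invertible ones, so the pointwise solution depends smoothly
  -- on z.
  have h2 : ContDiffOn ℝ ∞ (fun z ↦ (contactMatrix I α x z).inverse (localForm I β x z))
      (extChartAt I x).target := by
    refine ContDiffOn.clm_apply (fun z hz ↦ ?_) (hβ x)
    obtain ⟨e, he⟩ := isInvertible_contactMatrix hα hc hz
    have h3 := contDiffAt_map_inverse (n := ∞) (𝕜 := ℝ) e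
    rw [he] at h3
    exact h3.comp_contDiffWithinAt z (contDiffOn_contactMatrix hα x z hz)
  refine h2.congr fun z hz ↦ ?_
  have hA := isInvertible_contactMatrix hα hc hz
  have h4 : contactMatrix I α x z (localField I X x z) = localForm I β x z := by
    ext b
    rw [contactMatrix_apply hα hz, chartVec_localField X hz]
    exact hX _ _
  rw [← h4, hA.inverse_apply_self]

end ContactFields

/-! ### The Reeb field and contact Hamiltonians. -/

section Hamiltonian

set_option linter.unusedSectionVars false

variable {E : Type*} [NormedAddCommGroup E] [NormedSpace ℝ E]
  {H : Type*} [TopologicalSpace H] {I : ModelWithCorners ℝ E H}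
  {M : Type*} [TopologicalSpace M] [ChartedSpace H M] 

theorem extDer_swap (α : OneForm I M) (x : M) (v w : TangentSpace I x) :
    extDer I α x v w = - extDer I α x w v := by
  simp only [extDer]; ring

theorem extDer_sub_left (α : OneForm I M) (x : M) (a b w : TangentSpace I x) :
    extDer I α x (a - b) w = extDer I α x a w - extDer I α x b w := by
  have h (D : E →L[ℝ] E →L[ℝ] ℝ) (a b w : E) :
      D (a - b) w - D w (a - b) = D a w - D w a - (D b w - D w b) := by
    simp only [map_sub, sub_apply]; ring
  exact h _ a b w

theorem extDer_smul_left (α : OneForm I M) (x : M) (r : ℝ) (a w : TangentSpace I x) :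
    extDer I α x (r • a) w = r * extDer I α x a w := by
  have h (D : E →L[ℝ] E →L[ℝ] ℝ) (a w : E) :
      D (r • a) w - D w (r • a) = r * (D a w - D w a) := by
    simp only [map_smul, smul_apply, smul_eq_mul]; ring
  exact h _ a w

variable [IsManifold I ∞ M] [I.Boundaryless]

theorem localForm_differential {u : M → ℝ} (hu : ContMDiff I 𝓘(ℝ, ℝ) ∞ u) {x : M} {z : E}
    (hz : z ∈ (extChartAt I x).target) :
    localForm I (differential I u) x z = fderiv ℝ (u ∘ (extChartAt I x).symm) z := by
  have h1 : MDifferentiableAt I 𝓘(ℝ, ℝ) u ((extChartAt I x).symm z) :=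
    (hu _).mdifferentiableAt (by simp)
  have h2 : MDifferentiableAt 𝓘(ℝ, E) I (extChartAt I x).symm z :=
    ((contMDiffOn_extChartAt_symm (n := ∞) x).contMDiffAt
      ((isOpen_extChartAt_target x).mem_nhds hz)).mdifferentiableAt (by simp)
  have h3 := mfderiv_comp z h1 h2
  rw [mfderiv_eq_fderiv] at h3
  rw [h3]
  simp only [localForm, I.range_eq_univ, mfderivWithin_univ]
  rfl

theorem contDiffOn_comp_extChartAt_symm {u : M → ℝ} (hu : ContMDiff I 𝓘(ℝ, ℝ) ∞ u) (x : M) :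
    ContDiffOn ℝ ∞ (u ∘ (extChartAt I x).symm) (extChartAt I x).target :=
  contMDiffOn_iff_contDiffOn.1 (hu.comp_contMDiffOn (contMDiffOn_extChartAt_symm x))

/-- The Reeb field of a contact form. -/
theorem exists_reebField [FiniteDimensional ℝ E] {α : OneForm I M}
    (hα : IsSmoothForm I α) (hc : ∀ y, IsContactAt I α y) :
    ∃ R : (y : M) → TangentSpace I y, IsSmoothField I R ∧
      (∀ y, α y (R y) = 1) ∧ ∀ y (w : TangentSpace I y), extDer I α y (R y) w = 0 := by
  -- Solve dα(R, ·) + α(R) α = α. Inserting R gives α(R)² = α(R), and α(R) = 0 would make dα(R, ·)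
  -- vanish on ker α, hence R = 0 and α = 0.
  obtain ⟨R, hR, h⟩ := exists_smoothField hα hc (β := α) (contDiffOn_localForm hα)
  have h1 : ∀ y, α y (R y) = 1 := by
    intro y
    have h2 := h y (R y)
    have h3 : extDer I α y (R y) (R y) = 0 := by simp [extDer]
    rw [h3, zero_add] at h2
    by_contra hne
    have h4 : α y (R y) = 0 := by
      by_contra h0
      exact hne (mul_right_cancel₀ h0 (h2.trans (one_mul _).symm))
    have h5 : R y = 0 := (hc y).2 _ h4 fun w hw ↦ by simpa [h4, hw] using h y w
    refine (hc y).1 (ContinuousLinearMap.ext fun w ↦ ?_)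
    have h6 := h y w
    rw [h4, zero_mul, add_zero, h5] at h6
    rw [← h6]
    have := extDer_smul_left α y 0 (R y) w
    simpa using this
  exact ⟨R, hR, h1, fun y w ↦ by simpa [h1] using h y w⟩

/-- The contact vector field of a contact Hamiltonian. -/
theorem exists_contactField [FiniteDimensional ℝ E] {α : OneForm I M}
    (hα : IsSmoothForm I α) (hc : ∀ y, IsContactAt I α y)
    {u : M → ℝ} (hu : ContMDiff I 𝓘(ℝ, ℝ) ∞ u) :
    ∃ (X : (y : M) → TangentSpace I y) (c : M → ℝ), IsSmoothField I X ∧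
      (∀ y, α y (X y) = u y) ∧ ∀ y (w : TangentSpace I y),
        extDer I α y (X y) w = c y * α y w - differential I u y w := by
  obtain ⟨R, hR, hR1, hR2⟩ := exists_reebField hα hc
  -- The coefficient of α is chosen so that β(R) = u. Since dα(X, R) = 0, this forces α(X) = u.
  let β : OneForm I M := fun y ↦
    (differential I u y (R y) + u y) • α y - differential I u y
  have hβ : ∀ x, ContDiffOn ℝ ∞ (localForm I β x) (extChartAt I x).target := by
    intro x
    have h1 := contDiffOn_comp_extChartAt_symm hu x
    have h2 := h1.fderiv_of_isOpen (m := ∞) (isOpen_extChartAt_target x) (by simp)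
    refine ((((h2.clm_apply (hR x)).add h1).smul (contDiffOn_localForm hα x)).sub h2).congr
      fun z hz ↦ ?_
    ext v
    have h3 := chartVec_localField R hz
    have h4 := fun w : E ↦ congrArg (fun L : E →L[ℝ] ℝ ↦ L w) (localForm_differential hu hz)
    have h5 : differential I u ((extChartAt I x).symm z) (R ((extChartAt I x).symm z)) =
      fderiv ℝ (u ∘ (extChartAt I x).symm) z (localField I R x z) := by
      rw [← h3]; exact h4 _
    have h6 : differential I u ((extChartAt I x).symm z) (chartVec I x z v) =
      fderiv ℝ (u ∘ (extChartAt I x).symm) z v := h4 v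
    exact congrArg₂ (fun p q : ℝ ↦ (p + u ((extChartAt I x).symm z)) *
      localForm I α x z v - q) h5 h6
  obtain ⟨X, hX, h⟩ := exists_smoothField hα hc hβ
  have h1 : ∀ y, α y (X y) = u y := by
    intro y
    have h2 := h y (R y)
    have h3 : β y (R y) = (differential I u y (R y) + u y) * α y (R y) -
      differential I u y (R y) := rfl
    rw [extDer_swap, hR2, h3, hR1] at h2
    linarith
  refine ⟨X, fun y ↦ differential I u y (R y), hX, h1, fun y w ↦ ?_⟩
  have h2 := h y w
  have h3 : β y w = (differential I u y (R y) + u y) * α y w - differential I u y w := rfl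
  rw [h3, h1] at h2
  linarith

theorem contactField_eq_zero {α : OneForm I M} {y : M} (hc : IsContactAt I α y) {c : ℝ}
    {v : TangentSpace I y} (h0 : α y v = 0)
    (h : ∀ w, extDer I α y v w = c * α y w) : v = 0 :=
  hc.2 v h0 fun w hw ↦ by rw [h, hw, mul_zero]

/-- The Lie derivative of the contact form along a contact field is a multiple of the form. -/
theorem fderiv_localForm_contactField {α : OneForm I M} (hα : IsSmoothForm I α)
    {u : M → ℝ} (hu : ContMDiff I 𝓘(ℝ, ℝ) ∞ u)
    {X : (y : M) → TangentSpace I y} (hX : IsSmoothField I X) {c : M → ℝ}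
    (h1 : ∀ y, α y (X y) = u y)
    (h2 : ∀ y (w : TangentSpace I y),
        extDer I α y (X y) w = c y * α y w - differential I u y w)
    {x : M} {z : E} (hz : z ∈ (extChartAt I x).target) (v : E) :
    fderiv ℝ (localForm I α x) z (localField I X x z) v +
      localForm I α x z (fderiv ℝ (localField I X x) z v) =
      c ((extChartAt I x).symm z) * localForm I α x z v := by
  have ho : (extChartAt I x).target ∈ 𝓝 z := (isOpen_extChartAt_target x).mem_nhds hz
  have hL := ((contDiffOn_localForm hα x).contDiffAt ho).differentiableAt (by simp)
  have hF := ((hX x).contDiffAt ho).differentiableAt (by simp)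
  -- Cartan's formula in coordinates: L_X α = d(α(X)) + ι_X dα = du + (c α - du) = c α. The first
  -- term is the derivative of this function.
  have hev : (fun z ↦ localForm I α x z (localField I X x z)) =ᶠ[𝓝 z]
      u ∘ (extChartAt I x).symm := by
    filter_upwards [ho] with z' hz'
    refine Eq.trans ?_ (h1 _)
    exact congrArg (α _) (chartVec_localField X hz')
  have h3 := hev.fderiv_eq (𝕜 := ℝ)
  rw [fderiv_clm_apply hL hF] at h3
  have h4 := congrArg (fun L : E →L[ℝ] ℝ ↦ L v) h3
  have h5 := extDer_chartVec hα hz (localField I X x z) v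
  rw [chartVec_localField X hz, h2] at h5
  have h6 : differential I u ((extChartAt I x).symm z) (chartVec I x z v) =
      fderiv ℝ (u ∘ (extChartAt I x).symm) z v :=
    congrArg (fun L : E →L[ℝ] ℝ ↦ L v) (localForm_differential hu hz)
  rw [h6] at h5
  have h7 : α ((extChartAt I x).symm z) (chartVec I x z v) = localForm I α x z v := rfl
  rw [h7] at h5
  have h8 : localForm I α x z (fderiv ℝ (localField I X x) z v) +
    fderiv ℝ (localForm I α x) z v (localField I X x z) =
    fderiv ℝ (u ∘ (extChartAt I x).symm) z v := h4
  linarith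

end Hamiltonian

/-! ### Local flows of contact fields on a manifold. -/

section LocalFlow

set_option linter.unusedSectionVars false

variable {E : Type*} [NormedAddCommGroup E] [NormedSpace ℝ E]
  {H : Type*} [TopologicalSpace H] {I : ModelWithCorners ℝ E H}
  {M : Type*} [TopologicalSpace M] [ChartedSpace H M] [IsManifold I ∞ M]

variable [I.Boundaryless]

variable (I) in
/-- `X` is the contact field of the Hamiltonian `u` with respect to the contact form `α`. -/
structure IsContactField (α : OneForm I M) (u : M → ℝ) (X : (y : M) → TangentSpace I y) :
    Prop where
  smooth : IsSmoothField I X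
  apply_eq : ∀ y, α y (X y) = u y
  extDer_eq : ∃ c : M → ℝ, ∀ y (w : TangentSpace I y),
    extDer I α y (X y) w = c y * α y w - differential I u y w

/-- Where the Hamiltonian vanishes identically so does its differential, and nondegeneracy kills X.
Thus a compactly supported Hamiltonian has a compactly supported field. -/
theorem IsContactField.eq_zero {α : OneForm I M} {u : M → ℝ} {X : (y : M) → TangentSpace I y}
    (hX : IsContactField I α u X) {y : M} (hc : IsContactAt I α y) (hu : u =ᶠ[𝓝 y] fun _ ↦ 0) :
    X y = 0 := by
  obtain ⟨c, h⟩ := hX.extDer_eq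
  have h0 : differential I u y = 0 := hu.mfderiv_eq.trans mfderiv_const
  refine contactField_eq_zero hc (c := c y) ((hX.apply_eq y).trans hu.self_of_nhds) fun w ↦ ?_
  rw [h, h0]
  simp

/-- A map which is smooth near a point agrees near the point with a globally smooth map. -/
theorem exists_contDiff_eqOn_ball [FiniteDimensional ℝ E] {F : E → E} {s : Set E} {z : E}
    (hs : s ∈ 𝓝 z) (ho : IsOpen s) (hF : ContDiffOn ℝ ∞ F s) :
    ∃ (G : E → E) (r : ℝ), 0 < r ∧ ContDiff ℝ ∞ G ∧ Metric.ball z r ⊆ s ∧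
      EqOn G F (Metric.ball z r) := by
  obtain ⟨R, hR, hRs⟩ := Metric.nhds_basis_closedBall.mem_iff.1 hs
  let χ : ContDiffBump z := ⟨R / 2, R, by positivity, by linarith⟩
  refine ⟨fun x ↦ χ x • F x, R / 2, by positivity, contDiff_iff_contDiffAt.2 fun x ↦ ?_,
    fun x hx ↦ hRs ?_, fun x hx ↦ ?_⟩
  · by_cases hx : x ∈ s
    · exact χ.contDiff.contDiffAt.smul (hF.contDiffAt (ho.mem_nhds hx))
    · have h1 : (fun x ↦ χ x • F x) =ᶠ[𝓝 x] fun _ ↦ 0 := by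
        have h2 : (tsupport χ)ᶜ ∈ 𝓝 x := by
          refine (isClosed_tsupport _).isOpen_compl.mem_nhds fun h ↦ hx (hRs ?_)
          rwa [χ.tsupport_eq] at h
        filter_upwards [h2] with w hw
        rw [image_eq_zero_of_notMem_tsupport hw, zero_smul]
      exact contDiffAt_const.congr_of_eventuallyEq h1
  · exact Metric.ball_subset_closedBall (Metric.ball_subset_ball (by linarith) hx)
  · have : χ x = 1 := χ.one_of_mem_closedBall (Metric.ball_subset_closedBall hx)
    simp [this]

theorem hasMFDerivAt_extChartAt_symm {x : M} {z : E} (hz : z ∈ (extChartAt I x).target) :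
    HasMFDerivAt 𝓘(ℝ, E) I (extChartAt I x).symm z (chartVec I x z) := by
  have h : MDifferentiableAt 𝓘(ℝ, E) I (extChartAt I x).symm z :=
    ((contMDiffOn_extChartAt_symm (n := ∞) x).contMDiffAt
      ((isOpen_extChartAt_target x).mem_nhds hz)).mdifferentiableAt (by simp)
  have h1 := h.hasMFDerivAt
  have h2 : mfderiv 𝓘(ℝ, E) I (extChartAt I x).symm z = chartVec I x z := by
    rw [chartVec, I.range_eq_univ, mfderivWithin_univ]
  rwa [h2] at h1

/-- Local existence and smoothness of the flow of a contact field, which preserves the kernel of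
the contact form. -/
theorem exists_local_contactFlow [FiniteDimensional ℝ E] {α : OneForm I M} (hα : IsSmoothForm I α)
    {u : M → ℝ} (hu : ContMDiff I 𝓘(ℝ, ℝ) ∞ u) {X : (y : M) → TangentSpace I y}
    (hX : IsContactField I α u X) (y₀ : M) (h0 : α y₀ ≠ 0) :
    ∃ U ∈ 𝓝 y₀, ∃ τ > 0, ∃ Ψ : ℝ → M → M, IsOpen U ∧ (∀ y ∈ U, Ψ 0 y = y) ∧
      (∀ y ∈ U, IsMIntegralCurveOn (fun t ↦ Ψ t y) X (Ioo (-τ) τ)) ∧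
      ∀ y ∈ U, ∀ t ∈ Ioo (-τ) τ, ContMDiffAt I I ∞ (Ψ t) y ∧
        ∀ v, α y v = 0 → α (Ψ t y) (mfderiv I I (Ψ t) y v) = 0 := by
  have : CompleteSpace E := FiniteDimensional.complete ℝ E
  set z₀ := extChartAt I y₀ y₀ with hz₀
  set L := localForm I α y₀ with hL
  have hto := isOpen_extChartAt_target (I := I) y₀
  have hLs := contDiffOn_localForm hα y₀
  have hz0t : z₀ ∈ (extChartAt I y₀).target := mem_extChartAt_target y₀
  -- This fixed vector stays transverse to the kernel on Ω, as `flow_preserves_ker` requires.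
  obtain ⟨e, he⟩ : ∃ e, L z₀ e ≠ 0 := by
    by_contra! hcon
    refine h0 ?_
    have h1 : ∀ v : TangentSpace I ((extChartAt I y₀).symm z₀),
        α ((extChartAt I y₀).symm z₀) v = 0 := fun v ↦ by
      rw [← chartVec_mfderiv hz0t v]
      exact hcon _
    rw [hz₀, extChartAt_to_inv] at h1
    exact ContinuousLinearMap.ext h1
  set Ω : Set E := {z ∈ (extChartAt I y₀).target | L z e ≠ 0}
  have hΩ : IsOpen Ω := by
    have : ContinuousOn (fun z ↦ L z e) (extChartAt I y₀).target :=
      (hLs.clm_apply contDiffOn_const).continuousOn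
    exact this.isOpen_inter_preimage hto isOpen_compl_singleton
  have hz0Ω : z₀ ∈ Ω := ⟨hz0t, he⟩
  -- The path-space argument needs a field on all of E. The cut-off G agrees with X on a ball, and
  -- times are shortened so that orbits stay in that ball.
  obtain ⟨G, r, hr, hG, hrs, hGF⟩ := exists_contDiff_eqOn_ball (hΩ.mem_nhds hz0Ω) hΩ
    ((hX.smooth y₀).mono fun z hz ↦ hz.1)
  obtain ⟨ψ, τ, hτ, hψ0, hψd, hψs⟩ := exists_local_flow hG z₀
  obtain ⟨σ, hσ, hσψ⟩ : ∃ σ > 0, ∀ z ∈ Metric.ball z₀ σ, ∀ t ∈ Metric.ball (0 : ℝ) σ,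
      ψ t z ∈ Metric.ball z₀ r := by
    have h1 : ContinuousAt (fun p : E × ℝ ↦ ψ p.2 p.1) (z₀, 0) :=
      (hψs z₀ (Metric.mem_ball_self hτ) 0 (Metric.mem_ball_self hτ)).continuousAt
    have h2 : Metric.ball z₀ r ∈ 𝓝 (ψ 0 z₀) := by
      rw [hψ0 z₀ (Metric.mem_ball_self hτ)]
      exact Metric.ball_mem_nhds _ hr
    have h3 := h1.preimage_mem_nhds h2
    obtain ⟨σ, hσ, h4⟩ := Metric.mem_nhds_iff.1 h3
    refine ⟨σ, hσ, fun z hz t ht ↦ @h4 (z, t) ?_⟩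
    rw [← ball_prod_same]
    exact ⟨hz, ht⟩
  obtain ⟨σ', hσ', hσσ, hστ, hsr⟩ : ∃ σ' > 0, σ' ≤ σ ∧ σ' ≤ τ ∧ σ' ≤ r :=
    ⟨min σ (min τ r), by positivity, min_le_left _ _, (min_le_right _ _).trans (min_le_left _ _),
      (min_le_right _ _).trans (min_le_right _ _)⟩
  have hbσ : ∀ {z}, z ∈ Metric.ball z₀ σ' → z ∈ Metric.ball z₀ σ := fun h ↦
    Metric.ball_subset_ball hσσ h
  have hbτ : ∀ {z}, z ∈ Metric.ball z₀ σ' → z ∈ Metric.ball z₀ τ := fun h ↦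
    Metric.ball_subset_ball hστ h
  have hbσ' : ∀ {t}, t ∈ Metric.ball (0 : ℝ) σ' → t ∈ Metric.ball (0 : ℝ) σ := fun h ↦
    Metric.ball_subset_ball hσσ h
  have hbτ' : ∀ {t}, t ∈ Metric.ball (0 : ℝ) σ' → t ∈ Metric.ball (0 : ℝ) τ := fun h ↦
    Metric.ball_subset_ball hστ h
  have hmem : ∀ z ∈ Metric.ball z₀ σ', ∀ t ∈ Metric.ball (0 : ℝ) σ', ψ t z ∈ Metric.ball z₀ r :=
    fun z hz t ht ↦ hσψ z (hbσ hz) t (hbσ' ht)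
  obtain ⟨c, hc⟩ := hX.extDer_eq
  set U : Set M := (extChartAt I y₀).source ∩ extChartAt I y₀ ⁻¹' Metric.ball z₀ σ'
  have hUo : IsOpen U := isOpen_extChartAt_preimage' y₀ Metric.isOpen_ball
  have hy0U : y₀ ∈ U := ⟨mem_extChartAt_source y₀, Metric.mem_ball_self hσ'⟩
  have hIoo : ∀ {t}, t ∈ Ioo (-σ') σ' → t ∈ Metric.ball (0 : ℝ) σ' := by
    intro t ht
    rwa [Real.ball_eq_Ioo, zero_sub, zero_add]
  refine ⟨U, hUo.mem_nhds hy0U, σ', hσ', fun t y ↦ (extChartAt I y₀).symm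
    (ψ t (extChartAt I y₀ y)), hUo, ?_, ?_, ?_⟩
  · intro y hy
    beta_reduce
    rw [hψ0 _ (hbτ hy.2), (extChartAt I y₀).left_inv hy.1]
  · intro y hy t ht
    refine HasMFDerivAt.hasMFDerivWithinAt ?_
    have h1 := hmem _ hy.2 t (hIoo ht)
    have h2 := hψd _ (hbτ hy.2) t (hbτ' (hIoo ht))
    rw [hGF h1] at h2
    have h3 := (hasMFDerivAt_extChartAt_symm (hrs h1).1).comp t h2.hasFDerivAt.hasMFDerivAt
    refine h3.congr_mfderiv (ContinuousLinearMap.ext fun (a : ℝ) ↦ ?_)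
    exact (map_smul (chartVec I y₀ (ψ t (extChartAt I y₀ y))) (show ℝ from a) _).trans
      (congrArg ((show ℝ from a) • ·) (chartVec_localField X (hrs h1).1))
  · intro y hy t ht
    have hyz : ∃ z ∈ Metric.ball z₀ σ', (extChartAt I y₀).symm z = y :=
      ⟨_, hy.2, (extChartAt I y₀).left_inv hy.1⟩
    obtain ⟨z, hz, rfl⟩ := hyz
    have hzt : z ∈ (extChartAt I y₀).target := (hrs (Metric.ball_subset_ball hsr hz)).1
    have hri := (extChartAt I y₀).right_inv hzt
    have h1 := hmem _ hz t (hIoo ht)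
    have hs : ContDiffAt ℝ ∞ (ψ t) z :=
      (hψs z (hbτ hz) t (hbτ' (hIoo ht))).comp (f := fun x ↦ (x, t)) z
        (contDiffAt_id.prodMk contDiffAt_const)
    have hφ : ContMDiffAt I 𝓘(ℝ, E) ∞ (extChartAt I y₀) ((extChartAt I y₀).symm z) :=
      contMDiffAt_extChartAt' (by
        have := (extChartAt I y₀).map_target hzt
        rwa [extChartAt_source] at this)
    have hs1 : ContMDiffAt 𝓘(ℝ, E) 𝓘(ℝ, E) ∞ (ψ t)
        (extChartAt I y₀ ((extChartAt I y₀).symm z)) := by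
      rw [hri]; exact hs.contMDiffAt
    have hs2 : ContMDiffAt 𝓘(ℝ, E) I ∞ (extChartAt I y₀).symm
        (ψ t (extChartAt I y₀ ((extChartAt I y₀).symm z))) := by
      rw [hri]
      exact (contMDiffOn_extChartAt_symm (n := ∞) y₀).contMDiffAt (hto.mem_nhds (hrs h1).1)
    have hs3 : ContMDiffAt I 𝓘(ℝ, E) ∞ (ψ t ∘ extChartAt I y₀) ((extChartAt I y₀).symm z) :=
      hs1.comp _ hφ
    refine ⟨ContMDiffAt.comp (f := ψ t ∘ extChartAt I y₀) _ hs2 hs3, fun v hv ↦ ?_⟩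
    have hd1 := (hφ.mdifferentiableAt (by simp)).hasMFDerivAt
    have hd2 : HasMFDerivAt 𝓘(ℝ, E) 𝓘(ℝ, E) (ψ t)
        (extChartAt I y₀ ((extChartAt I y₀).symm z)) (fderiv ℝ (ψ t) z) := by
      rw [hri]; exact (hs.differentiableAt (by simp)).hasFDerivAt.hasMFDerivAt
    have hd3 : HasMFDerivAt 𝓘(ℝ, E) I (extChartAt I y₀).symm
        (ψ t (extChartAt I y₀ ((extChartAt I y₀).symm z))) (chartVec I y₀ (ψ t z)) := by
      have h := hasMFDerivAt_extChartAt_symm (I := I) (x := y₀) (hrs h1).1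
      rw [hri]; exact h
    have hd := (HasMFDerivAt.comp (f := ψ t ∘ extChartAt I y₀) _ hd3 (hd2.comp _ hd1)).mfderiv
    set w : E := mfderiv I 𝓘(ℝ, E) (extChartAt I y₀) ((extChartAt I y₀).symm z) v with hw
    have hLw : L z w = 0 := by
      refine Eq.trans ?_ hv
      exact congrArg (α _) (chartVec_mfderiv hzt v)
    have key := flow_preserves_ker (X := G) (lam := L) (c := fun z ↦ c ((extChartAt I y₀).symm z))
      Metric.isOpen_ball hG.contDiffOn (hLs.mono fun z hz ↦ (hrs hz).1) (fun z hz v ↦ ?_)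
      (e := e) (fun z hz ↦ (hrs hz).2) (fun x hx t ht ↦ hψs x (hbτ hx) t (hbτ' ht))
      (fun x hx t ht ↦ hψd x (hbτ hx) t (hbτ' ht)) (fun x hx ↦ hψ0 x (hbτ hx)) hmem hz hLw
      (hIoo ht)
    · have h5 : α ((extChartAt I y₀).symm (ψ t z)) (chartVec I y₀ (ψ t z)
        (fderiv ℝ (ψ t) z w)) = 0 := key
      have h6 := congrArg (fun A : TangentSpace I _ →L[ℝ] TangentSpace I _ ↦ A v) hd
      have h7 : ∀ (z' : E), z' = z → ∀ a : E, a = chartVec I y₀ (ψ t z) (fderiv ℝ (ψ t) z w) →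
        α ((extChartAt I y₀).symm (ψ t z')) a = 0 := by
        rintro z' rfl a rfl
        exact h5
      exact h7 _ hri _ h6
    · have hev : G =ᶠ[𝓝 z] localField I X y₀ := by
        filter_upwards [Metric.isOpen_ball.mem_nhds hz] with x hx using hGF hx
      rw [hev.fderiv_eq, hGF hz]
      exact fderiv_localForm_contactField hα hu hX.smooth hX.apply_eq hc (hrs hz).1 v

end LocalFlow

/-! ### The global flow of a compactly supported contact field. -/

section Flow

set_option linter.unusedSectionVars false

variable {E : Type*} [NormedAddCommGroup E] [NormedSpace ℝ E]
  {H : Type*} [TopologicalSpace H] {I : ModelWithCorners ℝ E H}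
  {M : Type*} [TopologicalSpace M] [ChartedSpace H M] [IsManifold I ∞ M]

variable (I) in
/-- The differential of `f` maps the kernel of `α` into itself. -/
def PreservesKer (α : OneForm I M) (f : M → M) : Prop :=
  ∀ y (v : TangentSpace I y), α y v = 0 → α (f y) (mfderiv I I f y v) = 0

theorem PreservesKer.id (α : OneForm I M) : PreservesKer I α id := by
  intro y v hv
  rw [mfderiv_id]
  exact hv

theorem PreservesKer.comp {α : OneForm I M} {f g : M → M} (hf : PreservesKer I α f)
    (hg : PreservesKer I α g) (hfs : ContMDiff I I ∞ f) (hgs : ContMDiff I I ∞ g) :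
    PreservesKer I α (f ∘ g) := by
  intro y v hv
  rw [mfderiv_comp y ((hfs _).mdifferentiableAt (by simp)) ((hgs _).mdifferentiableAt (by simp))]
  exact hf _ _ (hg _ _ hv)

variable (I) in
/-- The map `Ψ` is a local flow of `X` near `y₀`, for times less than `τ`, by smooth maps which
preserve the kernel of `α`. -/
def HasLocalFlow (α : OneForm I M) (X : (y : M) → TangentSpace I y) (τ : ℝ) (y₀ : M) : Prop :=
  ∃ U ∈ 𝓝 y₀, ∃ Ψ : ℝ → M → M, IsOpen U ∧ (∀ y ∈ U, Ψ 0 y = y) ∧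
      (∀ y ∈ U, IsMIntegralCurveOn (fun t ↦ Ψ t y) X (Ioo (-τ) τ)) ∧
      ∀ y ∈ U, ∀ t ∈ Ioo (-τ) τ, ContMDiffAt I I ∞ (Ψ t) y ∧
        ∀ v, α y v = 0 → α (Ψ t y) (mfderiv I I (Ψ t) y v) = 0

theorem HasLocalFlow.mono {α : OneForm I M} {X : (y : M) → TangentSpace I y} {τ τ' : ℝ} {y₀ : M}
    (h : HasLocalFlow I α X τ y₀) (hτ : τ' ≤ τ) : HasLocalFlow I α X τ' y₀ := by
  obtain ⟨U, hU, Ψ, ho, h0, h1, h2⟩ := h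
  have hsub : Ioo (-τ') τ' ⊆ Ioo (-τ) τ := Ioo_subset_Ioo (by linarith) hτ
  exact ⟨U, hU, Ψ, ho, h0, fun y hy ↦ (h1 y hy).mono hsub, fun y hy t ht ↦ h2 y hy t (hsub ht)⟩

theorem HasLocalFlow.eventually {α : OneForm I M} {X : (y : M) → TangentSpace I y} {τ : ℝ} {y₀ : M}
    (h : HasLocalFlow I α X τ y₀) : ∀ᶠ y in 𝓝 y₀, HasLocalFlow I α X τ y := by
  obtain ⟨U, hU, Ψ, ho, h0⟩ := h
  filter_upwards [hU] with y hy using ⟨U, ho.mem_nhds hy, Ψ, ho, h0⟩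

theorem hasLocalFlow_of_eventually_eq_zero {α : OneForm I M} {X : (y : M) → TangentSpace I y}
    {K : Set M} (hK : IsClosed K) (hX : ∀ y ∉ K, X y = 0) (τ : ℝ) {y₀ : M} (hy : y₀ ∉ K) :
    HasLocalFlow I α X τ y₀ :=
  ⟨Kᶜ, hK.isOpen_compl.mem_nhds hy, fun _ y ↦ y, hK.isOpen_compl, fun _ _ ↦ rfl,
    fun y hy ↦ (isMIntegralCurve_const (hX y hy)).isMIntegralCurveOn _,
    fun _ _ _ _ ↦ ⟨contMDiffAt_id, fun v hv ↦ PreservesKer.id α _ v hv⟩⟩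

/-- The flow of a contact field with compact support. -/
theorem exists_contactFlow [I.Boundaryless] [FiniteDimensional ℝ E] [T2Space M]
    {α : OneForm I M} (hα : IsSmoothForm I α) (h0 : ∀ y, α y ≠ 0)
    {u : M → ℝ} (hu : ContMDiff I 𝓘(ℝ, ℝ) ∞ u) {X : (y : M) → TangentSpace I y}
    (hX : IsContactField I α u X) {K : Set M} (hK : IsCompact K) (hXK : ∀ y ∉ K, X y = 0) :
    ∃ φ : ℝ → M → M, (∀ y, φ 0 y = y) ∧ (∀ y, IsMIntegralCurve (fun t ↦ φ t y) X) ∧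
      (∀ s t y, φ (s + t) y = φ s (φ t y)) ∧ (∀ t, ContMDiff I I ∞ (φ t)) ∧
      (∀ t, PreservesKer I α (φ t)) ∧ ∀ t, ∀ y ∉ K, φ t y = y := by
  have : CompleteSpace E := FiniteDimensional.complete ℝ E
  have hv : ContMDiff I I.tangent 1 (fun y ↦ (⟨y, X y⟩ : TangentBundle I M)) :=
    hX.smooth.contMDiff.of_le (by exact_mod_cast le_top)
  -- Compactness of K gives a uniform time of existence on K; off K the constant flow serves for
  -- every time.
  obtain ⟨τ, hτ, hloc⟩ : ∃ τ > 0, ∀ y, HasLocalFlow I α X τ y := by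
    obtain ⟨τ, hτ, h⟩ : ∃ τ > 0, ∀ y ∈ K, HasLocalFlow I α X τ y := by
      refine hK.induction_on (p := fun s ↦ ∃ τ > 0, ∀ y ∈ s, HasLocalFlow I α X τ y)
        ⟨1, one_pos, by simp⟩ (fun s t hst ⟨τ, hτ, h⟩ ↦ ⟨τ, hτ, fun y hy ↦ h y (hst hy)⟩) ?_ ?_
      · rintro s t ⟨τ, hτ, h⟩ ⟨τ', hτ', h'⟩
        refine ⟨min τ τ', lt_min hτ hτ', fun y hy ↦ hy.elim (fun hy ↦ ?_) fun hy ↦ ?_⟩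
        · exact (h y hy).mono (min_le_left _ _)
        · exact (h' y hy).mono (min_le_right _ _)
      · intro y _
        obtain ⟨U, hU, τ, hτ, Ψ, h⟩ := exists_local_contactFlow hα hu hX y (h0 y)
        have h1 : HasLocalFlow I α X τ y := ⟨U, hU, Ψ, h⟩
        exact ⟨{y | HasLocalFlow I α X τ y}, mem_nhdsWithin_of_mem_nhds h1.eventually, τ, hτ,
          fun _ h ↦ h⟩
    refine ⟨τ, hτ, fun y ↦ ?_⟩
    by_cases hy : y ∈ K
    · exact h y hy
    · exact hasLocalFlow_of_eventually_eq_zero hK.isClosed hXK τ hy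
  have hex : ∀ y, ∃ γ : ℝ → M, γ 0 = y ∧ IsMIntegralCurve γ X := by
    refine exists_isMIntegralCurve_of_isMIntegralCurveOn hv hτ fun y ↦ ?_
    obtain ⟨U, hU, Ψ, -, h0, h1, -⟩ := hloc y
    exact ⟨fun t ↦ Ψ t y, h0 y (mem_of_mem_nhds hU), h1 y (mem_of_mem_nhds hU)⟩
  choose γ hγ0 hγ using hex
  have huniq : ∀ {c : ℝ → M} {y : M}, IsMIntegralCurve c X → c 0 = y → c = γ y :=
    fun hc h ↦ isMIntegralCurve_Ioo_eq_of_contMDiff_boundaryless (t₀ := 0) hv hc (hγ _)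
      (h.trans (hγ0 _).symm)
  have hadd : ∀ s t y, γ y (s + t) = γ (γ y t) s := by
    intro s t y
    have h1 := huniq (y := γ y t) ((hγ y).comp_add t) (by simp)
    exact congrFun h1 s
  have hsmall : ∀ t ∈ Ioo (-τ) τ, ContMDiff I I ∞ (fun y ↦ γ y t) ∧
      PreservesKer I α (fun y ↦ γ y t) := by
    intro t ht
    have h1 : ∀ y, ∃ Ψ : M → M, (fun y ↦ γ y t) =ᶠ[𝓝 y] Ψ ∧ ContMDiffAt I I ∞ Ψ y ∧
        ∀ v, α y v = 0 → α (Ψ y) (mfderiv I I Ψ y v) = 0 := by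
      intro y
      obtain ⟨U, hU, Ψ, ho, h0, h1, h2⟩ := hloc y
      refine ⟨Ψ t, ?_, h2 y (mem_of_mem_nhds hU) t ht⟩
      filter_upwards [hU] with y' hy'
      exact isMIntegralCurveOn_Ioo_eqOn_of_contMDiff_boundaryless (t₀ := 0)
        ⟨by linarith, hτ⟩ hv ((hγ y').isMIntegralCurveOn _) (h1 y' hy')
        ((hγ0 _).trans (h0 y' hy').symm) ht
    refine ⟨fun y ↦ ?_, fun y v hv ↦ ?_⟩
    · obtain ⟨Ψ, h2, h3, -⟩ := h1 y
      exact h3.congr_of_eventuallyEq h2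
    · obtain ⟨Ψ, h2, h3, h4⟩ := h1 y
      have h5 := h4 v hv
      have h6 : ∀ (p : M) (a : E), p = Ψ y → a = mfderiv I I Ψ y v → α p a = 0 := by
        rintro _ _ rfl rfl
        exact h5
      exact h6 _ _ h2.self_of_nhds (congrArg (fun A : E →L[ℝ] E ↦ A v) h2.mfderiv_eq)
  -- A long time t is k steps of the short time t / k, and smoothness and kernel preservation are
  -- stable under composition.
  have hall : ∀ t, ContMDiff I I ∞ (fun y ↦ γ y t) ∧ PreservesKer I α (fun y ↦ γ y t) := by
    have hstep : ∀ t ∈ Ioo (-τ) τ, ∀ k : ℕ, ContMDiff I I ∞ (fun y ↦ γ y (k * t)) ∧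
        PreservesKer I α (fun y ↦ γ y (k * t)) := by
      intro t ht k
      induction k with
      | zero =>
        have : (fun y ↦ γ y ((0 : ℕ) * t)) = id := by
          funext y; simp [hγ0]
        rw [this]
        exact ⟨contMDiff_id, .id α⟩
      | succ k ih =>
        have : (fun y ↦ γ y ((k + 1 : ℕ) * t)) = (fun y ↦ γ y t) ∘ fun y ↦ γ y (k * t) := by
          funext y
          rw [Function.comp, ← hadd]
          congr 1
          push_cast
          ring
        rw [this]
        exact ⟨(hsmall t ht).1.comp ih.1, (hsmall t ht).2.comp ih.2 (hsmall t ht).1 ih.1⟩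
    intro t
    obtain ⟨k, hk⟩ := exists_nat_gt (|t| / τ)
    have hk0 : (0 : ℝ) < k := lt_of_le_of_lt (by positivity) hk
    have h1 := hstep (t / k) (abs_lt.1 (by
      rw [abs_div, abs_of_pos hk0, div_lt_iff₀ hk0]
      rwa [div_lt_iff₀ hτ, mul_comm] at hk)) k
    rwa [mul_div_cancel₀ _ hk0.ne'] at h1
  refine ⟨fun t y ↦ γ y t, hγ0, hγ, hadd, fun t ↦ (hall t).1, fun t ↦ (hall t).2, ?_⟩
  intro t y hy
  exact (congrFun (huniq (isMIntegralCurve_const (hXK y hy)) rfl) t).symm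

end Flow

/-! ### Infinite composition of contactomorphisms. -/

section Swindle

set_option linter.unusedSectionVars false

variable {E : Type*} [NormedAddCommGroup E] [NormedSpace ℝ E]
  {H : Type*} [TopologicalSpace H] {I : ModelWithCorners ℝ E H}
  {M : Type*} [TopologicalSpace M] [ChartedSpace H M] [IsManifold I ∞ M]

variable (I) in
/-- A contactomorphism from `M` to itself. -/
structure IsContactPerm (α : OneForm I M) (θ : Equiv.Perm M) : Prop where
  smooth : ContMDiff I I ∞ θ
  smooth_symm : ContMDiff I I ∞ θ.symm
  ker : PreservesKer I α θ
  ker_symm : PreservesKer I α θ.symm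

theorem IsContactPerm.refl (α : OneForm I M) : IsContactPerm I α (Equiv.refl M) :=
  ⟨contMDiff_id, contMDiff_id, .id α, .id α⟩

theorem IsContactPerm.trans {α : OneForm I M} {θ η : Equiv.Perm M} (hθ : IsContactPerm I α θ)
    (hη : IsContactPerm I α η) : IsContactPerm I α (θ.trans η) :=
  ⟨hη.smooth.comp hθ.smooth, hθ.smooth_symm.comp hη.smooth_symm,
    hη.ker.comp hθ.ker hη.smooth hθ.smooth,
    hθ.ker_symm.comp hη.ker_symm hθ.smooth_symm hη.smooth_symm⟩

/-- Preservation by the map gives one inclusion; preservation by the inverse gives the other. -/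
theorem IsContactPerm.map_ker {α : OneForm I M} {θ : Equiv.Perm M} (hθ : IsContactPerm I α θ)
    {ξ : PlaneField I M} (hξ : ∀ x (v : TangentSpace I x), v ∈ ξ x ↔ α x v = 0) (x : M) :
    (ξ x).map (mfderiv I I θ x : TangentSpace I x →ₗ[ℝ] TangentSpace I (θ x)) = ξ (θ x) := by
  ext w
  constructor
  · rintro ⟨v, hv, rfl⟩
    exact (hξ _ _).2 (hθ.ker _ _ ((hξ _ _).1 hv))
  · intro hw
    have h1 := hθ.ker_symm _ _ ((hξ _ _).1 hw)
    have h2 := mfderiv_comp (θ x) ((hθ.smooth _).mdifferentiableAt (by simp))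
      ((hθ.smooth_symm (θ x)).mdifferentiableAt (by simp))
    have h3 : (θ ∘ θ.symm : M → M) = id := by funext; simp
    rw [h3, mfderiv_id] at h2
    have h4 := congrArg (fun A : E →L[ℝ] E ↦ A w) h2
    have h5 : ∀ p, p = x → ∀ a : E, α p a = 0 → w = mfderiv I I θ p a →
        w ∈ (ξ x).map (mfderiv I I θ x : TangentSpace I x →ₗ[ℝ] TangentSpace I (θ x)) := by
      rintro p rfl a ha rfl
      exact ⟨a, (hξ _ _).2 ha, rfl⟩
    exact h5 _ (θ.symm_apply_apply x) _ h1 h4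

theorem AreContactomorphic.symm {ξ : PlaneField I M} {A B : Set M}
    (h : AreContactomorphic I ξ A B) : AreContactomorphic I ξ B A := by
  obtain ⟨f, rfl, rfl, hf⟩ := h
  refine ⟨f.symm, rfl, rfl, fun y hy ↦ ?_⟩
  obtain ⟨x, hx, rfl⟩ : ∃ x ∈ f.source, f x = y :=
    ⟨f.invFun y, f.map_target' hy, f.right_inv' hy⟩
  have hl : f.symm (f x) = x := f.left_inv' hx
  have h1 : MDifferentiableAt I I f x :=
    (f.contMDiffOn_toFun.contMDiffAt (f.open_source.mem_nhds hx)).mdifferentiableAt (by simp)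
  have h2 : MDifferentiableAt I I f.symm (f x) :=
    (f.contMDiffOn_invFun.contMDiffAt (f.open_target.mem_nhds hy)).mdifferentiableAt (by simp)
  have h3 := mfderiv_comp x h2 h1
  have h4 : f.symm ∘ f =ᶠ[𝓝 x] id := by
    filter_upwards [f.open_source.mem_nhds hx] with z hz using f.left_inv' hz
  rw [h4.mfderiv_eq, mfderiv_id] at h3
  have h5 : ∀ v : E, mfderiv I I f.symm (f x) (mfderiv I I f x v) = v := fun v ↦
    (congrArg (fun A : E →L[ℝ] E ↦ A v) h3).symm
  have h6 : ∀ p, p = x → ∀ A : TangentSpace I (f x) →L[ℝ] TangentSpace I p,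
      (∀ v : E, A (mfderiv I I f x v) = v) →
      (ξ (f x)).map (A : TangentSpace I (f x) →ₗ[ℝ] TangentSpace I p) = ξ p := by
    rintro p rfl A hA
    rw [← hf p hx]
    ext w
    constructor
    · rintro ⟨_, ⟨v, hv, rfl⟩, rfl⟩
      have := hA v
      exact this.symm ▸ hv
    · intro hw
      exact ⟨_, ⟨w, hw, rfl⟩, hA w⟩
  exact h6 _ hl _ h5

theorem AreContactomorphic.trans {ξ : PlaneField I M} {A B C : Set M}
    (h : AreContactomorphic I ξ A B) (h' : AreContactomorphic I ξ B C) :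
    AreContactomorphic I ξ A C := by
  obtain ⟨f, rfl, rfl, hf⟩ := h
  obtain ⟨g, hgs, rfl, hg⟩ := h'
  refine ⟨f.trans g, ?_, ?_, fun x hx ↦ ?_⟩
  · change f.toPartialEquiv.source ∩ f ⁻¹' g.source = _
    rw [hgs]
    exact inter_eq_left.2 fun x hx ↦ f.map_source' hx
  · change g.target ∩ g.invFun ⁻¹' f.target = _
    rw [← hgs]
    exact inter_eq_left.2 fun x hx ↦ g.map_target' hx
  · have hfx : f x ∈ f.target := f.map_source' hx
    have h1 : MDifferentiableAt I I f x :=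
      (f.contMDiffOn_toFun.contMDiffAt (f.open_source.mem_nhds hx)).mdifferentiableAt (by simp)
    have h2 : MDifferentiableAt I I g (f x) :=
      (g.contMDiffOn_toFun.contMDiffAt (g.open_source.mem_nhds (hgs ▸ hfx))).mdifferentiableAt
        (by simp)
    have h3 : mfderiv I I (f.trans g) x = (mfderiv I I g (f x)).comp (mfderiv I I f x) :=
      mfderiv_comp x h2 h1
    have h4 := congrArg (Submodule.map (mfderiv I I g (f x)).toLinearMap) (hf x hx)
    refine (congrArg (fun A : E →L[ℝ] E ↦ Submodule.map (A : E →ₗ[ℝ] E) (ξ x)) h3).trans ?_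
    exact (Submodule.map_comp _ _ _).trans (h4.trans (hg _ hfx))

/-- Contactomorphisms which agree on an increasing sequence of open sets define a contactomorphism
of its union. -/
theorem areContactomorphic_iUnion {α : OneForm I M} {ξ : PlaneField I M}
    (hξ : ∀ x (v : TangentSpace I x), v ∈ ξ x ↔ α x v = 0) {D : ℕ → Set M}
    (hDo : ∀ k, IsOpen (D k)) (hD : Monotone D) {Ψ : ℕ → Equiv.Perm M}
    (hΨ : ∀ k, IsContactPerm I α (Ψ k)) (heq : ∀ k, EqOn (Ψ (k + 1)) (Ψ k) (D k)) :
    AreContactomorphic I ξ (⋃ k, D k) (⋃ k, Ψ k '' D k) := by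
  rcases isEmpty_or_nonempty M with hM | hM
  · have : ∀ s : Set M, s = ∅ := fun s ↦ Set.eq_empty_of_isEmpty s
    exact ⟨Diffeomorph.toPartialDiffeomorph (Diffeomorph.refl I M ∞),
      (this _).trans (this _).symm, (this _).trans (this _).symm, fun x ↦ isEmptyElim x⟩
  have heq' : ∀ k j, EqOn (Ψ (k + j)) (Ψ k) (D k) := by
    intro k j
    induction j with
    | zero => exact fun _ _ ↦ rfl
    | succ j ih => exact fun x hx ↦ (heq (k + j) (hD (Nat.le_add_right k j) hx)).trans (ih hx)
  choose! i hi using fun (x : M) (hx : x ∈ ⋃ k, D k) ↦ mem_iUnion.1 hx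
  let F : M → M := fun x ↦ Ψ (i x) x
  have hF : ∀ k, EqOn F (Ψ k) (D k) := by
    intro k x hx
    have h1 := hi x (mem_iUnion_of_mem k hx)
    rcases le_total k (i x) with h | h
    · obtain ⟨j, hj⟩ := Nat.exists_eq_add_of_le h
      change Ψ (i x) x = _
      rw [hj]
      exact heq' k j hx
    · obtain ⟨j, rfl⟩ := Nat.exists_eq_add_of_le h
      exact (heq' _ j h1).symm
  have hinj : InjOn F (⋃ k, D k) := by
    intro x hx y hy hxy
    obtain ⟨k, hk⟩ := mem_iUnion.1 hx
    obtain ⟨l, hl⟩ := mem_iUnion.1 hy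
    have h1 := hF _ (hD (le_max_left k l) hk)
    have h2 := hF _ (hD (le_max_right k l) hl)
    rw [h1, h2] at hxy
    exact (Ψ _).injective hxy
  have himg : F '' (⋃ k, D k) = ⋃ k, Ψ k '' D k := by
    rw [image_iUnion]
    exact iUnion_congr fun k ↦ (hF k).image_eq
  have hbij : BijOn F (⋃ k, D k) (⋃ k, Ψ k '' D k) := himg ▸ hinj.bijOn_image
  have hopen : ∀ k, IsOpen (Ψ k '' D k) := by
    intro k
    rw [Equiv.image_eq_preimage_symm]
    exact (hDo k).preimage (hΨ k).smooth_symm.continuous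
  have hinv : ∀ k, EqOn ((BijOn.toPartialEquiv F _ _ hbij)).symm (Ψ k).symm (Ψ k '' D k) := by
    rintro k _ ⟨x, hx, rfl⟩
    have h1 := (BijOn.toPartialEquiv F _ _ hbij).left_inv (mem_iUnion_of_mem k hx)
    have h2 : (BijOn.toPartialEquiv F _ _ hbij) x = Ψ k x := hF k hx
    rw [h2] at h1
    rw [h1, Equiv.symm_apply_apply]
  have hFs : ∀ x ∈ ⋃ k, D k, ∃ k, x ∈ D k ∧ F =ᶠ[𝓝 x] Ψ k := by
    intro x hx
    obtain ⟨k, hk⟩ := mem_iUnion.1 hx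
    refine ⟨k, hk, ?_⟩
    filter_upwards [(hDo k).mem_nhds hk] with y hy using hF k hy
  refine ⟨⟨(BijOn.toPartialEquiv F _ _ hbij), isOpen_iUnion hDo, isOpen_iUnion hopen, fun x hx ↦ ?_,
    fun y hy ↦ ?_⟩, rfl, rfl, fun x hx ↦ ?_⟩
  · obtain ⟨k, -, hk⟩ := hFs x hx
    exact ((hΨ k).smooth.contMDiffAt.congr_of_eventuallyEq hk).contMDiffWithinAt
  · obtain ⟨k, hk⟩ := mem_iUnion.1 hy
    refine ((hΨ k).smooth_symm.contMDiffAt.congr_of_eventuallyEq ?_).contMDiffWithinAt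
    filter_upwards [(hopen k).mem_nhds hk] with y hy using hinv k hy
  · obtain ⟨k, -, hk⟩ := hFs x hx
    have h1 := (hΨ k).map_ker hξ x
    have h2 : ∀ p, p = Ψ k x → ∀ A : TangentSpace I x →L[ℝ] TangentSpace I p,
        A = mfderiv I I (Ψ k) x →
        (ξ x).map (A : TangentSpace I x →ₗ[ℝ] TangentSpace I p) = ξ p := by
      rintro _ rfl _ rfl
      exact h1
    exact h2 _ hk.self_of_nhds _ hk.mfderiv_eq

/-- If every neighbourhood of `C` contains the image of `K (k + 1)` under a contactomorphism with
support in `K k` which preserves `C`, then the complements of `⋂ k, K k` and of `C` are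
contactomorphic. -/
theorem areContactomorphic_of_compressible {α : OneForm I M} {ξ : PlaneField I M}
    (hξ : ∀ x (v : TangentSpace I x), v ∈ ξ x ↔ α x v = 0) {C : Set M} {K V : ℕ → Set M}
    (hK : ∀ k, IsClosed (K k)) (hKa : Antitone K) (hCK : ∀ k, C ⊆ K k)
    (hV : ∀ k, IsOpen (V k)) (hVC : ⋂ k, V k = C)
    (hθ : ∀ k O, IsOpen O → C ⊆ O → ∃ θ : Equiv.Perm M, IsContactPerm I α θ ∧
      (∀ y ∉ K k, θ y = y) ∧ θ '' C = C ∧ θ '' K (k + 1) ⊆ O) :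
    AreContactomorphic I ξ (⋂ k, K k)ᶜ Cᶜ := by
  choose! θ h1 h2 h3 h4 using hθ
  -- Ψ_(k+1) = Ψ_k ∘ θ_k, the new factor acting first. Hence Ψ changes only on K_k, and since θ_k
  -- sends K_(k+1) into Ψ_k⁻¹(V_k), one gets Ψ_(k+1)(K_(k+1)) ⊆ V_k.
  let Ψ : ℕ → Equiv.Perm M := fun k ↦ Nat.rec (Equiv.refl M)
    (fun k Φ ↦ (θ k (Φ ⁻¹' V k)).trans Φ) k
  have hs : ∀ k, Ψ (k + 1) = (θ k (Ψ k ⁻¹' V k)).trans (Ψ k) := fun k ↦ rfl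
  have hall : ∀ k, IsContactPerm I α (Ψ k) ∧ Ψ k '' C = C ∧ IsOpen (Ψ k ⁻¹' V k) ∧
      C ⊆ Ψ k ⁻¹' V k := by
    have haux : ∀ k, IsContactPerm I α (Ψ k) → Ψ k '' C = C → IsOpen (Ψ k ⁻¹' V k) ∧
      C ⊆ Ψ k ⁻¹' V k := by
      intro k hk hC
      refine ⟨(hV k).preimage hk.smooth.continuous, fun y hy ↦ ?_⟩
      have : Ψ k y ∈ C := hC ▸ mem_image_of_mem _ hy
      rw [← hVC] at this
      exact mem_iInter.1 this k
    intro k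
    induction k with
    | zero => exact ⟨.refl α, image_id _, haux 0 (.refl α) (image_id _)⟩
    | succ k ih =>
      obtain ⟨i1, i2, i3, i4⟩ := ih
      have j1 : IsContactPerm I α (Ψ (k + 1)) := hs k ▸ (h1 k _ i3 i4).trans i1
      have j2 : Ψ (k + 1) '' C = C := by
        rw [hs, Equiv.coe_trans, image_comp, h3 k _ i3 i4, i2]
      exact ⟨j1, j2, haux _ j1 j2⟩
  have hcon := areContactomorphic_iUnion (I := I) (D := fun k ↦ (K k)ᶜ) hξ
    (fun k ↦ (hK k).isOpen_compl) (fun k l hkl ↦ compl_subset_compl.2 (hKa hkl))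
    (Ψ := Ψ) (fun k ↦ (hall k).1) (fun k x hx ↦ by
      rw [hs, Equiv.trans_apply, h2 k _ (hall k).2.2.1 (hall k).2.2.2 x hx])
  have hsrc : ⋃ k, (K k)ᶜ = (⋂ k, K k)ᶜ := compl_iInter K |>.symm
  have htgt : ⋃ k, Ψ k '' (K k)ᶜ = Cᶜ := by
    ext y
    simp only [mem_iUnion]
    constructor
    · rintro ⟨k, x, hx, rfl⟩ hy
      rw [← (hall k).2.1] at hy
      obtain ⟨x', hx', he⟩ := hy
      exact hx ((Ψ k).injective he ▸ hCK k hx')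
    · intro hy
      rw [← hVC, mem_compl_iff, mem_iInter, not_forall] at hy
      obtain ⟨k, hk⟩ := hy
      -- A point outside V_k is not in Ψ_(k+1)(K_(k+1)), so its preimage already lies in the region
      -- where the sequence has stabilised.
      refine ⟨k + 1, (Ψ (k + 1)).symm y, fun hmem ↦ hk ?_, (Ψ (k + 1)).apply_symm_apply y⟩
      have h5 := h4 k _ (hall k).2.2.1 (hall k).2.2.2 (mem_image_of_mem _ hmem)
      have h6 : Ψ k (θ k (Ψ k ⁻¹' V k) ((Ψ (k + 1)).symm y)) = y := by
        rw [← Equiv.trans_apply, ← hs, Equiv.apply_symm_apply]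
      rw [← h6]
      exact h5
  rwa [hsrc, htgt] at hcon

end Swindle

/-! ### Compressing sublevel sets towards the core. -/

section Compression

set_option linter.unusedSectionVars false

variable {E : Type*} [NormedAddCommGroup E] [NormedSpace ℝ E]
  {H : Type*} [TopologicalSpace H] {I : ModelWithCorners ℝ E H}
  {M : Type*} [TopologicalSpace M] [ChartedSpace H M] [IsManifold I ∞ M]

variable (I) in
/-- A region `Ω` in which the sublevel sets of `ρ` below `R` are compact, and a field `Q` which satisfies
`α(Q) = u`, `ι_Q dα = α - du` and along which `ρ` increases off its zero set. The set `C` consists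
of the points whose orbit stays in the zero set of `ρ`. -/
structure IsContactWell (α : OneForm I M) (Ω : Set M) (ρ u : M → ℝ)
    (Q : (y : M) → TangentSpace I y) (R : ℝ) (C : Set M) : Prop where
  isOpen : IsOpen Ω
  smooth_rho : ContMDiffOn I 𝓘(ℝ, ℝ) ∞ ρ Ω
  smooth_u : ContMDiffOn I 𝓘(ℝ, ℝ) ∞ u Ω
  nonneg : ∀ y ∈ Ω, 0 ≤ ρ y
  isCompact : ∀ r < R, IsCompact {y ∈ Ω | ρ y ≤ r}
  apply_eq : ∀ y ∈ Ω, α y (Q y) = u y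
  extDer_eq : ∀ y ∈ Ω, ∀ w : TangentSpace I y,
    extDer I α y (Q y) w = α y w - differential I u y w
  continuousOn : ContinuousOn (fun y ↦ differential I ρ y (Q y)) Ω
  increasing : ∀ y ∈ Ω, 0 < ρ y → 0 < differential I ρ y (Q y)
  stationary : ∀ y ∈ Ω, ρ y = 0 → differential I ρ y (Q y) = 0
  mem_core : ∀ X : (y : M) → TangentSpace I y, IsSmoothField I X →
    (∀ y ∈ Ω, ρ y = 0 → X y = Q y) → ∀ γ : ℝ → M, IsMIntegralCurve γ X →
      (∀ t, γ t ∈ Ω ∧ ρ (γ t) = 0) → γ 0 ∈ C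
  of_mem_core : ∀ X : (y : M) → TangentSpace I y, IsSmoothField I X →
    (∀ y ∈ Ω, ρ y = 0 → X y = Q y) → ∀ γ : ℝ → M, IsMIntegralCurve γ X →
      γ 0 ∈ C → ∀ t, 0 ≤ t → γ t ∈ Ω ∧ ρ (γ t) = 0

/-- A cut-off function. -/
theorem exists_cutoff {a b : ℝ} (hab : a < b) : ∃ g : ℝ → ℝ, ContDiff ℝ ∞ g ∧
    (∀ r, 0 ≤ g r) ∧ (∀ r ≤ a, g r = 1) ∧ ∀ r, b ≤ r → g r = 0 := by
  have h : 0 < b - a := sub_pos.2 hab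
  refine ⟨fun r ↦ Real.smoothTransition ((b - r) / (b - a)),
    Real.smoothTransition.contDiff.comp ((contDiff_const.sub contDiff_id).div_const _),
    fun r ↦ Real.smoothTransition.nonneg _, fun r hr ↦ ?_, fun r hr ↦ ?_⟩
  · exact Real.smoothTransition.one_of_one_le ((one_le_div h).2 (by linarith))
  · exact Real.smoothTransition.zero_of_nonpos (div_nonpos_of_nonpos_of_nonneg (by linarith) h.le)

variable {α : OneForm I M} {Ω : Set M} {ρ u : M → ℝ} {Q : (y : M) → TangentSpace I y} {R : ℝ}
  {C : Set M}

theorem differential_comp_mul {g : ℝ → ℝ} (hg : ContDiff ℝ ∞ g) {y : M}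
    (hρ : ContMDiffAt I 𝓘(ℝ, ℝ) ∞ ρ y) (hu : ContMDiffAt I 𝓘(ℝ, ℝ) ∞ u y)
    (w : TangentSpace I y) :
    differential I (fun y ↦ g (ρ y) * u y) y w =
      g (ρ y) * differential I u y w + u y * (deriv g (ρ y) * differential I ρ y w) := by
  have h1 := (hρ.mdifferentiableAt (by simp)).hasMFDerivAt
  have h2 := (hu.mdifferentiableAt (by simp)).hasMFDerivAt
  have h3 : HasMFDerivAt 𝓘(ℝ, ℝ) 𝓘(ℝ, ℝ) g (ρ y) _ :=
    ((hg.differentiable (by simp)) (ρ y)).hasDerivAt.hasFDerivAt.hasMFDerivAt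
  have h4 := (HasMFDerivAt.mul (h3.comp y h1) h2).mfderiv
  refine (congrArg (fun A : E →L[ℝ] ℝ ↦ A w) h4).trans ?_
  have h5 : ∀ (A B : E →L[ℝ] ℝ) (p q s : ℝ) (w : E), (p • A + q •
    (ContinuousLinearMap.toSpanSingleton ℝ s).comp B) w = p * A w + q * (s * B w) := by
    intro A B p q s w
    simp [mul_comm]
  exact h5 _ _ _ _ _ w

/-- The contact field of `g(ρ) u` moves `ρ` as `g(ρ) Q` does. -/
theorem IsContactWell.differential_contactField (hW : IsContactWell I α Ω ρ u Q R C) {y : M}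
    (hy : y ∈ Ω) (hc : IsContactAt I α y) {g : ℝ → ℝ} (hg : ContDiff ℝ ∞ g)
    {H : M → ℝ} (hH : ∀ y ∈ Ω, H y = g (ρ y) * u y)
    {X : (y : M) → TangentSpace I y} [I.Boundaryless] (hX : IsContactField I α H X) :
    (u y * deriv g (ρ y) = 0 → X y = g (ρ y) • Q y) ∧
    differential I ρ y (X y) = g (ρ y) * differential I ρ y (Q y) := by
  obtain ⟨c, h⟩ := hX.extDer_eq
  have hρs := hW.smooth_rho.contMDiffAt (hW.isOpen.mem_nhds hy)
  have hus := hW.smooth_u.contMDiffAt (hW.isOpen.mem_nhds hy)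
  have hev : H =ᶠ[𝓝 y] fun y ↦ g (ρ y) * u y := by
    filter_upwards [hW.isOpen.mem_nhds hy] with z hz using hH z hz
  have hdH : ∀ w : TangentSpace I y, differential I H y w =
      g (ρ y) * differential I u y w + u y * (deriv g (ρ y) * differential I ρ y w) := by
    intro w
    refine Eq.trans ?_ (differential_comp_mul hg hρs hus w)
    exact congrArg (fun A : E →L[ℝ] ℝ ↦ A w) hev.mfderiv_eq
  -- The error N = X - g Q lies in ker α, and ι_N dα = (c - g) α - u g' dρ. Inserting N gives u g'
  -- dρ(N) = 0: either dρ(N) = 0, or u g' = 0 and then N = 0 by nondegeneracy.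
  set N : TangentSpace I y := X y - g (ρ y) • Q y with hN
  have hαN : α y N = 0 := by
    rw [hN, map_sub, map_smul, hX.apply_eq, hW.apply_eq y hy, hH y hy, smul_eq_mul, sub_self]
  have hdN : ∀ w, extDer I α y N w = (c y - g (ρ y)) * α y w -
      u y * deriv g (ρ y) * differential I ρ y w := by
    intro w
    rw [hN, extDer_sub_left, extDer_smul_left, h, hW.extDer_eq y hy, hdH]
    ring
  have h0 : u y * deriv g (ρ y) = 0 → X y = g (ρ y) • Q y := fun h0 ↦ by
    refine sub_eq_zero.1 (contactField_eq_zero hc (c := c y - g (ρ y)) hαN fun w ↦ ?_)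
    rw [hdN, h0, zero_mul, sub_zero]
  refine ⟨h0, ?_⟩
  have h1 : u y * deriv g (ρ y) * differential I ρ y N = 0 := by
    have h2 := hdN N
    have h3 : extDer I α y N N = 0 := by simp [extDer]
    rw [h3, hαN] at h2
    linarith
  have h4 : differential I ρ y N = 0 := by
    by_cases hz : u y * deriv g (ρ y) = 0
    · rw [hN, h0 hz, sub_self, map_zero]
    · exact (mul_eq_zero.1 h1).resolve_left hz
  rw [hN, map_sub, map_smul, smul_eq_mul] at h4
  linarith

/-- The Hamiltonian `g(ρ) u`, extended by zero. -/
theorem IsContactWell.exists_hamiltonian [T2Space M] (hW : IsContactWell I α Ω ρ u Q R C)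
    {b : ℝ} (hb : b < R) {g : ℝ → ℝ} (hg : ContDiff ℝ ∞ g) (hgb : ∀ r, b ≤ r → g r = 0) :
    ∃ H : M → ℝ, ContMDiff I 𝓘(ℝ, ℝ) ∞ H ∧ (∀ y ∈ Ω, H y = g (ρ y) * u y) ∧
      ∀ y, y ∉ {y ∈ Ω | ρ y ≤ b} → H y = 0 := by
  classical
  set K : Set M := {y ∈ Ω | ρ y ≤ b}
  have hK : IsClosed K := (hW.isCompact b hb).isClosed
  let H : M → ℝ := fun y ↦ if y ∈ Ω then g (ρ y) * u y else 0
  have h1 : ∀ y ∈ Ω, H y = g (ρ y) * u y := fun y hy ↦ if_pos hy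
  have h2 : ∀ y, y ∉ K → H y = 0 := by
    intro y hy
    by_cases hyΩ : y ∈ Ω
    · rw [h1 y hyΩ, hgb _ (not_le.1 fun h ↦ hy ⟨hyΩ, h⟩).le, zero_mul]
    · exact if_neg hyΩ
  refine ⟨H, fun y ↦ ?_, h1, h2⟩
  by_cases hy : y ∈ Ω
  · have hn := hW.isOpen.mem_nhds hy
    have h3 : ContMDiffAt I 𝓘(ℝ, ℝ) ∞ (fun y ↦ g (ρ y) * u y) y :=
      (hg.contMDiff.contMDiffAt.comp y (hW.smooth_rho.contMDiffAt hn)).mul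
        (hW.smooth_u.contMDiffAt hn)
    refine h3.congr_of_eventuallyEq ?_
    filter_upwards [hn] with z hz using h1 z hz
  · have hyK : y ∉ K := fun h ↦ hy h.1
    have h3 : ContMDiffAt I 𝓘(ℝ, ℝ) ∞ (fun _ : M ↦ (0 : ℝ)) y := contMDiffAt_const
    refine h3.congr_of_eventuallyEq ?_
    filter_upwards [hK.isOpen_compl.mem_nhds hyK] with z hz using h2 z hz

/-- Every neighbourhood of `C` contains the image of a smaller sublevel set of `ρ` under a
contactomorphism with support in a larger one. -/
theorem IsContactWell.exists_compression [T2Space M] [I.Boundaryless] [FiniteDimensional ℝ E]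
    (hW : IsContactWell I α Ω ρ u Q R C) (hα : IsSmoothForm I α) (hc : ∀ y, IsContactAt I α y)
    {a b : ℝ} (ha : 0 < a) (hab : a < b) (hb : b < R) :
    IsClosed C ∧ C ⊆ {y ∈ Ω | ρ y = 0} ∧ ∀ O, IsOpen O → C ⊆ O →
      ∃ θ : Equiv.Perm M, IsContactPerm I α θ ∧ (∀ y, y ∉ {y ∈ Ω | ρ y ≤ b} → θ y = y) ∧
        θ '' C = C ∧ θ '' {y ∈ Ω | ρ y ≤ a} ⊆ O := by
  obtain ⟨g, hg, hg0, hga, hgb⟩ := exists_cutoff hab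
  obtain ⟨H, hH, hHΩ, hHK⟩ := hW.exists_hamiltonian hb hg hgb
  obtain ⟨X, c, hX1, hX2, hX3⟩ := exists_contactField hα hc hH
  have hX : IsContactField I α H X := ⟨hX1, hX2, c, hX3⟩
  set K : ℝ → Set M := fun r ↦ {y ∈ Ω | ρ y ≤ r} with hKdef
  have hKb : IsCompact (K b) := hW.isCompact b hb
  have hKa : IsCompact (K a) := hW.isCompact a (hab.trans hb)
  have hXK : ∀ y ∉ K b, X y = 0 := fun y hy ↦ hX.eq_zero (hc y) (by
    filter_upwards [hKb.isClosed.isOpen_compl.mem_nhds hy] with z hz using hHK z hz)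
  obtain ⟨φ, hφ0, hφX, hφadd, hφs, hφk, hφK⟩ :=
    exists_contactFlow hα (fun y ↦ (hc y).1) hH hX hKb hXK
  have hinv : ∀ t y, φ (-t) (φ t y) = y := fun t y ↦ by
    rw [← hφadd, neg_add_cancel, hφ0]
  have hinv' : ∀ t y, φ t (φ (-t) y) = y := fun t y ↦ by
    rw [← hφadd, add_neg_cancel, hφ0]
  -- Points outside K b are fixed, so K b is invariant in both time directions.
  have hstay : ∀ y ∈ K b, ∀ t, φ t y ∈ K b := by
    intro y hy t
    by_contra hcon
    have h1 := hφK (-t) _ hcon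
    rw [hinv] at h1
    exact hcon (h1 ▸ hy)
  set D : M → ℝ := fun y ↦ differential I ρ y (Q y) with hD
  have hD0 : ∀ y ∈ Ω, 0 ≤ D y := by
    intro y hy
    rcases (hW.nonneg y hy).eq_or_lt with h | h
    · exact (hW.stationary y hy h.symm).ge
    · exact (hW.increasing y hy h).le
  have hder : ∀ y ∈ K b, ∀ t,
      HasDerivAt (fun t ↦ ρ (φ t y)) (g (ρ (φ t y)) * D (φ t y)) t := by
    intro y hy t
    have hΩ : φ t y ∈ Ω := (hstay y hy t).1
    have h1 := (hW.differential_contactField hΩ (hc _) hg hHΩ hX).2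
    have h2 := ((hW.smooth_rho.contMDiffAt (hW.isOpen.mem_nhds hΩ)).mdifferentiableAt
      (by simp)).hasMFDerivAt
    have h3 : ∀ A : ℝ →L[ℝ] ℝ, HasMFDerivAt 𝓘(ℝ, ℝ) 𝓘(ℝ, ℝ) (ρ ∘ fun t ↦ φ t y) t A →
        HasDerivAt (fun t ↦ ρ (φ t y)) (A 1) t := fun A hA ↦ by
      have h4 : HasFDerivAt (fun t ↦ ρ (φ t y)) A t := hasMFDerivAt_iff_hasFDerivAt.1 hA
      exact h4.hasDerivAt
    refine (h3 _ (HasMFDerivAt.comp (f := fun t ↦ φ t y) t h2 (hφX y t))).congr_deriv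
      (Eq.trans ?_ h1)
    refine congrArg (differential I ρ (φ t y)) ?_
    exact one_smul ℝ (X (φ t y))
  have hmono : ∀ y ∈ K b, Monotone fun t ↦ ρ (φ t y) := fun y hy ↦
    monotone_of_hasDerivAt_nonneg (fun t ↦ hder y hy t)
      fun t ↦ mul_nonneg (hg0 _) (hD0 _ (hstay y hy t).1)
  have hab' : K a ⊆ K b := fun y hy ↦ ⟨hy.1, hy.2.trans hab.le⟩
  -- Since a > 0, g is constant near 0, so X and Q agree on the zero set of ρ.
  have hXQ : ∀ y ∈ Ω, ρ y = 0 → X y = Q y := by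
    intro y hy h0
    have h1 : deriv g (ρ y) = 0 := by
      have : g =ᶠ[𝓝 (ρ y)] fun _ ↦ 1 := by
        filter_upwards [Iio_mem_nhds (h0.trans_lt ha)] with r hr using hga r (le_of_lt hr)
      rw [this.deriv_eq, deriv_const]
    have h2 := (hW.differential_contactField hy (hc _) hg hHΩ hX).1 (by rw [h1, mul_zero])
    rw [h2, hga _ (h0.trans_le ha.le), one_smul]
  -- Positive times suffice: backward in time ρ cannot increase and is nonnegative, so it stays at
  -- 0.
  have hC : ∀ y, y ∈ C ↔ ∀ t, 0 ≤ t → φ t y ∈ Ω ∧ ρ (φ t y) = 0 := by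
    intro y
    have h1 := hW.mem_core X hX1 hXQ (fun t ↦ φ t y) (hφX y)
    have h2 := hW.of_mem_core X hX1 hXQ (fun t ↦ φ t y) (hφX y)
    rw [hφ0] at h1 h2
    refine ⟨h2, fun h ↦ h1 fun t ↦ ?_⟩
    have h0 := h 0 le_rfl
    rw [hφ0] at h0
    rcases le_total 0 t with ht | ht
    · exact h t ht
    · have hyK : y ∈ K b := ⟨h0.1, h0.2.trans_le (ha.trans hab).le⟩
      have h3 := hstay y hyK t
      refine ⟨h3.1, le_antisymm ?_ (hW.nonneg _ h3.1)⟩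
      have h4 : ρ (φ t y) ≤ ρ (φ 0 y) := hmono y hyK ht
      rwa [hφ0, h0.2] at h4
  have hC0 : C ⊆ {y ∈ Ω | ρ y = 0} := by
    intro y hy
    have h1 := (hC y).1 hy 0 le_rfl
    rwa [hφ0] at h1
  have hCinv : ∀ t, ∀ y ∈ C, φ t y ∈ C := by
    intro t y hy
    have hyK : y ∈ K b := ⟨(hC0 hy).1, (hC0 hy).2.trans_le (ha.trans hab).le⟩
    refine (hC _).2 fun s hs ↦ ?_
    rw [← hφadd]
    rcases le_total 0 (s + t) with h | h
    · exact (hC y).1 hy _ h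
    · have h1 := hstay y hyK (s + t)
      refine ⟨h1.1, le_antisymm ?_ (hW.nonneg _ h1.1)⟩
      have h2 : ρ (φ (s + t) y) ≤ ρ (φ 0 y) := hmono y hyK h
      rwa [hφ0, (hC0 hy).2] at h2
  -- LaSalle's argument: ρ would grow without bound along an orbit confined to K a on which it is
  -- ever positive.
  have hlasalle : ∀ y, (∀ n : ℕ, φ n y ∈ K a) → y ∈ C := by
    intro y hy
    have hyK : y ∈ K b := by
      have := hy 0
      rw [Nat.cast_zero, hφ0] at this
      exact hab' this
    have hya : ∀ t, φ t y ∈ K a := by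
      intro t
      obtain ⟨n, hn⟩ := exists_nat_ge t
      exact ⟨(hstay y hyK t).1, (hmono y hyK hn).trans (hy n).2⟩
    refine (hC y).2 fun s _ ↦ ⟨(hya s).1, ?_⟩
    by_contra hne
    have hpos : 0 < ρ (φ s y) := lt_of_le_of_ne (hW.nonneg _ (hya s).1) (Ne.symm hne)
    -- The orbit after time s remains in this compact set, on which dρ(Q) attains a positive minimum
    -- D y₁; there g(ρ) = 1.
    set A : Set M := K a ∩ ρ ⁻¹' Ici (ρ (φ s y)) with hA
    have hAc : IsCompact A := by
      have h1 : ContinuousOn ρ (K a) := hW.smooth_rho.continuousOn.mono fun y hy ↦ hy.1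
      exact hKa.of_isClosed_subset
        (h1.preimage_isClosed_of_isClosed hKa.isClosed isClosed_Ici) inter_subset_left
    have hAs : φ s y ∈ A := ⟨hya s, le_refl (ρ (φ s y))⟩
    obtain ⟨y₁, hy₁, hmin⟩ := hAc.exists_isMinOn ⟨_, hAs⟩
      (hW.continuousOn.mono fun y hy ↦ hy.1.1)
    have hm : 0 < D y₁ := hW.increasing y₁ hy₁.1.1 (hpos.trans_le hy₁.2)
    have hgrow : ∀ t, s ≤ t → D y₁ ≤ g (ρ (φ t y)) * D (φ t y) := by
      intro t ht
      rw [hga _ (hya t).2, one_mul]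
      exact hmin ⟨hya t, hmono y hyK ht⟩
    have hlin : ∀ t, s ≤ t → D y₁ * (t - s) ≤ ρ (φ t y) - ρ (φ s y) := by
      intro t ht
      refine Convex.mul_sub_le_image_sub_of_le_deriv (convex_Ici s)
        (fun t _ ↦ (hder y hyK t).continuousAt.continuousWithinAt)
        (fun t _ ↦ (hder y hyK t).differentiableAt.differentiableWithinAt) (fun t ht ↦ ?_)
        s self_mem_Ici t ht ht
      rw [(hder y hyK t).deriv]
      exact hgrow t (interior_subset ht)
    -- This time is enough to raise ρ by a + 1, beyond the bound a.
    have h1 := hlin (s + (a + 1) / D y₁) (le_add_of_nonneg_right (by positivity))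
    have h2 : D y₁ * (s + (a + 1) / D y₁ - s) = a + 1 := by
      field_simp
      ring
    have h3 := (hya (s + (a + 1) / D y₁)).2
    linarith
  set V : ℕ → Set M := fun n ↦ φ (-n) '' K a with hV
  have hVmem : ∀ n y, y ∈ V n ↔ φ n y ∈ K a := by
    intro n y
    constructor
    · rintro ⟨x, hx, rfl⟩
      rwa [hinv']
    · exact fun h ↦ ⟨_, h, hinv _ _⟩
  have hVc : ∀ n, IsCompact (V n) := fun n ↦ hKa.image (hφs _).continuous
  have hCV : ⋂ n, V n = C := by
    ext y
    simp only [mem_iInter, hVmem]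
    refine ⟨hlasalle y, fun hy n ↦ ?_⟩
    have h1 := (hC y).1 hy n n.cast_nonneg
    exact ⟨h1.1, h1.2.trans_le ha.le⟩
  have hVanti : Antitone V := by
    intro n k hnk y hy
    rw [hVmem] at hy ⊢
    have h1 := hstay _ (hab' hy) (-k)
    rw [hinv] at h1
    exact ⟨(hstay y h1 n).1, (hmono y h1 (Nat.cast_le.2 hnk)).trans hy.2⟩
  refine ⟨hCV ▸ isClosed_iInter fun n ↦ (hVc n).isClosed, hC0, fun O hO hCO ↦ ?_⟩
  -- The sets φ_(-n)(K a) are compact and decrease to C, so one of them lies in O. The time -n map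
  -- is the required contactomorphism.
  obtain ⟨n, hn⟩ := exists_subset_nhds_of_isCompact hVanti.directed_ge hVc
    fun x hx ↦ hO.mem_nhds (hCO (hCV ▸ hx))
  have hneg : ∀ t y, φ (- -t) (φ (-t) y) = y := fun t y ↦ by rw [neg_neg, hinv']
  refine ⟨⟨φ (-n), φ n, hinv' n, hinv n⟩, ⟨hφs _, hφs _, hφk _, hφk _⟩, fun y hy ↦ hφK _ y hy,
    ?_, hn⟩
  refine Subset.antisymm ?_ fun y hy ↦ ⟨φ n y, hCinv _ _ hy, hinv _ _⟩
  rintro _ ⟨y, hy, rfl⟩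
  exact hCinv _ _ hy

/-- The complement of every sublevel set of `ρ` is contactomorphic to the complement of `C`. -/
theorem IsContactWell.areContactomorphic [T2Space M] [SecondCountableTopology M] [I.Boundaryless]
    [FiniteDimensional ℝ E] (hW : IsContactWell I α Ω ρ u Q R C) {ξ : PlaneField I M}
    (hξ : IsContactFormFor I α ξ) {m : ℝ} (hm : 0 ≤ m) (hmR : m < R) :
    AreContactomorphic I ξ {y ∈ Ω | ρ y ≤ m}ᶜ Cᶜ := by
  have : LocallyCompactSpace H := I.locallyCompactSpace
  have : LocallyCompactSpace M := Manifold.locallyCompact_of_finiteDimensional I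
  let _ : MetricSpace M := TopologicalSpace.metrizableSpaceMetric M
  -- Levels strictly decreasing to m, starting halfway to R so that all are below R. They are
  -- positive even when m = 0, as the compression requires.
  set b : ℕ → ℝ := fun k ↦ m + (R - m) / (k + 2) with hb
  have hRm : 0 < R - m := sub_pos.2 hmR
  have hbm : ∀ k, m < b k := fun k ↦ by simp only [hb]; linarith [show 0 < (R - m) / (k + 2) by positivity]
  have hbanti : StrictAnti b := by
    refine strictAnti_nat_of_succ_lt fun k ↦ ?_
    simp only [hb]
    gcongr
    simp
  have hbR : ∀ k, b k < R := by
    intro k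
    refine (hbanti.antitone (Nat.zero_le k)).trans_lt ?_
    simp only [hb, Nat.cast_zero, zero_add]
    linarith
  have hcomp := fun k ↦ hW.exists_compression hξ.smooth hξ.contact (hm.trans_lt (hbm (k + 1)))
    (hbanti (Nat.lt_succ_self k)) (hbR k)
  -- A closed set in a metrizable space is a countable intersection of open sets.
  obtain ⟨V, hV, hVC⟩ := (hcomp 0).1.isGδ.eq_iInter_nat
  have hcon := areContactomorphic_of_compressible hξ.ker_eq (C := C)
    (K := fun k ↦ {y ∈ Ω | ρ y ≤ b k}) (fun k ↦ (hW.isCompact _ (hbR k)).isClosed)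
    (fun k l hkl y hy ↦ ⟨hy.1, hy.2.trans (hbanti.antitone hkl)⟩)
    (fun k y hy ↦ ⟨((hcomp 0).2.1 hy).1, ((hcomp 0).2.1 hy).2.trans_le (hm.trans (hbm k).le)⟩)
    hV hVC.symm fun k O hO hCO ↦ (hcomp k).2.2 O hO hCO
  have hK : ⋂ k, {y ∈ Ω | ρ y ≤ b k} = {y ∈ Ω | ρ y ≤ m} := by
    ext y
    simp only [mem_iInter, mem_ofPred_eq]
    refine ⟨fun h ↦ ⟨(h 0).1, ?_⟩, fun h k ↦ ⟨h.1, h.2.trans (hbm k).le⟩⟩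
    have hlim : Filter.Tendsto b Filter.atTop (𝓝 m) := by
      have h1 : Filter.Tendsto (fun k : ℕ ↦ (R - m) / ((k : ℝ) + 2)) Filter.atTop (𝓝 0) :=
        Filter.Tendsto.div_atTop tendsto_const_nhds
          (Filter.tendsto_atTop_add_const_right _ _ tendsto_natCast_atTop_atTop)
      simpa [hb] using h1.const_add m
    exact ge_of_tendsto' hlim fun k ↦ (h k).2
  rwa [hK] at hcon

end Compression

/-! ### Open maps, minima and lifts of curves. -/

section Maps

set_option linter.unusedSectionVars false

variable {E : Type*} [NormedAddCommGroup E] [NormedSpace ℝ E]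
  {H : Type*} [TopologicalSpace H] {I : ModelWithCorners ℝ E H}
  {M : Type*} [TopologicalSpace M] [ChartedSpace H M] [IsManifold I ∞ M]
  {E' : Type*} [NormedAddCommGroup E'] [NormedSpace ℝ E']
  {H' : Type*} [TopologicalSpace H'] {I' : ModelWithCorners ℝ E' H'}
  {N : Type*} [TopologicalSpace N] [ChartedSpace H' N] [IsManifold I' ∞ N]

/-- A smooth map is open at every interior point at which its differential is onto. -/
theorem map_nhds_eq_of_surjective_mfderiv [CompleteSpace E] [CompleteSpace E'] [I'.Boundaryless]
    {f : M → N} {x : M} (hf : ContMDiffAt I I' ∞ f x) (hx : I.IsInteriorPoint x)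
    (hs : Function.Surjective (mfderiv I I' f x)) : Filter.map f (𝓝 x) = 𝓝 (f x) := by
  have hr : range I ∈ 𝓝 (extChartAt I x x) := range_mem_nhds_isInteriorPoint hx
  set F := writtenInExtChartAt I I' x f with hF
  have h1 : ContDiffAt ℝ ∞ F (extChartAt I x x) :=
    (contMDiffAt_iff.1 hf).2.contDiffAt hr
  have h2 : mfderiv I I' f x = fderiv ℝ F (extChartAt I x x) := by
    rw [(hf.mdifferentiableAt (by simp)).mfderiv, fderivWithin_of_mem_nhds hr]
  have h3 := (h1.hasStrictFDerivAt (by simp)).map_nhds_eq_of_surj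
    (LinearMap.range_eq_top.2 (by
      have h4 : Function.Surjective (fderiv ℝ F (extChartAt I x x)) := by
        rw [← h2]; exact hs
      exact h4))
  have hFx : F (extChartAt I x x) = extChartAt I' (f x) (f x) := by
    simp [hF, writtenInExtChartAt]
  have h5 : Filter.map (extChartAt I x) (𝓝 x) = 𝓝 (extChartAt I x x) := by
    rw [map_extChartAt_nhds, nhdsWithin_eq_nhds.2 hr]
  have h6 : Filter.map (extChartAt I' (f x)).symm (𝓝 (extChartAt I' (f x) (f x))) = 𝓝 (f x) := by
    have := map_extChartAt_symm_nhdsWithin_range (I := I') (f x)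
    rwa [I'.range_eq_univ, nhdsWithin_univ] at this
  have h7 : f =ᶠ[𝓝 x] (extChartAt I' (f x)).symm ∘ F ∘ extChartAt I x := by
    filter_upwards [extChartAt_source_mem_nhds (I := I) x,
      hf.continuousAt.preimage_mem_nhds (extChartAt_source_mem_nhds (I := I') (f x))] with y hy hy'
    simp only [hF, writtenInExtChartAt, Function.comp, (extChartAt I x).left_inv hy]
    exact ((extChartAt I' (f x)).left_inv hy').symm
  rw [Filter.map_congr h7, ← Filter.map_map, ← Filter.map_map, h5, h3, hFx, h6]

/-- The differential of a function vanishes at an interior minimum. -/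
theorem differential_eq_zero_of_isLocalMin {u : M → ℝ} {x : M} (hx : I.IsInteriorPoint x)
    (hu : IsLocalMin u x) (v : TangentSpace I x) : differential I u x v = 0 := by
  by_cases hd : MDifferentiableAt I 𝓘(ℝ, ℝ) u x
  · have hr : range I ∈ 𝓝 (extChartAt I x x) := range_mem_nhds_isInteriorPoint hx
    have h1 : IsLocalMin (writtenInExtChartAt I 𝓘(ℝ, ℝ) x u) (extChartAt I x x) := by
      have h2 : Filter.Tendsto (extChartAt I x).symm (𝓝 (extChartAt I x x)) (𝓝 x) := by
        have := continuousAt_extChartAt_symm (I := I) x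
        rwa [ContinuousAt, extChartAt_to_inv] at this
      have h3 := h2.eventually hu
      filter_upwards [h3] with z hz
      simpa only [writtenInExtChartAt, extChartAt_model_space_eq_id, PartialEquiv.refl_coe,
        Function.comp, extChartAt_to_inv, id] using hz
    have h4 : mfderiv I 𝓘(ℝ, ℝ) u x = 0 := by
      rw [hd.mfderiv, fderivWithin_of_mem_nhds hr]
      exact h1.fderiv_eq_zero
    exact congrArg (fun A : E →L[ℝ] ℝ ↦ A v) h4
  · exact congrArg (fun A : E →L[ℝ] ℝ ↦ A v) (mfderiv_zero_of_not_mdifferentiableAt hd)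

/-- Integral curves of smooth fields are of class `C^1`. -/
theorem contMDiff_one_of_isMIntegralCurve [I.Boundaryless] {X : (y : M) → TangentSpace I y}
    (hX : IsSmoothField I X) {γ : ℝ → M} (hγ : IsMIntegralCurve γ X) :
    ContMDiff 𝓘(ℝ, ℝ) I 1 γ := by
  intro t
  refine contMDiffAt_iff.2 ⟨hγ.continuous.continuousAt, ?_⟩
  simp only [extChartAt_model_space_eq_id, PartialEquiv.refl_symm, PartialEquiv.refl_coe,
    Function.comp_id, modelWithCornersSelf_coe, range_id, id_eq, contDiffWithinAt_univ]
  set s : Set ℝ := γ ⁻¹' (extChartAt I (γ t)).source with hs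
  have hso : IsOpen s := (isOpen_extChartAt_source (γ t)).preimage hγ.continuous
  have hc : ContinuousOn (extChartAt I (γ t) ∘ γ) s :=
    (continuousOn_extChartAt (γ t)).comp hγ.continuous.continuousOn fun _ h ↦ h
  have hd : ∀ r ∈ s, HasDerivAt (extChartAt I (γ t) ∘ γ)
      (localField I X (γ t) (extChartAt I (γ t) (γ r))) r := by
    intro r hr
    have hr' : γ r ∈ (chartAt H (γ t)).source := by rwa [← extChartAt_source I]
    have h1 := ((mdifferentiableAt_extChartAt hr').hasMFDerivAt.comp r (hγ r))
    have h2 : ∀ A : ℝ →L[ℝ] E, HasMFDerivAt 𝓘(ℝ, ℝ) 𝓘(ℝ, E) (extChartAt I (γ t) ∘ γ) r A →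
        HasDerivAt (extChartAt I (γ t) ∘ γ) (A 1) r := fun A hA ↦ by
      have h4 : HasFDerivAt (extChartAt I (γ t) ∘ γ) A r := hasMFDerivAt_iff_hasFDerivAt.1 hA
      exact h4.hasDerivAt
    refine (h2 _ h1).congr_deriv ?_
    rw [localField, (extChartAt I (γ t)).left_inv hr]
    exact congrArg (mfderiv I 𝓘(ℝ, E) (extChartAt I (γ t)) (γ r)) (one_smul ℝ (X (γ r)))
  refine contDiffAt_one_iff.2 ⟨fun r ↦ ContinuousLinearMap.toSpanSingleton ℝ
    (localField I X (γ t) (extChartAt I (γ t) (γ r))), s,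
    hso.mem_nhds (mem_extChartAt_source (γ t)), ?_, fun r hr ↦ (hd r hr).hasFDerivAt⟩
  have h1 : ContinuousOn (fun r ↦ localField I X (γ t) (extChartAt I (γ t) (γ r))) s :=
    (hX (γ t)).continuousOn.comp hc fun r hr ↦ (extChartAt I (γ t)).map_source hr
  exact (ContinuousLinearMap.toSpanSingletonCLE (𝕜 := ℝ) (E := E)).continuous.comp_continuousOn h1

/-- A continuous lift of a differentiable curve through an immersion is differentiable. -/
theorem mdifferentiableAt_lift {f : M → N} {s : ℝ → M} {t : ℝ} (hs : ContinuousAt s t)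
    (hf : Manifold.IsImmersionAt I I' ∞ f (s t)) (h : ContMDiffAt 𝓘(ℝ, ℝ) I' 1 (f ∘ s) t) :
    MDifferentiableAt 𝓘(ℝ, ℝ) I s t := by
  -- The curve is only known to be of class C¹, so the immersion is regarded as C¹ through the same
  -- charts.
  have h1 : Manifold.IsImmersionAt I I' 1 f (s t) :=
    .mk_of_charts hf.equiv hf.domChart hf.codChart hf.mem_domChart_source hf.mem_codChart_source
      (IsManifold.maximalAtlas_subset_of_le (by exact_mod_cast le_top) hf.domChart_mem_maximalAtlas)
      (IsManifold.maximalAtlas_subset_of_le (by exact_mod_cast le_top) hf.codChart_mem_maximalAtlas)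
      hf.source_subset_preimage_source hf.writtenInCharts
  exact ((ContMDiffAt.iff_comp_isImmersionAt h1).2 ⟨hs, h⟩).mdifferentiableAt (by simp)

/-- The derivative of a function along a smooth vector field is continuous. -/
theorem continuous_differential_apply {u : M → ℝ} (hu : ContMDiff I 𝓘(ℝ, ℝ) ∞ u)
    {Z : (x : M) → TangentSpace I x}
    (hZ : ContMDiff I I.tangent ∞ (fun x ↦ (⟨x, Z x⟩ : TangentBundle I M))) :
    Continuous fun x ↦ differential I u x (Z x) := by
  have h1 : Continuous (tangentMap I 𝓘(ℝ, ℝ) u) := hu.continuous_tangentMap (by simp)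
  have h2 : Continuous fun p : TangentBundle 𝓘(ℝ, ℝ) ℝ ↦ p.2 :=
    (contMDiff_snd_tangentBundle_modelSpace ℝ 𝓘(ℝ, ℝ) (n := 0)).continuous
  exact h2.comp (h1.comp hZ.continuous)

end Maps

section Opens

theorem hasMFDerivAt_opens_val (V : TopologicalSpace.Opens ℝ) (q : V) :
    HasMFDerivAt 𝓘(ℝ, ℝ) 𝓘(ℝ, ℝ) (fun q : V ↦ (q : ℝ)) q (ContinuousLinearMap.id ℝ ℝ) := by
  have hv : ∀ x : V, extChartAt 𝓘(ℝ, ℝ) q x = (x : ℝ) := fun x ↦ rfl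
  refine ⟨continuous_subtype_val.continuousAt, ?_⟩
  have h : writtenInExtChartAt 𝓘(ℝ, ℝ) 𝓘(ℝ, ℝ) q (fun q : V ↦ (q : ℝ))
      =ᶠ[𝓝 (extChartAt 𝓘(ℝ, ℝ) q q)] id := by
    filter_upwards [extChartAt_target_mem_nhds (I := 𝓘(ℝ, ℝ)) q] with z hz
    have h1 := (extChartAt 𝓘(ℝ, ℝ) q).right_inv hz
    rw [hv] at h1
    simpa only [writtenInExtChartAt, extChartAt_model_space_eq_id, PartialEquiv.refl_coe,
        Function.comp, id] using h1
  exact ((hasFDerivAt_id _).congr_of_eventuallyEq h).hasFDerivWithinAt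

end Opens

/-! ### The model form and the radial field on the thickening. -/

section Weinstein

set_option linter.unusedSectionVars false

variable {n : ℕ} [NeZero n]
  {Y : Type*} [TopologicalSpace Y] [ChartedSpace (EuclideanSpace ℝ (Fin (2 * n + 1))) Y]
  [IsManifold (𝓡 (2 * n + 1)) ∞ Y]
  {S : Type*} [TopologicalSpace S] [CompactSpace S] [ChartedSpace (EuclideanHalfSpace (2 * n)) S]
  [IsManifold (𝓡∂ (2 * n)) ∞ S] {ξ : PlaneField (𝓡 (2 * n + 1)) Y}

theorem extDer_zero_left {α : OneForm (𝓡 (2 * n + 1)) Y} {y : Y}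
    (w : TangentSpace (𝓡 (2 * n + 1)) y) : extDer (𝓡 (2 * n + 1)) α y 0 w = 0 := by
  have := extDer_smul_left α y 0 0 w
  rwa [zero_smul, zero_mul] at this

namespace WeinsteinHypersurface

/-- A vector killed by the differential would be in the radical of the restricted symplectic form.
-/
theorem mfderiv_emb_injective (W : WeinsteinHypersurface S ξ) (x : S) :
    Function.Injective (mfderiv (𝓡∂ (2 * n)) (𝓡 (2 * n + 1)) W.emb x) := by
  refine (injective_iff_map_eq_zero _).2 fun v hv ↦ W.symplectic x v fun w ↦ ?_
  rw [hv, extDer_zero_left]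

/-- λ(Z) = dλ(Z, Z) = 0. -/
theorem liouvilleForm_liouville (W : WeinsteinHypersurface S ξ) (x : S) :
    W.liouvilleForm x (W.liouville x) = 0 := by
  refine (W.liouville_dual x (W.liouville x)).symm.trans ?_
  simp [extDer]

end WeinsteinHypersurface

namespace ContactSurrounding

variable {W : WeinsteinHypersurface S ξ}
  {S' : Type*} [TopologicalSpace S'] [CompactSpace S']
  [ChartedSpace (EuclideanHalfSpace (2 * n)) S'] [IsManifold (𝓡∂ (2 * n)) ∞ S']
  {B : Type*} [TopologicalSpace B] [ChartedSpace (EuclideanSpace ℝ (Fin (2 * n - 1))) B]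
  [IsManifold (𝓡 (2 * n - 1)) ∞ B] (U : ContactSurrounding W S' B)

/-- The interval `(-ε, ε)`. -/
abbrev interval : TopologicalSpace.Opens ℝ := ⟨Ioo (-U.ε) U.ε, isOpen_Ioo⟩

/-- The function `h ^ 2 + u ^ 2` on the thickening. -/
def radius (p : S' × U.interval) : ℝ := U.h p.1 ^ 2 + (p.2 : ℝ) ^ 2

/-- The field `(Z, u ∂ / ∂u)` on the thickening. -/
noncomputable def field (p : S' × U.interval) : TangentSpace ((𝓡∂ (2 * n)).prod 𝓘(ℝ, ℝ)) p :=
  ((U.ext.liouville p.1, (p.2 : ℝ)) : EuclideanSpace ℝ (Fin (2 * n)) × ℝ)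

theorem hasMFDerivAt_coord (p : S' × U.interval) :
    HasMFDerivAt ((𝓡∂ (2 * n)).prod 𝓘(ℝ, ℝ)) 𝓘(ℝ, ℝ) (fun q : S' × U.interval ↦ (q.2 : ℝ)) p
      (ContinuousLinearMap.snd ℝ (EuclideanSpace ℝ (Fin (2 * n))) ℝ) :=
  (hasMFDerivAt_opens_val U.interval p.2).comp p (hasMFDerivAt_snd p)

theorem contMDiff_coord : ContMDiff ((𝓡∂ (2 * n)).prod 𝓘(ℝ, ℝ)) 𝓘(ℝ, ℝ) ∞
    (fun q : S' × U.interval ↦ (q.2 : ℝ)) :=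
  contMDiff_subtype_val.comp contMDiff_snd

theorem contMDiff_radius : ContMDiff ((𝓡∂ (2 * n)).prod 𝓘(ℝ, ℝ)) 𝓘(ℝ, ℝ) ∞ U.radius := by
  have h1 : ContMDiff ((𝓡∂ (2 * n)).prod 𝓘(ℝ, ℝ)) 𝓘(ℝ, ℝ) ∞
      (fun q : S' × U.interval ↦ U.h q.1) := U.h_smooth.comp contMDiff_fst
  exact ((contDiff_fst.pow 2).add (contDiff_snd.pow 2)).contMDiff.comp
    (h1.prodMk_space U.contMDiff_coord)

theorem differential_radius (p : S' × U.interval) :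
    differential ((𝓡∂ (2 * n)).prod 𝓘(ℝ, ℝ)) U.radius p (U.field p) =
      2 * U.h p.1 * differential (𝓡∂ (2 * n)) U.h p.1 (U.ext.liouville p.1) +
        2 * (p.2 : ℝ) ^ 2 := by
  have h1 : HasMFDerivAt ((𝓡∂ (2 * n)).prod 𝓘(ℝ, ℝ)) 𝓘(ℝ, ℝ)
      (fun q : S' × U.interval ↦ U.h q.1) p _ :=
    ((U.h_smooth p.1).mdifferentiableAt (by simp)).hasMFDerivAt.comp p (hasMFDerivAt_fst p)
  have h2 := U.hasMFDerivAt_coord p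
  have h3 := (HasMFDerivAt.add (h1.mul h1) (h2.mul h2)).mfderiv
  have h4 : U.radius = ((fun q : S' × U.interval ↦ U.h q.1) * fun q ↦ U.h q.1) +
      ((fun q : S' × U.interval ↦ (q.2 : ℝ)) * fun q ↦ (q.2 : ℝ)) := by
    funext q
    simp only [radius, Pi.add_apply, Pi.mul_apply]
    ring
  rw [← h4] at h3
  refine (congrArg (fun A : (EuclideanSpace ℝ (Fin (2 * n)) × ℝ) →L[ℝ] ℝ ↦ A
    (U.ext.liouville p.1, (p.2 : ℝ))) h3).trans ?_
  have h5 : ∀ (A : EuclideanSpace ℝ (Fin (2 * n)) →L[ℝ] ℝ)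
      (a : EuclideanSpace ℝ (Fin (2 * n))) (s r : ℝ),
      ((s • A.comp (ContinuousLinearMap.fst ℝ _ ℝ) + s • A.comp (ContinuousLinearMap.fst ℝ _ ℝ)) +
        (r • ContinuousLinearMap.snd ℝ (EuclideanSpace ℝ (Fin (2 * n))) ℝ +
          r • ContinuousLinearMap.snd ℝ (EuclideanSpace ℝ (Fin (2 * n))) ℝ)) (a, r) =
        2 * s * A a + 2 * r ^ 2 := by
    intro A a s r
    simp
    ring
  exact h5 _ _ _ _

theorem form_thick (p : S' × U.interval) (a : EuclideanSpace ℝ (Fin (2 * n)) × ℝ) :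
    U.ext.form (U.thick p)
      (mfderiv ((𝓡∂ (2 * n)).prod 𝓘(ℝ, ℝ)) (𝓡 (2 * n + 1)) U.thick p a) =
    U.ext.liouvilleForm p.1 a.1 +
      a.2 := by
  have h1 := congrArg (fun A : (EuclideanSpace ℝ (Fin (2 * n)) × ℝ) →L[ℝ] ℝ ↦ A a)
    (congrFun U.thick_form p)
  refine h1.trans ?_
  have h2 := (hasMFDerivAt_fst (I := 𝓡∂ (2 * n)) (I' := 𝓘(ℝ, ℝ)) p).mfderiv
  have h3 := (U.hasMFDerivAt_coord p).mfderiv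
  have h4 : ∀ (A : EuclideanSpace ℝ (Fin (2 * n)) →L[ℝ] ℝ)
      (F : (EuclideanSpace ℝ (Fin (2 * n)) × ℝ) →L[ℝ] EuclideanSpace ℝ (Fin (2 * n)))
      (G : (EuclideanSpace ℝ (Fin (2 * n)) × ℝ) →L[ℝ] ℝ)
      (a : EuclideanSpace ℝ (Fin (2 * n)) × ℝ), F = ContinuousLinearMap.fst ℝ _ ℝ →
      G = ContinuousLinearMap.snd ℝ _ ℝ → (A.comp F + G) a = A a.1 + a.2 := by
    rintro A _ _ a rfl rfl
    simp
  exact h4 _ _ _ _ h2 h3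

/-- du is closed, so only π^* λ_Σ contributes. It is written as the pull-back of λ along `emb ∘
fst`, so that naturality applies to a smooth form on the boundaryless Y. -/
theorem extDer_thick (p : S' × U.interval) (a b : EuclideanSpace ℝ (Fin (2 * n)) × ℝ) :
    extDer (𝓡 (2 * n + 1)) U.ext.form (U.thick p)
      (mfderiv ((𝓡∂ (2 * n)).prod 𝓘(ℝ, ℝ)) (𝓡 (2 * n + 1)) U.thick p a)
      (mfderiv ((𝓡∂ (2 * n)).prod 𝓘(ℝ, ℝ)) (𝓡 (2 * n + 1)) U.thick p b) =
    extDer (𝓡 (2 * n + 1)) U.ext.form (U.ext.emb p.1)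
      (mfderiv (𝓡∂ (2 * n)) (𝓡 (2 * n + 1)) U.ext.emb p.1
        a.1)
      (mfderiv (𝓡∂ (2 * n)) (𝓡 (2 * n + 1)) U.ext.emb p.1
        b.1) := by
  have hα := U.ext.isContactFormFor.smooth
  have ht := U.thick_isSmoothEmbedding.contMDiff
  have he : ContMDiff ((𝓡∂ (2 * n)).prod 𝓘(ℝ, ℝ)) (𝓡 (2 * n + 1)) ∞
      (U.ext.emb ∘ (Prod.fst : S' × U.interval → S')) :=
    U.ext.isSmoothEmbedding.contMDiff.comp contMDiff_fst
  have hpb : pullback ((𝓡∂ (2 * n)).prod 𝓘(ℝ, ℝ)) (𝓡∂ (2 * n)) Prod.fst U.ext.liouvilleForm =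
      pullback ((𝓡∂ (2 * n)).prod 𝓘(ℝ, ℝ)) (𝓡 (2 * n + 1))
        (U.ext.emb ∘ (Prod.fst : S' × U.interval → S')) U.ext.form := by
    funext q
    have h1 := mfderiv_comp (I := (𝓡∂ (2 * n)).prod 𝓘(ℝ, ℝ)) (I' := 𝓡∂ (2 * n))
      (I'' := 𝓡 (2 * n + 1)) q
      ((U.ext.isSmoothEmbedding.contMDiff q.1).mdifferentiableAt (by simp))
      ((contMDiff_fst (n := ∞) q).mdifferentiableAt (by simp))
    simp only [pullback]
    rw [h1]
    rfl
  have hform := U.thick_form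
  rw [hpb] at hform
  obtain ⟨D1, hD1, -⟩ := hasFDerivWithinAt_localForm_pullback
    (Filter.Eventually.of_forall fun y ↦ he y) hα (x := p)
  obtain ⟨D2, hD2, -⟩ := hasFDerivWithinAt_localForm_pullback
    (Filter.Eventually.of_forall fun y ↦ U.contMDiff_coord y) isSmoothForm_stdForm (x := p)
  have h0 := extDer_pullback (.of_forall fun y ↦ ht y) hα a b (x := p)
  have h1 := extDer_add (β := differential ((𝓡∂ (2 * n)).prod 𝓘(ℝ, ℝ))
    (fun q : S' × U.interval ↦ (q.2 : ℝ))) hD1.differentiableWithinAt hD2.differentiableWithinAt a b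
  have h4 := congrArg (fun β ↦ extDer ((𝓡∂ (2 * n)).prod 𝓘(ℝ, ℝ)) β p a b) hform
  refine h0.symm.trans (h4.trans (h1.trans ((congrArg (_ + ·)
    (extDer_differential U.contMDiff_coord p a b)).trans ((add_zero _).trans
    ((extDer_pullback (.of_forall fun y ↦ he y) hα _ _).trans ?_)))))
  have h2 := (HasMFDerivAt.comp p ((U.ext.isSmoothEmbedding.contMDiff p.1).mdifferentiableAt
    (by simp)).hasMFDerivAt (hasMFDerivAt_fst (I := 𝓡∂ (2 * n)) (I' := 𝓘(ℝ, ℝ)) p)).mfderiv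
  have h3 : ∀ c : EuclideanSpace ℝ (Fin (2 * n)) × ℝ,
      mfderiv ((𝓡∂ (2 * n)).prod 𝓘(ℝ, ℝ)) (𝓡 (2 * n + 1))
        (U.ext.emb ∘ (Prod.fst : S' × U.interval → S')) p c =
      mfderiv (𝓡∂ (2 * n)) (𝓡 (2 * n + 1)) U.ext.emb p.1 c.1 := fun c ↦
    congrArg (fun A : (EuclideanSpace ℝ (Fin (2 * n)) × ℝ) →L[ℝ] _ ↦ A c) h2
  exact congrArg₂ (extDer (𝓡 (2 * n + 1)) U.ext.form (U.ext.emb p.1)) (h3 a) (h3 b)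

/-- For (v, r) in the kernel, dλ detects v because it is symplectic on Σ̃; once v = 0, λ takes the
value r. -/
theorem mfderiv_thick_injective (p : S' × U.interval) : Function.Injective
    (mfderiv ((𝓡∂ (2 * n)).prod 𝓘(ℝ, ℝ)) (𝓡 (2 * n + 1)) U.thick p) := by
  have h : ∀ a : EuclideanSpace ℝ (Fin (2 * n)) × ℝ,
      mfderiv ((𝓡∂ (2 * n)).prod 𝓘(ℝ, ℝ)) (𝓡 (2 * n + 1)) U.thick p a = 0 → a = 0 := by
    rintro ⟨v, r⟩ ha
    have h1 : v = 0 := by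
      refine U.ext.symplectic p.1 _ fun w ↦ ?_
      have h2 := U.extDer_thick p (v, r) (w, 0)
      rw [ha, extDer_zero_left] at h2
      exact h2.symm
    subst h1
    have h2 := U.form_thick p (0, r)
    rw [ha, map_zero] at h2
    have h3 : U.ext.liouvilleForm p.1 (0 : TangentSpace (𝓡∂ (2 * n)) p.1) = 0 := map_zero _
    have h4 : (0 : ℝ) = U.ext.liouvilleForm p.1 (0 : TangentSpace (𝓡∂ (2 * n)) p.1) + r := h2
    rw [h3, zero_add] at h4
    rw [← h4]
    rfl
  exact (injective_iff_map_eq_zero _).2 h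

end ContactSurrounding
end Weinstein

/-! ### Transport of the model from the thickening to the contact manifold. -/

section Weinstein

set_option linter.unusedSectionVars false

variable {n : ℕ} [NeZero n]
  {Y : Type*} [TopologicalSpace Y] [ChartedSpace (EuclideanSpace ℝ (Fin (2 * n + 1))) Y]
  [IsManifold (𝓡 (2 * n + 1)) ∞ Y]
  {S : Type*} [TopologicalSpace S] [CompactSpace S] [ChartedSpace (EuclideanHalfSpace (2 * n)) S]
  [IsManifold (𝓡∂ (2 * n)) ∞ S] {ξ : PlaneField (𝓡 (2 * n + 1)) Y}

namespace ContactSurrounding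

variable {W : WeinsteinHypersurface S ξ}
  {S' : Type*} [TopologicalSpace S'] [CompactSpace S']
  [ChartedSpace (EuclideanHalfSpace (2 * n)) S'] [IsManifold (𝓡∂ (2 * n)) ∞ S']
  {B : Type*} [TopologicalSpace B] [ChartedSpace (EuclideanSpace ℝ (Fin (2 * n - 1))) B]
  [IsManifold (𝓡 (2 * n - 1)) ∞ B] (U : ContactSurrounding W S' B)

theorem h_of_mem_boundary {x : S'} (hx : x ∈ (𝓡∂ (2 * n)).boundary S') : U.h x = U.ε := by
  rw [← U.collar_end] at hx
  obtain ⟨⟨b, t⟩, ⟨-, ht⟩, rfl⟩ := hx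
  obtain ⟨t₀, ht₀, h⟩ := U.h_end
  have ht' : t = 1 + U.ε := ht
  have h1 := h b t ⟨by rw [ht']; exact ht₀.2.le, ht'.le⟩
  rw [h1, ht']
  ring

/-- A zero of h off Σ would be a minimum. In the interior this contradicts dh(Z) > 0, and on the
boundary h = ε. -/
theorem h_eq_zero_iff (x : S') : U.h x = 0 ↔ U.ext.emb x ∈ W.carrier := by
  refine ⟨fun h0 ↦ ?_, U.h_zero x⟩
  by_contra hx
  have hpos := U.h_increasing x hx
  rcases ModelWithCorners.isInteriorPoint_or_isBoundaryPoint (I := 𝓡∂ (2 * n)) x with h | h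
  · have hmin : IsLocalMin U.h x := Filter.Eventually.of_forall fun z ↦ by
      rw [h0]; exact U.h_nonneg z
    exact hpos.ne' (differential_eq_zero_of_isLocalMin h hmin _)
  · exact U.ε_pos.ne' ((U.h_of_mem_boundary h).symm.trans h0)

/-- On the boundary of the thickening h = ε, so ρ ≥ ε² there. This is why ε² is the upper level of
the well. -/
theorem isInteriorPoint {p : S' × U.interval} (hp : U.radius p < U.ε ^ 2) :
    ((𝓡∂ (2 * n)).prod 𝓘(ℝ, ℝ)).IsInteriorPoint p := by
  have h1 : (𝓡∂ (2 * n)).IsInteriorPoint p.1 := by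
    rcases ModelWithCorners.isInteriorPoint_or_isBoundaryPoint (I := 𝓡∂ (2 * n)) p.1 with h | h
    · exact h
    · have h2 := U.h_of_mem_boundary h
      rw [radius, h2] at hp
      nlinarith [sq_nonneg (p.2 : ℝ)]
  have h2 : p ∈ ((𝓡∂ (2 * n)).prod 𝓘(ℝ, ℝ)).interior (S' × U.interval) := by
    rw [ModelWithCorners.interior_prod]
    exact ⟨h1, BoundarylessManifold.isInteriorPoint⟩
  exact h2

theorem mfderiv_thick_surjective (p : S' × U.interval) : Function.Surjective
    (mfderiv ((𝓡∂ (2 * n)).prod 𝓘(ℝ, ℝ)) (𝓡 (2 * n + 1)) U.thick p) := by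
  have h (A : (EuclideanSpace ℝ (Fin (2 * n)) × ℝ) →L[ℝ] EuclideanSpace ℝ (Fin (2 * n + 1)))
      (hA : Function.Injective A) : Function.Surjective A :=
    (LinearMap.injective_iff_surjective_of_finrank_eq_finrank (f := A.toLinearMap)
      (by rw [Module.finrank_prod, finrank_euclideanSpace_fin, finrank_euclideanSpace_fin,
        Module.finrank_self])).1 hA
  exact h _ (U.mfderiv_thick_injective p)

theorem map_thick_nhds {p : S' × U.interval} (hp : U.radius p < U.ε ^ 2) :
    Filter.map U.thick (𝓝 p) = 𝓝 (U.thick p) :=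
  map_nhds_eq_of_surjective_mfderiv (U.thick_isSmoothEmbedding.contMDiff p)
    (U.isInteriorPoint hp) (U.mfderiv_thick_surjective p)

theorem thick_injective : Function.Injective U.thick :=
  U.thick_isSmoothEmbedding.isEmbedding.injective

/-- The image in `Y` of the open region `h ^ 2 + u ^ 2 < ε ^ 2`. -/
def region : Set Y := U.thick '' {p | U.radius p < U.ε ^ 2}

theorem isOpen_region : IsOpen U.region := by
  refine isOpen_iff_mem_nhds.2 ?_
  rintro _ ⟨p, hp, rfl⟩
  rw [← U.map_thick_nhds hp]
  exact Filter.image_mem_map ((U.contMDiff_radius.continuous.isOpen_preimage _ isOpen_Iio).mem_nhds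
    hp)

/-- The set-theoretic inverse, with the junk value p off the image, is continuous at `thick p`
because `thick` is open at p. It is smooth because `thick` is an immersion and `thick ∘ σ` is the
identity nearby. -/
theorem exists_local_inverse {p : S' × U.interval} (hp : U.radius p < U.ε ^ 2) :
    ∃ σ : Y → S' × U.interval, (∀ q, σ (U.thick q) = q) ∧
      ContMDiffAt (𝓡 (2 * n + 1)) ((𝓡∂ (2 * n)).prod 𝓘(ℝ, ℝ)) ∞ σ (U.thick p) ∧
      ∀ᶠ y in 𝓝 (U.thick p), U.thick (σ y) = y := by
  have h1 : ∀ q, Function.extend U.thick id (fun _ ↦ p) (U.thick q) = q := fun q ↦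
    U.thick_injective.extend_apply _ _ _
  have h3 : ∀ᶠ y in 𝓝 (U.thick p), U.thick (Function.extend U.thick id (fun _ ↦ p) y) = y := by
    rw [← U.map_thick_nhds hp]
    exact Filter.eventually_map.2 (.of_forall fun q ↦ congrArg U.thick (h1 q))
  refine ⟨Function.extend U.thick id fun _ ↦ p, h1, ?_, h3⟩
  refine (ContMDiffAt.iff_comp_isImmersionAt
    (U.thick_isSmoothEmbedding.isImmersion.isImmersionAt _)).2 ⟨?_, ?_⟩
  · rw [ContinuousAt, h1, ← U.map_thick_nhds hp, Filter.tendsto_map'_iff]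
    refine Filter.tendsto_id.congr fun q ↦ (h1 q).symm
  · exact contMDiffAt_id.congr_of_eventuallyEq h3

/-- The function on `Y` which corresponds to a function on the thickening. -/
noncomputable def onY (f : S' × U.interval → ℝ) : Y → ℝ := Function.extend U.thick f 0

theorem onY_thick (f : S' × U.interval → ℝ) (p : S' × U.interval) : U.onY f (U.thick p) = f p :=
  U.thick_injective.extend_apply _ _ _

theorem contMDiffAt_onY {f : S' × U.interval → ℝ}
    (hf : ContMDiff ((𝓡∂ (2 * n)).prod 𝓘(ℝ, ℝ)) 𝓘(ℝ, ℝ) ∞ f) {p : S' × U.interval}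
    (hp : U.radius p < U.ε ^ 2) :
    ContMDiffAt (𝓡 (2 * n + 1)) 𝓘(ℝ, ℝ) ∞ (U.onY f) (U.thick p) := by
  obtain ⟨σ, h1, h2, h3⟩ := U.exists_local_inverse hp
  refine (hf.contMDiffAt.comp (U.thick p) h2).congr_of_eventuallyEq ?_
  filter_upwards [h3] with y hy
  exact (congrArg (U.onY f) hy).symm.trans (U.onY_thick f _)

theorem continuousAt_onY {f : S' × U.interval → ℝ} (hf : Continuous f) {p : S' × U.interval}
    (hp : U.radius p < U.ε ^ 2) : ContinuousAt (U.onY f) (U.thick p) := by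
  rw [ContinuousAt, U.onY_thick, ← U.map_thick_nhds hp, Filter.tendsto_map'_iff]
  exact (hf.continuousAt (x := p)).tendsto.congr fun q ↦ (U.onY_thick f q).symm

theorem differential_onY {f : S' × U.interval → ℝ}
    (hf : ContMDiff ((𝓡∂ (2 * n)).prod 𝓘(ℝ, ℝ)) 𝓘(ℝ, ℝ) ∞ f) {p : S' × U.interval}
    (hp : U.radius p < U.ε ^ 2) (a : EuclideanSpace ℝ (Fin (2 * n)) × ℝ) :
    differential (𝓡 (2 * n + 1)) (U.onY f) (U.thick p)
      (mfderiv ((𝓡∂ (2 * n)).prod 𝓘(ℝ, ℝ)) (𝓡 (2 * n + 1)) U.thick p a) =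
    differential ((𝓡∂ (2 * n)).prod 𝓘(ℝ, ℝ)) f p a := by
  have h1 := mfderiv_comp p ((U.contMDiffAt_onY hf hp).mdifferentiableAt (by simp))
    ((U.thick_isSmoothEmbedding.contMDiff p).mdifferentiableAt (by simp))
  have h2 : U.onY f ∘ U.thick = f := funext (U.onY_thick f)
  rw [h2] at h1
  exact (congrArg (fun A : (EuclideanSpace ℝ (Fin (2 * n)) × ℝ) →L[ℝ] ℝ ↦ A a) h1).symm

/-- The field on `Y` which corresponds to the field `(Z, u ∂ / ∂u)` on the thickening. -/
noncomputable def fieldOnY : (y : Y) → TangentSpace (𝓡 (2 * n + 1)) y :=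
  Function.extend U.thick (fun p ↦ (mfderiv ((𝓡∂ (2 * n)).prod 𝓘(ℝ, ℝ)) (𝓡 (2 * n + 1)) U.thick p
    (U.field p) : EuclideanSpace ℝ (Fin (2 * n + 1)))) 0

theorem fieldOnY_thick (p : S' × U.interval) : U.fieldOnY (U.thick p) =
    mfderiv ((𝓡∂ (2 * n)).prod 𝓘(ℝ, ℝ)) (𝓡 (2 * n + 1)) U.thick p (U.field p) :=
  U.thick_injective.extend_apply _ _ _

/-- The bound |u| ≤ √r < ε keeps the second coordinate in a compact part of the open interval, and
the other factor is compact. -/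
theorem isCompact_sublevel {r : ℝ} (hr : r < U.ε ^ 2) : IsCompact {p | U.radius p ≤ r} := by
  rcases lt_or_ge r 0 with h | h
  · have : {p | U.radius p ≤ r} = ∅ := by
      refine eq_empty_of_forall_notMem fun p hp ↦ ?_
      have h1 : U.radius p ≤ r := hp
      rw [radius] at h1
      nlinarith [sq_nonneg (p.2 : ℝ), sq_nonneg (U.h p.1)]
    rw [this]
    exact isCompact_empty
  · have hs : √r < U.ε := by
      rw [Real.sqrt_lt' U.ε_pos]; exact hr
    have h1 : IsCompact ((fun q : U.interval ↦ (q : ℝ)) ⁻¹' Icc (-√r) √r) := by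
      refine (IsEmbedding.subtypeVal.isInducing.isCompact_preimage_iff ?_).2 isCompact_Icc
      rintro t ⟨h1, h2⟩
      exact ⟨⟨t, ⟨by linarith, by linarith⟩⟩, rfl⟩
    refine (isCompact_univ.prod h1).of_isClosed_subset
      (isClosed_le U.contMDiff_radius.continuous continuous_const) fun p hp ↦ ⟨mem_univ _, ?_⟩
    have h2 : U.radius p ≤ r := hp
    rw [radius] at h2
    exact Real.abs_le_sqrt (by nlinarith [sq_nonneg (U.h p.1)]) |> abs_le.1

theorem thick_sublevel {r : ℝ} (hr : r < U.ε ^ 2) :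
    {y ∈ U.region | U.onY U.radius y ≤ r} = U.thick '' {p | U.radius p ≤ r} := by
  ext y
  constructor
  · rintro ⟨⟨p, -, rfl⟩, hp⟩
    rw [U.onY_thick] at hp
    exact ⟨p, hp, rfl⟩
  · rintro ⟨p, hp, rfl⟩
    exact ⟨⟨p, lt_of_le_of_lt hp hr, rfl⟩, (U.onY_thick _ _).trans_le hp⟩

theorem radius_nonneg (p : S' × U.interval) : 0 ≤ U.radius p := by
  unfold radius; positivity

theorem radius_eq_zero_iff (p : S' × U.interval) :
    U.radius p = 0 ↔ U.ext.emb p.1 ∈ W.carrier ∧ (p.2 : ℝ) = 0 := by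
  rw [← U.h_eq_zero_iff, radius]
  constructor
  · intro h
    constructor <;> nlinarith [sq_nonneg (p.2 : ℝ), sq_nonneg (U.h p.1)]
  · rintro ⟨h1, h2⟩
    rw [h1, h2]
    ring

theorem zeroSet_radius : {y ∈ U.region | U.onY U.radius y = 0} = W.carrier := by
  have hε : (0 : ℝ) < U.ε ^ 2 := pow_pos U.ε_pos 2
  ext y
  constructor
  · rintro ⟨⟨p, -, rfl⟩, hp⟩
    rw [U.onY_thick, U.radius_eq_zero_iff] at hp
    rw [U.thick_zero p hp.2]
    exact hp.1
  · intro hy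
    obtain ⟨x, rfl⟩ := U.subset_ext hy
    let p : S' × U.interval := (x, ⟨0, by simp [U.ε_pos]⟩)
    have h1 : U.radius p = 0 := (U.radius_eq_zero_iff p).2 ⟨hy, rfl⟩
    have h2 : U.thick p = U.ext.emb x := U.thick_zero p rfl
    rw [← h2]
    exact ⟨⟨p, by rw [mem_ofPred_eq, h1]; exact hε, rfl⟩, (U.onY_thick _ _).trans h1⟩

theorem differential_radius_nonneg (x : S') :
    0 ≤ U.h x * differential (𝓡∂ (2 * n)) U.h x (U.ext.liouville x) := by
  rcases (U.h_nonneg x).eq_or_lt with h | h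
  · rw [← h, zero_mul]
  · exact (mul_pos h (U.h_increasing x fun hx ↦ h.ne' (U.h_zero x hx))).le

theorem differential_radius_pos {p : S' × U.interval} (hp : 0 < U.radius p) :
    0 < differential ((𝓡∂ (2 * n)).prod 𝓘(ℝ, ℝ)) U.radius p (U.field p) := by
  rw [U.differential_radius]
  by_cases hu : (p.2 : ℝ) = 0
  · have h1 : U.h p.1 ≠ 0 := fun h ↦ by
      rw [radius, h, hu] at hp
      simp at hp
    have h2 := U.h_increasing p.1 fun hx ↦ h1 (U.h_zero _ hx)
    have h3 : 0 < U.h p.1 := lt_of_le_of_ne (U.h_nonneg _) (Ne.symm h1)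
    have h4 := mul_pos h3 h2
    rw [hu]
    linarith
  · have h1 := U.differential_radius_nonneg p.1
    have h2 : 0 < (p.2 : ℝ) ^ 2 := by positivity
    linarith

end ContactSurrounding
end Weinstein

/-! ### One-sided uniqueness of integral curves. -/

section Curves

set_option linter.unusedSectionVars false

variable {E : Type*} [NormedAddCommGroup E] [NormedSpace ℝ E]
  {H : Type*} [TopologicalSpace H] {I : ModelWithCorners ℝ E H}
  {M : Type*} [TopologicalSpace M] [ChartedSpace H M] [IsManifold I ∞ M]

/-- Uniqueness of integral curves for positive times. -/
theorem eqOn_of_isMIntegralCurveOn_Icc [I.Boundaryless] [T2Space M]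
    {X : (y : M) → TangentSpace I y} (hX : IsSmoothField I X) {γ c : ℝ → M}
    (hγ : IsMIntegralCurve γ X) {T : ℝ} (hT : 0 < T) (hc : IsMIntegralCurveOn c X (Icc 0 T))
    (h0 : c 0 = γ 0) : EqOn γ c (Ico 0 T) := by
  have hv : ContMDiff I I.tangent 1 (fun y ↦ (⟨y, X y⟩ : TangentBundle I M)) :=
    hX.contMDiff.of_le (by exact_mod_cast le_top)
  -- Uniqueness is applied on an open interval around 0, so c is prolonged to negative times by γ.
  set δ : ℝ → M := fun r ↦ if r ≤ 0 then γ r else c r with hδ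
  have hle : ∀ r ≤ 0, δ r = γ r := fun r hr ↦ if_pos hr
  have hge : ∀ r, 0 ≤ r → δ r = c r := by
    intro r hr
    rcases hr.eq_or_lt with rfl | h
    · rw [hle 0 le_rfl, h0]
    · exact if_neg (not_le.2 h)
  have hl : ∀ r ≤ 0, HasMFDerivWithinAt 𝓘(ℝ, ℝ) I δ (Iic 0) r
      ((1 : ℝ →L[ℝ] ℝ).smulRight (X (δ r))) := by
    intro r hr
    rw [hle r hr]
    exact (hγ r).hasMFDerivWithinAt.congr_mono (fun x hx ↦ hle x hx) (hle r hr) (subset_univ _)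
  have hr : ∀ r ∈ Icc 0 T, HasMFDerivWithinAt 𝓘(ℝ, ℝ) I δ (Icc 0 T) r
      ((1 : ℝ →L[ℝ] ℝ).smulRight (X (δ r))) := by
    intro r hr
    rw [hge r hr.1]
    exact (hc r hr).congr_mono (fun x hx ↦ hge x hx.1) (hge r hr.1) Subset.rfl
  have hδX : IsMIntegralCurveOn δ X (Ioo (-1) T) := by
    intro r hrm
    refine HasMFDerivAt.hasMFDerivWithinAt ?_
    rcases lt_trichotomy r 0 with h | h | h
    · exact (hl r h.le).hasMFDerivAt (Iic_mem_nhds h)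
    · subst h
      refine ((hl 0 le_rfl).union (hr 0 ⟨le_rfl, hT.le⟩)).hasMFDerivAt ?_
      rw [Iic_union_Icc_eq_Iic hT.le]
      exact Iic_mem_nhds hT
    · exact (hr r ⟨h.le, hrm.2.le⟩).hasMFDerivAt (Icc_mem_nhds h hrm.2)
  have h1 := isMIntegralCurveOn_Ioo_eqOn_of_contMDiff_boundaryless (t₀ := 0)
    ⟨by norm_num, hT⟩ hv (hγ.isMIntegralCurveOn _) hδX (hle 0 le_rfl).symm
  exact fun r hr' ↦ (h1 ⟨by linarith [hr'.1], hr'.2⟩).trans (hge r hr'.1)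

end Curves

/-! ### The core, and the contact well of a surrounding. -/

section Weinstein

set_option linter.unusedSectionVars false

variable {n : ℕ} [NeZero n]
  {Y : Type*} [TopologicalSpace Y] [ChartedSpace (EuclideanSpace ℝ (Fin (2 * n + 1))) Y]
  [IsManifold (𝓡 (2 * n + 1)) ∞ Y]
  {S : Type*} [TopologicalSpace S] [CompactSpace S] [ChartedSpace (EuclideanHalfSpace (2 * n)) S]
  [IsManifold (𝓡∂ (2 * n)) ∞ S] {ξ : PlaneField (𝓡 (2 * n + 1)) Y}

namespace ContactSurrounding

variable {W : WeinsteinHypersurface S ξ}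
  {S' : Type*} [TopologicalSpace S'] [CompactSpace S']
  [ChartedSpace (EuclideanHalfSpace (2 * n)) S'] [IsManifold (𝓡∂ (2 * n)) ∞ S']
  {B : Type*} [TopologicalSpace B] [ChartedSpace (EuclideanSpace ℝ (Fin (2 * n - 1))) B]
  [IsManifold (𝓡 (2 * n - 1)) ∞ B] (U : ContactSurrounding W S' B)

/-- The Liouville field of a hypersurface is that of any hypersurface containing it. -/
theorem mfderiv_emb_liouville (s : S) (x : S') (hx : U.ext.emb x = W.emb s) :
    (mfderiv (𝓡∂ (2 * n)) (𝓡 (2 * n + 1)) U.ext.emb x (U.ext.liouville x) :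
      EuclideanSpace ℝ (Fin (2 * n + 1))) =
    mfderiv (𝓡∂ (2 * n)) (𝓡 (2 * n + 1)) W.emb s (W.liouville s) := by
  choose j hj using fun s : S ↦ U.subset_ext (mem_range_self s)
  have hej : U.ext.emb ∘ j = W.emb := funext hj
  have hjx : j s = x := U.ext.isSmoothEmbedding.isEmbedding.injective ((hj s).trans hx.symm)
  subst hjx
  have hjc : Continuous j := by
    rw [U.ext.isSmoothEmbedding.isEmbedding.continuous_iff, hej]
    exact W.isSmoothEmbedding.contMDiff.continuous
  have hjs : ContMDiff (𝓡∂ (2 * n)) (𝓡∂ (2 * n)) ∞ j := by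
    refine (ContMDiff.iff_comp_isImmersion U.ext.isSmoothEmbedding.isImmersion).2 ⟨hjc, ?_⟩
    rw [hej]
    exact W.isSmoothEmbedding.contMDiff
  have hd := mfderiv_comp s ((U.ext.isSmoothEmbedding.contMDiff (j s)).mdifferentiableAt (by simp))
    ((hjs s).mdifferentiableAt (by simp))
  rw [hej] at hd
  have hd' : ∀ v : EuclideanSpace ℝ (Fin (2 * n)),
      (mfderiv (𝓡∂ (2 * n)) (𝓡 (2 * n + 1)) W.emb s v : EuclideanSpace ℝ (Fin (2 * n + 1))) =
      mfderiv (𝓡∂ (2 * n)) (𝓡 (2 * n + 1)) U.ext.emb (j s)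
        (mfderiv (𝓡∂ (2 * n)) (𝓡∂ (2 * n)) j s v) := fun v ↦
    congrArg (fun A : EuclideanSpace ℝ (Fin (2 * n)) →L[ℝ] EuclideanSpace ℝ (Fin (2 * n + 1)) ↦ A v)
      hd
  -- The two hypersurfaces have equal dimension, so testing against vectors tangent to Σ determines
  -- the Liouville field of Σ̃ at points of Σ.
  have hsurj : Function.Surjective (mfderiv (𝓡∂ (2 * n)) (𝓡∂ (2 * n)) j s) := by
    have h (A : EuclideanSpace ℝ (Fin (2 * n)) →L[ℝ] EuclideanSpace ℝ (Fin (2 * n)))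
        (hA : Function.Injective A) : Function.Surjective A :=
      (LinearMap.injective_iff_surjective (f := A.toLinearMap)).1 hA
    refine h _ fun v w hvw ↦ W.mfderiv_emb_injective s ?_
    exact (hd' v).trans ((congrArg (mfderiv (𝓡∂ (2 * n)) (𝓡 (2 * n + 1)) U.ext.emb (j s))
      hvw).trans (hd' w).symm)
  have hdual : ∀ (y : Y) (α : OneForm (𝓡 (2 * n + 1)) Y), y = W.emb s → α = W.form →
      ∀ a b v : EuclideanSpace ℝ (Fin (2 * n + 1)), ∀ w : EuclideanSpace ℝ (Fin (2 * n)),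
      a = mfderiv (𝓡∂ (2 * n)) (𝓡 (2 * n + 1)) W.emb s (W.liouville s) →
      b = mfderiv (𝓡∂ (2 * n)) (𝓡 (2 * n + 1)) W.emb s w →
      extDer (𝓡 (2 * n + 1)) α y a b = α y b := by
    rintro _ _ rfl rfl _ _ _ w rfl rfl
    exact W.liouville_dual s w
  have hZ : mfderiv (𝓡∂ (2 * n)) (𝓡∂ (2 * n)) j s (W.liouville s) = U.ext.liouville (j s) := by
    refine sub_eq_zero.1 (U.ext.symplectic (j s) _ fun w ↦ ?_)
    obtain ⟨w, rfl⟩ := hsurj w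
    rw [map_sub, extDer_sub_left, U.ext.liouville_dual, sub_eq_zero]
    exact hdual _ _ (hj s) U.ext_form _ _ 0 w (hd' _).symm (hd' _).symm
  exact (congrArg (mfderiv (𝓡∂ (2 * n)) (𝓡 (2 * n + 1)) U.ext.emb (j s)) hZ).symm.trans
    (hd' _).symm

theorem mfderiv_thick_horizontal (p : S' × U.interval) (hp : (p.2 : ℝ) = 0)
    (v : EuclideanSpace ℝ (Fin (2 * n))) :
    (mfderiv ((𝓡∂ (2 * n)).prod 𝓘(ℝ, ℝ)) (𝓡 (2 * n + 1)) U.thick p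
      ((v, (0 : ℝ)) : EuclideanSpace ℝ (Fin (2 * n)) × ℝ) :
      EuclideanSpace ℝ (Fin (2 * n + 1))) =
    mfderiv (𝓡∂ (2 * n)) (𝓡 (2 * n + 1)) U.ext.emb p.1 v := by
  obtain ⟨x, q⟩ := p
  have h1 : U.thick ∘ (fun x : S' ↦ (x, q)) = U.ext.emb := funext fun x ↦ U.thick_zero (x, q) hp
  have h2 : HasMFDerivAt (𝓡∂ (2 * n)) ((𝓡∂ (2 * n)).prod 𝓘(ℝ, ℝ)) (fun x : S' ↦ (x, q)) x _ :=
    (hasMFDerivAt_id x).prodMk (hasMFDerivAt_const q x)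
  have h3 := (HasMFDerivAt.comp x ((U.thick_isSmoothEmbedding.contMDiff (x, q)).mdifferentiableAt
    (by simp)).hasMFDerivAt h2).mfderiv
  rw [h1] at h3
  exact (congrArg (fun A : EuclideanSpace ℝ (Fin (2 * n)) →L[ℝ]
    EuclideanSpace ℝ (Fin (2 * n + 1)) ↦ A v) h3).symm

/-- On `W` the field `(Z, u ∂ / ∂u)` is the Liouville field of `W`. -/
theorem fieldOnY_emb (s : S) : (U.fieldOnY (W.emb s) : EuclideanSpace ℝ (Fin (2 * n + 1))) =
    mfderiv (𝓡∂ (2 * n)) (𝓡 (2 * n + 1)) W.emb s (W.liouville s) := by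
  obtain ⟨x, hx⟩ := U.subset_ext (mem_range_self s)
  let p : S' × U.interval := (x, ⟨0, by simp [U.ε_pos]⟩)
  have h1 : U.thick p = W.emb s := (U.thick_zero p rfl).trans hx
  have h2 := congrArg (fun y ↦ (U.fieldOnY y : EuclideanSpace ℝ (Fin (2 * n + 1)))) h1
  refine h2.symm.trans ((U.fieldOnY_thick p).trans ?_)
  exact (U.mfderiv_thick_horizontal p rfl (U.ext.liouville x)).trans
    (U.mfderiv_emb_liouville s x hx)

variable {X : (y : Y) → TangentSpace (𝓡 (2 * n + 1)) y}

/-- On Σ the field X is the Liouville field, so the curve lifts to an integral curve of Z in S for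
all times. -/
theorem mem_core_of_isMIntegralCurve (hX : IsSmoothField (𝓡 (2 * n + 1)) X)
    (hXQ : ∀ y ∈ W.carrier, X y = U.fieldOnY y) {γ : ℝ → Y} (hγ : IsMIntegralCurve γ X)
    (hγW : ∀ t, γ t ∈ W.carrier) : γ 0 ∈ W.core := by
  choose s hs using hγW
  have hes : W.emb ∘ s = γ := funext hs
  have hsc : Continuous s := by
    rw [W.isSmoothEmbedding.isEmbedding.continuous_iff, hes]
    exact hγ.continuous
  have hsZ : IsMIntegralCurve s W.liouville := by
    intro t
    have h1 : MDifferentiableAt 𝓘(ℝ, ℝ) (𝓡∂ (2 * n)) s t := by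
      refine mdifferentiableAt_lift hsc.continuousAt
        (W.isSmoothEmbedding.isImmersion.isImmersionAt (s t)) ?_
      rw [hes]
      exact contMDiff_one_of_isMIntegralCurve hX hγ t
    have h2 := (HasMFDerivAt.comp t ((W.isSmoothEmbedding.contMDiff (s t)).mdifferentiableAt
      (by simp)).hasMFDerivAt h1.hasMFDerivAt).mfderiv
    rw [hes, (hγ t).mfderiv] at h2
    refine h1.hasMFDerivAt.congr_mfderiv ?_
    have h3 : (X (γ t) : EuclideanSpace ℝ (Fin (2 * n + 1))) =
        mfderiv (𝓡∂ (2 * n)) (𝓡 (2 * n + 1)) W.emb (s t)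
          (mfderiv 𝓘(ℝ, ℝ) (𝓡∂ (2 * n)) s t (1 : ℝ)) := by
      have h4 := congrArg (fun A : ℝ →L[ℝ] EuclideanSpace ℝ (Fin (2 * n + 1)) ↦ A 1) h2
      exact (one_smul ℝ (X (γ t) : EuclideanSpace ℝ (Fin (2 * n + 1)))).symm.trans h4
    have h4 : (X (γ t) : EuclideanSpace ℝ (Fin (2 * n + 1))) =
        mfderiv (𝓡∂ (2 * n)) (𝓡 (2 * n + 1)) W.emb (s t) (W.liouville (s t)) := by
      refine Eq.trans ?_ (U.fieldOnY_emb (s t))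
      have h5 : ∀ y, y = γ t → (X (γ t) : EuclideanSpace ℝ (Fin (2 * n + 1))) = U.fieldOnY y := by
        rintro _ rfl
        exact hXQ _ ⟨s t, hs t⟩
      exact h5 _ (hs t)
    have h5 : mfderiv 𝓘(ℝ, ℝ) (𝓡∂ (2 * n)) s t (1 : ℝ) = W.liouville (s t) :=
      W.mfderiv_emb_injective (s t) (h3.symm.trans h4)
    have h6 : ∀ (A : ℝ →L[ℝ] EuclideanSpace ℝ (Fin (2 * n))) (v : EuclideanSpace ℝ (Fin (2 * n))),
        A 1 = v → A = (1 : ℝ →L[ℝ] ℝ).smulRight v := by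
      rintro A _ rfl
      ext
      simp
    exact h6 _ _ h5
  -- `flowImage` asks for a curve on [-t, 0] starting at the point, hence the shift by t.
  refine ⟨s 0, mem_iInter.2 fun t ↦ ⟨fun r ↦ s (r + t), ?_, ?_⟩, hs 0⟩
  · exact (hsZ.comp_add (t : ℝ)).isMIntegralCurveOn _
  · simp

/-- A core point has Liouville trajectories in Σ of every length; by uniqueness they are pieces of
γ. -/
theorem mem_carrier_of_mem_core [T2Space Y] (hX : IsSmoothField (𝓡 (2 * n + 1)) X)
    (hXQ : ∀ y ∈ W.carrier, X y = U.fieldOnY y) {γ : ℝ → Y} (hγ : IsMIntegralCurve γ X)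
    (h0 : γ 0 ∈ W.core) {t : ℝ} (ht : 0 ≤ t) : γ t ∈ W.carrier := by
  obtain ⟨s, hs, hs0⟩ := h0
  -- One unit more than t, since the curves are compared on a half-open interval that must contain
  -- t.
  have hT : 0 < t + 1 := by linarith
  obtain ⟨c, hc, hcs⟩ := mem_iInter.1 hs ⟨t + 1, hT⟩
  have hcX : IsMIntegralCurveOn (fun r ↦ W.emb (c (r + -(t + 1)))) X (Icc 0 (t + 1)) := by
    intro r hr
    have h1 := hc.comp_add (-(t + 1)) r ⟨by change -(t + 1) ≤ r + -(t + 1); linarith [hr.1],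
      by change r + -(t + 1) ≤ 0; linarith [hr.2]⟩
    have h2 := ((W.isSmoothEmbedding.contMDiff (c (r + -(t + 1)))).mdifferentiableAt
      (by simp)).hasMFDerivAt
    have h3 := HasMFDerivAt.comp_hasMFDerivWithinAt r h2 h1
    refine (h3.mono ?_).congr_mfderiv ?_
    · intro r hr
      exact ⟨by change -(t + 1) ≤ r + -(t + 1); linarith [hr.1],
        by change r + -(t + 1) ≤ 0; linarith [hr.2]⟩
    · have h4 : (X (W.emb (c (r + -(t + 1)))) : EuclideanSpace ℝ (Fin (2 * n + 1))) =
          mfderiv (𝓡∂ (2 * n)) (𝓡 (2 * n + 1)) W.emb (c (r + -(t + 1)))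
            (W.liouville (c (r + -(t + 1)))) :=
        (hXQ _ (mem_range_self _)).trans (U.fieldOnY_emb _)
      have h5 : ∀ (A : EuclideanSpace ℝ (Fin (2 * n)) →L[ℝ] EuclideanSpace ℝ (Fin (2 * n + 1)))
          (v : EuclideanSpace ℝ (Fin (2 * n))) (w : EuclideanSpace ℝ (Fin (2 * n + 1))),
          w = A v → A.comp ((1 : ℝ →L[ℝ] ℝ).smulRight v) = (1 : ℝ →L[ℝ] ℝ).smulRight w := by
        rintro A v _ rfl
        ext
        simp
      exact h5 _ _ _ h4
  have h1 := eqOn_of_isMIntegralCurveOn_Icc hX hγ hT hcX (by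
    simp only [zero_add, hcs, hs0]) ⟨ht, by linarith⟩
  rw [h1]
  exact mem_range_self _

/-- With Q = Z + u ∂_u: λ(Q) = λ_Σ(Z) + u = u, ι_Q dλ = ι_Z dλ_Σ = λ_Σ = λ - du, and dρ(Q) = 2h
dh(Z) + 2u². The zero set of ρ is Σ, where Q is the Liouville field, so the orbits that stay there
describe the core. -/
theorem isContactWell [T2Space Y] : IsContactWell (𝓡 (2 * n + 1)) W.form U.region (U.onY U.radius)
    (U.onY fun p ↦ (p.2 : ℝ)) U.fieldOnY (U.ε ^ 2) W.core where
  isOpen := U.isOpen_region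
  smooth_rho := by
    rintro _ ⟨p, hp, rfl⟩
    exact (U.contMDiffAt_onY U.contMDiff_radius hp).contMDiffWithinAt
  smooth_u := by
    rintro _ ⟨p, hp, rfl⟩
    exact (U.contMDiffAt_onY U.contMDiff_coord hp).contMDiffWithinAt
  nonneg := by
    rintro _ ⟨p, -, rfl⟩
    exact (U.radius_nonneg p).trans_eq (U.onY_thick _ _).symm
  isCompact r hr := by
    rw [U.thick_sublevel hr]
    exact (U.isCompact_sublevel hr).image U.thick_isSmoothEmbedding.contMDiff.continuous
  apply_eq := by
    rintro _ ⟨p, -, rfl⟩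
    rw [← U.ext_form, U.fieldOnY_thick, U.onY_thick]
    refine (U.form_thick p (U.ext.liouville p.1, (p.2 : ℝ))).trans ?_
    exact (congrArg (· + (p.2 : ℝ)) (U.ext.liouvilleForm_liouville p.1)).trans (zero_add _)
  extDer_eq := by
    rintro _ ⟨p, hp, rfl⟩ w
    obtain ⟨b, rfl⟩ := U.mfderiv_thick_surjective p w
    rw [← U.ext_form, U.fieldOnY_thick]
    have h1 := U.extDer_thick p (U.ext.liouville p.1, (p.2 : ℝ)) b
    have h2 := U.form_thick p b
    have h3 := U.differential_onY U.contMDiff_coord hp b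
    have h4 := U.ext.liouville_dual p.1 (show EuclideanSpace ℝ (Fin (2 * n)) × ℝ from b).1
    have h5 : differential ((𝓡∂ (2 * n)).prod 𝓘(ℝ, ℝ)) (fun q : S' × U.interval ↦ (q.2 : ℝ)) p b =
        (show EuclideanSpace ℝ (Fin (2 * n)) × ℝ from b).2 :=
      congrArg (fun A : (EuclideanSpace ℝ (Fin (2 * n)) × ℝ) →L[ℝ] ℝ ↦ A b)
        (U.hasMFDerivAt_coord p).mfderiv
    refine (h1.trans h4).trans (Eq.trans ?_ (congrArg₂ (fun p q : ℝ ↦ p - q) h2 (h3.trans h5)).symm)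
    exact (add_sub_cancel_right _ _).symm
  continuousOn := by
    have h1 : ∀ y ∈ U.region, differential (𝓡 (2 * n + 1)) (U.onY U.radius) y (U.fieldOnY y) =
        U.onY (fun p ↦ 2 * U.h p.1 *
          differential (𝓡∂ (2 * n)) U.h p.1 (U.ext.liouville p.1) + 2 * (p.2 : ℝ) ^ 2) y := by
      rintro _ ⟨p, hp, rfl⟩
      rw [U.onY_thick, U.fieldOnY_thick, ← U.differential_radius]
      exact U.differential_onY U.contMDiff_radius hp (U.ext.liouville p.1, (p.2 : ℝ))
    refine ContinuousOn.congr ?_ h1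
    rintro _ ⟨p, hp, rfl⟩
    refine (U.continuousAt_onY ?_ hp).continuousWithinAt
    have h2 := (continuous_differential_apply U.h_smooth U.ext.liouville_smooth).comp
      (continuous_fst (X := S') (Y := U.interval))
    have h3 := U.h_smooth.continuous.comp (continuous_fst (X := S') (Y := U.interval))
    exact ((continuous_const.mul h3).mul h2).add
      (continuous_const.mul (U.contMDiff_coord.continuous.pow 2))
  increasing := by
    rintro _ ⟨p, hp, rfl⟩ h
    rw [U.onY_thick] at h
    rw [U.fieldOnY_thick]
    exact (U.differential_radius_pos h).trans_eq
      (U.differential_onY U.contMDiff_radius hp (U.ext.liouville p.1, (p.2 : ℝ))).symm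
  stationary := by
    rintro _ ⟨p, hp, rfl⟩ h
    rw [U.onY_thick, U.radius_eq_zero_iff, ← U.h_eq_zero_iff] at h
    rw [U.fieldOnY_thick]
    refine (U.differential_onY U.contMDiff_radius hp (U.ext.liouville p.1, (p.2 : ℝ))).trans ?_
    refine (U.differential_radius p).trans ?_
    rw [h.1, h.2]
    ring
  mem_core X hX hXQ γ hγ h :=
    U.mem_core_of_isMIntegralCurve hX (fun y hy ↦ by
      rw [← U.zeroSet_radius] at hy
      exact hXQ y hy.1 hy.2) hγ fun t ↦ U.zeroSet_radius ▸ h t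
  of_mem_core X hX hXQ γ hγ h t ht := by
    have h1 := U.mem_carrier_of_mem_core hX (fun y hy ↦ by
      rw [← U.zeroSet_radius] at hy
      exact hXQ y hy.1 hy.2) hγ h ht
    rwa [← U.zeroSet_radius] at h1

theorem carrier_eq : U.carrier = {y ∈ U.region | U.onY U.radius y ≤ U.δ ^ 2} :=
  (U.thick_sublevel (pow_lt_pow_left₀ U.δ_lt U.δ_pos.le two_ne_zero)).symm

theorem areContactomorphic_compl_core [T2Space Y] [SecondCountableTopology Y] {m : ℝ} (hm : 0 ≤ m)
    (hmε : m < U.ε ^ 2) : AreContactomorphic (𝓡 (2 * n + 1)) ξ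
      {y ∈ U.region | U.onY U.radius y ≤ m}ᶜ W.coreᶜ :=
  U.isContactWell.areContactomorphic W.isContactFormFor hm hmε

theorem isClosed_carrier [T2Space Y] : IsClosed U.carrier := by
  rw [U.carrier_eq]
  exact (U.isContactWell.isCompact _ (pow_lt_pow_left₀ U.δ_lt U.δ_pos.le two_ne_zero)).isClosed

theorem areContactomorphic_carrier_core [T2Space Y] [SecondCountableTopology Y]
    (U : ContactSurrounding W S' B) :
    AreContactomorphic (𝓡 (2 * n + 1)) ξ W.carrierᶜ W.coreᶜ := by
  -- The level m = 0: as ρ is nonnegative, the sublevel set is its zero set Σ.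
  have h1 := U.areContactomorphic_compl_core le_rfl (pow_pos U.ε_pos 2)
  have h2 : {y ∈ U.region | U.onY U.radius y ≤ 0} = W.carrier := by
    rw [← U.zeroSet_radius]
    ext y
    refine and_congr_right fun hy ↦ ⟨fun h ↦ le_antisymm h ?_, fun h ↦ h.le⟩
    exact U.isContactWell.nonneg y hy
  rwa [h2] at h1

theorem areContactomorphic_closure_core [T2Space Y] [SecondCountableTopology Y] :
    AreContactomorphic (𝓡 (2 * n + 1)) ξ (closure U.carrier)ᶜ W.coreᶜ := by
  rw [U.isClosed_carrier.closure_eq, U.carrier_eq]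
  exact U.areContactomorphic_compl_core (sq_nonneg _)
    (pow_lt_pow_left₀ U.δ_lt U.δ_pos.le two_ne_zero)

end ContactSurrounding
end Weinstein
end ContactGeometry

/-! ### The proposition, by comparing both complements with that of the core. -/

theorem mainTheorem1 {n : ℕ} [NeZero n]
    {Y : Type*} [TopologicalSpace Y] [T2Space Y] [SecondCountableTopology Y]
    [ChartedSpace (EuclideanSpace ℝ (Fin (2 * n + 1))) Y] [IsManifold (𝓡 (2 * n + 1)) ∞ Y]
    (ξ : ContactGeometry.PlaneField (𝓡 (2 * n + 1)) Y)
    (_hξ : ContactGeometry.IsContactStructure (𝓡 (2 * n + 1)) ξ)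
    {S : Type*} [TopologicalSpace S] [CompactSpace S]
    [ChartedSpace (EuclideanHalfSpace (2 * n)) S] [IsManifold (𝓡∂ (2 * n)) ∞ S]
    (W : ContactGeometry.WeinsteinHypersurface S ξ)
    {S' : Type*} [TopologicalSpace S'] [CompactSpace S']
    [ChartedSpace (EuclideanHalfSpace (2 * n)) S'] [IsManifold (𝓡∂ (2 * n)) ∞ S']
    {B : Type*} [TopologicalSpace B] [ChartedSpace (EuclideanSpace ℝ (Fin (2 * n - 1))) B]
    [IsManifold (𝓡 (2 * n - 1)) ∞ B]
    (U : ContactGeometry.ContactSurrounding W S' B) :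
    ContactGeometry.AreContactomorphic (𝓡 (2 * n + 1)) ξ (closure U.carrier)ᶜ W.carrierᶜ ∧
    ContactGeometry.AreContactomorphic (𝓡 (2 * n + 1)) ξ W.carrierᶜ W.coreᶜ ∧
    ContactGeometry.AreContactomorphic (𝓡 (2 * n + 1)) ξ (closure U.carrier)ᶜ W.coreᶜ := by
  have h1 := U.areContactomorphic_carrier_core
  have h2 := U.areContactomorphic_closure_core
  exact ⟨h2.trans h1.symm, h1, h2⟩
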